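/- Let $p$ be a prime, let $|\cdot|_p$ be the $p$-adic absolute value on $\overline{\mathbb{Q}}_p$, let $F\subset\overline{\mathbb{Q}}_p$ be a finite extension of $\mathbb{Q}_p$ with ring of integers $\mathcal{O}_F$, and let $E\subseteq F$ be a subfield containing $\mathbb{Q}_p$, with ring of integers $\mathcal{O}_E$, uniformizer $\pi_E$ and residue field of $q'$ elements. Let $f\in\mathcal{O}_E[[X]]$ satisfy $f(X)\equiv\pi_E X \bmod X^2$ and $f(X)\equiv X^{q'}\bmod \pi_E$, and let $\mathcal{F}_{LT}$ be the associated one-dimensional Lubin–Tate formal group over $\mathcal{O}_E$: its group law $L(X,Y)\in\mathcal{O}_E[[X,Y]]$ is the commutative formal group law with $f(L(X,Y))=L(f(X),f(Y))$, so that $[\pi_E](X)=f(X)$. Let $\mathcal{F}_{LT}[\pi_E^\infty]$ be the set of $x\in\overline{\mathbb{Q}}_p$ with $|x|_p<1$ and $[\pi_E^k](x)=(f\circ\cdots\circ f)(x)=0$ for some $k\ge 0$. Let $n\ge 0$, let $I\subseteq\mathcal{O}_F[[X_1,\ldots,X_n]]$ be an ideal, and let $A=\mathcal{O}_F[[X_1,\ldots,X_n]]/I$.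 Then exactly one of the following occurs: 1. The formal scheme $\mathrm{Spf}(A)$ contains a translate of $\mathcal{F}_{LT}$ by a torsion point of $\mathcal{F}_{LT}^n$. That is, there are a point $(\xi_1,\ldots,\xi_n)\in\mathcal{F}_{LT}[\pi_E^\infty]^n$ and a closed immersion of formal groups $h=(h_1,\ldots,h_n):\mathcal{F}_{LT}\to\mathcal{F}_{LT}^n$ over $\mathcal{O}_F$ (power series $h_i\in T\mathcal{O}_F[[T]]$ with $h_i(L(X,Y))=L(h_i(X),h_i(Y))$ for all $i$, and with $h_i'(0)\in\mathcal{O}_F^\times$ for some $i$) such that $$\phi\bigl(L(h_1(T),\xi_1),\ldots,L(h_n(T),\xi_n)\bigr)=0\quad\text{as a power series in } T,\ \text{for all } \phi\in I.$$ 2. There exist a constant $C_I>0$ and a finite set $\mathcal{F}\subset\mathcal{F}_{LT}[\pi_E^\infty]^n$ such that for every $(\zeta_1,\ldots,\zeta_n)\in\mathcal{F}_{LT}[\pi_E^\infty]^n\setminus\mathcal{F}$ there is $\phi\in I$ with $$|\phi(\zeta_1,\ldots,\zeta_n)|_p>C_I.$$ -/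

import Mathlib

open scoped PowerSeries.WithPiTopology

noncomputable section

namespace LubinTateManinMumford

section Integers

variable {p : ℕ} [Fact p.Prime]

/-- The ring of integers `{x ∈ K : |x|_p ≤ 1}` of a subfield `K` of `ℚ̄_p` containing `ℚ_p`. -/
def integers (K : IntermediateField ℚ_[p] (PadicAlgCl p)) : Subring (PadicAlgCl p) where
  carrier := {x | x ∈ K ∧ ‖x‖ ≤ 1}
  mul_mem' := by
    rintro a b ⟨ha, ha'⟩ ⟨hb, hb'⟩
    refine ⟨K.mul_mem ha hb, ?_⟩
    rw [norm_mul]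
    exact mul_le_one₀ ha' (norm_nonneg b) hb'
  one_mem' := ⟨K.one_mem, by simp⟩
  add_mem' := by
    rintro a b ⟨ha, ha'⟩ ⟨hb, hb'⟩
    exact ⟨K.add_mem ha hb, (PadicAlgCl.isNonarchimedean p a b).trans (max_le ha' hb')⟩
  zero_mem' := ⟨K.zero_mem, by simp⟩
  neg_mem' := by
    rintro a ⟨ha, ha'⟩
    exact ⟨K.neg_mem ha, by rwa [norm_neg]⟩

/-- The inclusion `𝒪_E → 𝒪_F` for `E ⊆ F`. -/
def integersInclusion {E F : IntermediateField ℚ_[p] (PadicAlgCl p)} (h : E ≤ F) :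
    integers E →+* integers F :=
  Subring.inclusion fun _ hx => ⟨h hx.1, hx.2⟩

/-- `π` is a uniformizer of `K`: it generates the maximal ideal `{x : |x|_p < 1}` of `𝒪_K`. -/
def IsUniformizer {K : IntermediateField ℚ_[p] (PadicAlgCl p)} (π : integers K) : Prop :=
  ∀ x : integers K, ‖(x : PadicAlgCl p)‖ < 1 ↔ π ∣ x

end Integers

section FormalGroups

variable {R : Type*} [CommRing R]

/-- A Lubin-Tate series for `π`: `f ≡ π X mod X²` and `f ≡ X^q mod π`, where `q` is the number of
elements of `R / π`. -/
structure IsLubinTateSeries (π : R) (f : PowerSeries R) : Prop where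
  constantCoeff_eq : PowerSeries.constantCoeff f = 0
  coeff_one_eq : PowerSeries.coeff 1 f = π
  congr_X_pow : ∀ k : ℕ,
    π ∣ PowerSeries.coeff k (f - PowerSeries.X ^ Nat.card (R ⧸ Ideal.span {π}))

/-- `h ∈ T R[[T]]` is an endomorphism of the formal group law `G`: `h(G(X, Y)) = G(h(X), h(Y))`. -/
structure IsEndomorphism (G : FormalGroup R) (h : PowerSeries R) : Prop where
  constantCoeff_eq : PowerSeries.constantCoeff h = 0
  map_add : h.subst G.toPowerSeries =
    G.toPowerSeries.subst
      ![h.subst (MvPowerSeries.X 0 : MvPowerSeries (Fin 2) R),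
        h.subst (MvPowerSeries.X 1 : MvPowerSeries (Fin 2) R)]

/-- `G` is the Lubin-Tate formal group law attached to the Lubin-Tate series `f` for `π`, that is,
the (unique) commutative formal group law of which `f` is an endomorphism. -/
structure IsLubinTateFormalGroup (π : R) (f : PowerSeries R) (G : FormalGroup R) : Prop where
  series : IsLubinTateSeries π f
  comm : G.IsComm
  endomorphism : IsEndomorphism G f

/-- A homomorphism `G → Gⁿ` of formal groups, given by its `n` component series
`h = (h₁(T), …, hₙ(T))`, is a closed immersion (`R[[X₁, …, Xₙ]] → R[[T]]`, `Xᵢ ↦ hᵢ(T)` is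
surjective) precisely when, `R` being local, some `hᵢ` has a unit as its linear coefficient. -/
structure IsEmbedding (G : FormalGroup R) {n : ℕ} (h : Fin n → PowerSeries R) : Prop where
  endomorphism : ∀ i, IsEndomorphism G (h i)
  immersion : ∃ i, IsUnit (PowerSeries.coeff 1 (h i))

end FormalGroups

section Evaluation

/-- The value `φ(x) = ∑_d φ_d x₁^{d₁} ⋯ xₙ^{dₙ}` of a power series at a tuple `x` of elements of a
topological algebra. It is used at tuples in the open unit ball of `ℚ̄_p` and at tuples of power
series over `ℚ̄_p` (with coefficientwise convergence) that have integral coefficients in a finite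
extension of `ℚ_p` and constant terms in the open unit ball; there the sum converges. -/
def eval {R B : Type*} [CommRing R] [CommRing B] [Algebra R B] [TopologicalSpace B] {n : ℕ}
    (φ : MvPowerSeries (Fin n) R) (x : Fin n → B) : B :=
  ∑' d : Fin n →₀ ℕ, algebraMap R B (MvPowerSeries.coeff d φ) * ∏ i, x i ^ d i

/-- The value `f(x) = ∑_k f_k x^k` of a power series in one variable. -/
def evalOne {R B : Type*} [CommRing R] [CommRing B] [Algebra R B] [TopologicalSpace B]
    (f : PowerSeries R) (x : B) : B :=
  ∑' k : ℕ, algebraMap R B (PowerSeries.coeff k f) * x ^ k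

end Evaluation

section Torsion

variable {p : ℕ} [Fact p.Prime] {E F : IntermediateField ℚ_[p] (PadicAlgCl p)}

/-- The set `F_LT[π_E^∞]` of `ℚ̄_p`-valued torsion points: the points `x` of the open unit disc
killed by some `[π_E^k] = f ∘ ⋯ ∘ f`. -/
def torsionPoints (f : PowerSeries (integers E)) : Set (PadicAlgCl p) :=
  {x | ‖x‖ < 1 ∧ ∃ k : ℕ, (evalOne f)^[k] x = 0}

/-- The set `F_LT[π_E^∞]ⁿ` of torsion points of `F_LTⁿ`. -/
def torsionTuples (f : PowerSeries (integers E)) (n : ℕ) : Set (Fin n → PadicAlgCl p) :=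
  {ζ | ∀ i, ζ i ∈ torsionPoints f}

/-- The parametrization `T ↦ (G(h₁(T), ξ₁), …, G(hₙ(T), ξₙ))` of the translate by `ξ` of the image
of `h : G → Gⁿ`, as a tuple of power series over `ℚ̄_p`. -/
def translate (G : FormalGroup (integers E)) {n : ℕ} (h : Fin n → PowerSeries (integers F))
    (ξ : Fin n → PadicAlgCl p) : Fin n → PowerSeries (PadicAlgCl p) :=
  fun i => eval G.toPowerSeries
    ![PowerSeries.map (integers F).subtype (h i), PowerSeries.C (ξ i)]

/-- `Spf(𝒪_F[[X₁, …, Xₙ]]/I)` contains a translate of the formal group `G` by a torsion point `ξ` of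
`Gⁿ`: every element of `I` becomes the zero series on the translate by `ξ` of the image of some
embedding `G → Gⁿ` of formal groups over `𝒪_F`. -/
def ContainsTorsionTranslate (hEF : E ≤ F) (f : PowerSeries (integers E))
    (G : FormalGroup (integers E)) {n : ℕ} (I : Ideal (MvPowerSeries (Fin n) (integers F))) :
    Prop :=
  ∃ ξ ∈ torsionTuples f n, ∃ h : Fin n → PowerSeries (integers F),
    IsEmbedding (G.map (integersInclusion hEF)) h ∧
      ∀ φ ∈ I, eval φ (translate G h ξ) = 0

/-- The ideal `I` is bounded away from zero on the torsion points of `F_LTⁿ` outside a finite set: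
at each of the other torsion points some element of `I` has absolute value larger than a constant
`C > 0` that does not depend on the point. -/
def BoundedAwayFromZero (f : PowerSeries (integers E)) {n : ℕ}
    (I : Ideal (MvPowerSeries (Fin n) (integers F))) : Prop :=
  ∃ C : ℝ, 0 < C ∧ ∃ S : Set (Fin n → PadicAlgCl p), S.Finite ∧ S ⊆ torsionTuples f n ∧
    ∀ ζ ∈ torsionTuples f n \ S, ∃ φ ∈ I, C < ‖eval φ ζ‖

end Torsion

end LubinTateManinMumford

end

set_option linter.unusedSectionVars false

noncomputable section

/-! ### First-order expansions and uniqueness in Lubin and Tate's lemma -/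

namespace MvPowerSeries

variable {σ τ R : Type*} [CommRing R]

/-! The open unit disc of the complete field `ℂ_p` is a module over `O_E` for the formal group law.
This rests on Lubin and Tate's lemma: a series intertwining two Lubin-Tate series for `π` is
determined by its linear part (`eq_of_subst_eq_subst`), and in one variable every linear part occurs
(`exists_subst_eq_subst`).

The two alternatives exclude each other: an embedding carries the infinitely many torsion points
injectively to torsion tuples, so on a contained translate all of `I` vanishes at infinitely many
torsion tuples (`not_boundedAwayFromZero_of_contains`).

Conversely, if `I` is not bounded away from zero, there are torsion tuples `Z_k` of order tending to
infinity at which every element of `I` has norm at most `1/(k+1)`. A point killed by every power of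
`π` that kills a torsion point `ω` is a multiple of `ω`, so all coordinates of `Z_k` are multiples
of one of largest order. The multipliers lie in the compact ring `O_E`; along a subsequence they
converge, and splitting off the limits leaves a tuple of far smaller order. By induction on `n`
(`exists_decomposition`), a subsequence has the form `ξ + B w_k` with `ξ` a fixed torsion tuple, `B`
a matrix with a left inverse over `O_E`, and `w_k` torsion. Since `[π]` raises the norm of a torsion
point to the power `q` until it kills it, the norms of the coordinates of `w_k` tend to 1, at widely
different rates.

For `φ` in `I`, the series `g(T) = φ(ξ + B T)` has coefficients in the integers of a finite
extension, and `g(w_k)` tends to 0. The coefficient norms are discrete, so their maximum is attained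
if `g` is nonzero, and among the largest coefficients the one with colexicographically smallest
exponent dominates at `w_k`; hence `g = 0` (`eq_zero_of_tendsto_ev`). Setting all variables but the
first to zero gives a translate by `ξ` along the first column of `B`, which has a unit entry because
`B` has a left inverse. -/

theorem coeff_mul_eq_zero_of_degree_lt {u v : MvPowerSeries τ R} {d : τ →₀ ℕ}
    (hu : ∀ e : τ →₀ ℕ, e.degree < d.degree → coeff e u = 0) (hv : constantCoeff v = 0) :
    coeff d (u * v) = 0 := by
  classical
  rw [coeff_mul]
  refine Finset.sum_eq_zero fun x hx => ?_
  rw [Finset.HasAntidiagonal.mem_antidiagonal] at hx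
  by_cases h : x.2 = 0
  · rw [h, coeff_zero_eq_constantCoeff_apply, hv, mul_zero]
  · rw [hu, zero_mul]
    have h2 : x.2.degree ≠ 0 := by rwa [Ne, Finsupp.degree_eq_zero_iff]
    have := congrArg Finsupp.degree hx
    rw [map_add] at this
    omega

/-- To first order, `f(a) - f(b)` is `f'(0) (a - b)`. -/
theorem coeff_subst_sub_coeff_subst (f : PowerSeries R) {a b : MvPowerSeries τ R}
    (ha : constantCoeff a = 0) (hb : constantCoeff b = 0) {d : τ →₀ ℕ}
    (hab : ∀ e : τ →₀ ℕ, e.degree < d.degree → coeff e a = coeff e b) :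
    coeff d (f.subst a) - coeff d (f.subst b) =
      PowerSeries.coeff 1 f * (coeff d a - coeff d b) := by
  have ha' := PowerSeries.HasSubst.of_constantCoeff_zero ha
  have hb' := PowerSeries.HasSubst.of_constantCoeff_zero hb
  rw [PowerSeries.coeff_subst ha', PowerSeries.coeff_subst hb',
    ← finsum_sub_distrib (PowerSeries.coeff_subst_finite ha' f d)
      (PowerSeries.coeff_subst_finite hb' f d), finsum_eq_single _ 1]
  · simp [mul_sub]
  · intro n hn
    -- The cofactor of `a - b` in `a ^ n - b ^ n` is homogeneous of degree `n - 1`, so it has no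
    -- constant term when `n ≥ 2`; it is empty when `n = 0`.
    rw [← smul_sub, ← map_sub, ← (Commute.all a b).mul_geom_sum₂, coeff_mul_eq_zero_of_degree_lt,
      smul_zero]
    · intro e he
      rw [map_sub, hab e he, sub_self]
    · rw [map_sum]
      refine Finset.sum_eq_zero fun i hi => ?_
      rw [Finset.mem_range] at hi
      rw [map_mul, map_pow, map_pow, ha, hb, ← pow_add, zero_pow (by omega)]

theorem coeff_subst_of_degree_eq_one (f : PowerSeries R) {a : MvPowerSeries τ R}
    (ha : constantCoeff a = 0) {d : τ →₀ ℕ} (hd : d.degree = 1) :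
    coeff d (f.subst a) = PowerSeries.coeff 1 f * coeff d a := by
  classical
  have h := coeff_subst_sub_coeff_subst f ha (map_zero _) (d := d) (fun e he => by
    have : e = 0 := by
      rwa [hd, Nat.lt_one_iff, Finsupp.degree_eq_zero_iff] at he
    rw [this, map_zero, coeff_zero_eq_constantCoeff_apply, ha])
  have hd0 : d ≠ 0 := by
    rintro rfl
    simp at hd
  rwa [PowerSeries.subst_zero_eq_C_constantCoeff, map_C, coeff_C, if_neg hd0, map_zero, sub_zero,
    sub_zero] at h

/-- The lowest-degree coefficients of `h(a)` when `aᵢ = c Xᵢ + ⋯`. -/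
theorem coeff_subst_of_X_mul [Finite σ] {h : MvPowerSeries σ R} {u : σ → MvPowerSeries σ R} {c : R}
    (hu : ∀ i, constantCoeff (u i) = c) {d : σ →₀ ℕ}
    (hd : ∀ e : σ →₀ ℕ, e.degree < d.degree → coeff e h = 0) :
    coeff d (h.subst fun i => X i * u i) = c ^ d.degree * coeff d h := by
  classical
  cases nonempty_fintype σ
  rw [coeff_subst (hasSubst_of_constantCoeff_zero fun i => by simp), finsum_eq_single _ d]
  · have : (d.prod fun s e => (X s * u s) ^ e) = monomial d 1 * d.prod fun s e => u s ^ e := by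
      simp_rw [mul_pow]
      rw [Finsupp.prod_mul, monomial_one_eq]
    rw [this, coeff_monomial_mul, if_pos le_rfl, tsub_self, coeff_zero_eq_constantCoeff_apply,
      Finsupp.prod, map_prod, Finsupp.degree_apply]
    simp [hu, Finset.prod_pow_eq_pow_sum, mul_comm]
  · intro e he
    rcases lt_or_ge e.degree d.degree with h1 | h1
    · rw [hd e h1, zero_smul]
    · have : (e.prod fun s k => (X s * u s) ^ k) = monomial e 1 * e.prod fun s k => u s ^ k := by
        simp_rw [mul_pow]
        rw [Finsupp.prod_mul, monomial_one_eq]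
      rw [this, coeff_monomial_mul, if_neg, smul_zero]
      intro h2
      apply he
      obtain ⟨k, rfl⟩ := exists_add_of_le h2
      rw [map_add] at h1
      have : k.degree = 0 := by omega
      have : k = 0 := by rwa [Finsupp.degree_eq_zero_iff] at this
      simp [this]

theorem exists_eq_X_mul {g : PowerSeries R} (hg : PowerSeries.constantCoeff g = 0) :
    ∃ u : PowerSeries R, PowerSeries.constantCoeff u = PowerSeries.coeff 1 g ∧
      g = PowerSeries.X * u := by
  obtain ⟨u, hu⟩ := PowerSeries.X_dvd_iff.mpr hg
  refine ⟨u, ?_, hu⟩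
  rw [hu, mul_comm, PowerSeries.coeff_one_mul]
  simp

/-- This is the shape of substitution in which `coeff_subst_of_X_mul` reads off the lowest-degree
coefficients. -/
theorem exists_subst_X_eq [Finite σ] {g : PowerSeries R} (hg : PowerSeries.constantCoeff g = 0) :
    ∃ u : σ → MvPowerSeries σ R, (∀ i, constantCoeff (u i) = PowerSeries.coeff 1 g) ∧
      ∀ i, g.subst (X i : MvPowerSeries σ R) = X i * u i := by
  obtain ⟨u, hu, rfl⟩ := exists_eq_X_mul hg
  refine ⟨fun i => u.subst (X i : MvPowerSeries σ R), fun i => ?_, fun i => ?_⟩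
  · rw [← hu, PowerSeries.constantCoeff_subst (PowerSeries.HasSubst.X i),
      finsum_eq_single _ 0 (fun n hn => by simp [hn])]
    simp
  · rw [PowerSeries.subst_mul (PowerSeries.HasSubst.X i),
      PowerSeries.subst_X (PowerSeries.HasSubst.X i)]

/-- Uniqueness in Lubin and Tate's lemma: a series intertwining `f` and `g` is determined by
its linear part. -/
theorem eq_of_subst_eq_subst [Finite σ] [IsDomain R] {f g : PowerSeries R} {π : R}
    (hπ : π ≠ 0) (hπ1 : ∀ n ≠ 0, IsUnit (1 - π ^ n)) (hf1 : PowerSeries.coeff 1 f = π)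
    (hg : PowerSeries.constantCoeff g = 0) (hg1 : PowerSeries.coeff 1 g = π)
    {a b : MvPowerSeries σ R} (ha : constantCoeff a = 0) (hb : constantCoeff b = 0)
    (hab : ∀ d : σ →₀ ℕ, d.degree = 1 → coeff d a = coeff d b)
    (hfa : f.subst a = a.subst fun i => g.subst (X i : MvPowerSeries σ R))
    (hfb : f.subst b = b.subst fun i => g.subst (X i : MvPowerSeries σ R)) : a = b := by
  obtain ⟨u, hu, hgu⟩ := exists_subst_X_eq (σ := σ) hg
  simp_rw [hgu] at hfa hfb
  have hs : HasSubst fun i => X i * u i := hasSubst_of_constantCoeff_zero fun i => by simp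
  suffices h : ∀ n : ℕ, ∀ d : σ →₀ ℕ, d.degree = n → coeff d a = coeff d b by
    ext d
    exact h _ d rfl
  intro n
  induction n using Nat.strong_induction_on with
  | _ n ih =>
    rintro d rfl
    rcases Nat.lt_or_ge 1 d.degree with h1 | h1
    · have h2 := coeff_subst_sub_coeff_subst f ha hb (d := d) fun e he => ih _ he e rfl
      have h3 := coeff_subst_of_X_mul (h := a - b) hu (d := d) fun e he => by
        rw [map_sub, ih _ he e rfl, sub_self]
      -- The degree-`d` coefficients give `(π - π ^ d) (a_d - b_d) = 0`, and `π - π ^ d = π (1 - π ^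
      -- (d - 1))` has a unit as second factor.
      rw [subst_sub hs, map_sub, ← hfa, ← hfb, h2, hf1, hg1, map_sub, ← sub_eq_zero,
        ← sub_mul] at h3
      obtain ⟨k, hk⟩ : ∃ k, d.degree = k + 1 := ⟨d.degree - 1, by omega⟩
      rcases mul_eq_zero.mp h3 with h4 | h4
      · rw [hk, pow_succ', ← mul_one_sub, mul_eq_zero, or_iff_right hπ] at h4
        exact absurd h4 (hπ1 k (by omega)).ne_zero
      · exact sub_eq_zero.mp h4
    · interval_cases h : d.degree
      · have : d = 0 := by rwa [Finsupp.degree_eq_zero_iff] at h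
        rw [this, coeff_zero_eq_constantCoeff_apply, coeff_zero_eq_constantCoeff_apply, ha, hb]
      · exact hab d h

end MvPowerSeries

/-! ### Existence in Lubin and Tate's lemma -/

namespace PowerSeries

variable {R : Type*} [CommRing R]

/-- Series over `R` whose reduction is the `q`-power map commute with every series modulo `π`, when
the residue field has `q` elements. -/
theorem dvd_coeff_subst_sub_subst {κ : Type*} [Field κ] [Finite κ] {ρ : R →+* κ} {π : R}
    (hρ : ∀ x, ρ x = 0 ↔ π ∣ x) {f g h : PowerSeries R}
    (hf : f.map ρ = X ^ Nat.card κ) (hg : g.map ρ = X ^ Nat.card κ)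
    (hg0 : constantCoeff g = 0) (hh : constantCoeff h = 0) (k : ℕ) :
    π ∣ coeff k (f.subst h - h.subst g) := by
  cases nonempty_fintype κ
  obtain ⟨p, hp⟩ := CharP.exists κ
  obtain ⟨n, hpp, hn⟩ := FiniteField.card κ p
  have := Fact.mk hpp
  rw [Nat.card_eq_fintype_card, hn] at hf hg
  rw [← hρ, ← coeff_map, map_sub]
  have h1 : (f.subst h).map ρ = (h.map ρ) ^ (p ^ (n : ℕ)) := by
    refine (map_subst (.of_constantCoeff_zero hh) f).trans ?_
    have h0 : HasSubst (h.map ρ) :=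
      HasSubst.of_constantCoeff_zero' (by rw [← coeff_zero_eq_constantCoeff_apply, coeff_map,
        coeff_zero_eq_constantCoeff_apply, hh, map_zero])
    rw [hf]
    exact (subst_pow h0 _ _).trans (by rw [subst_X h0])
  have h2 : (h.subst g).map ρ = (h.map ρ) ^ (p ^ (n : ℕ)) := by
    refine (map_subst (.of_constantCoeff_zero hg0) h).trans ?_
    -- The `q`-power Frobenius is the identity on a field of `q` elements, so this identity becomes
    -- `h(X ^ q) = h(X) ^ q`.
    have h3 := MvPowerSeries.map_iterateFrobenius_expand p hpp.ne_zero (h.map ρ) n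
    have h4 : iterateFrobenius κ p n = RingHom.id κ := by
      ext x
      rw [iterateFrobenius_def, ← hn, FiniteField.pow_card, RingHom.id_apply]
    rw [h4, MvPowerSeries.map_id, RingHom.id_apply] at h3
    rw [← h3]
    change subst (g.map ρ) _ = _
    rw [hg]
    exact (expand_apply (p ^ (n : ℕ)) (pow_ne_zero _ hpp.ne_zero) _).symm
  change coeff k (MvPowerSeries.map ρ _ - MvPowerSeries.map ρ _) = 0
  rw [h1, h2, sub_self, map_zero]

/-- Existence in Lubin and Tate's lemma, in one variable. -/
theorem exists_subst_eq_subst {κ : Type*} [Field κ] [Finite κ] {ρ : R →+* κ} {π : R}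
    (hρ : ∀ x, ρ x = 0 ↔ π ∣ x) (hπ1 : ∀ n ≠ 0, IsUnit (1 - π ^ n)) {f g : PowerSeries R}
    (hf : f.map ρ = X ^ Nat.card κ) (hg : g.map ρ = X ^ Nat.card κ)
    (hf0 : constantCoeff f = 0) (hf1 : coeff 1 f = π)
    (hg0 : constantCoeff g = 0) (hg1 : coeff 1 g = π) (a : R) :
    ∃ h : PowerSeries R, constantCoeff h = 0 ∧ coeff 1 h = a ∧ f.subst h = h.subst g := by
  obtain ⟨u, hu, hgu⟩ := MvPowerSeries.exists_eq_X_mul hg0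
  have hgs : HasSubst g := HasSubst.of_constantCoeff_zero' hg0
  -- Changing `h` first in degree `d` changes the error `f(h) - h(g)` in degree `d` by `π - π ^ d`
  -- times the change of the coefficient.
  have key : ∀ (h h' : PowerSeries R), constantCoeff h = 0 → constantCoeff h' = 0 → ∀ d : ℕ,
      (∀ e < d, coeff e h' = coeff e h) →
      coeff d (f.subst h' - h'.subst g) - coeff d (f.subst h - h.subst g) =
        (π - π ^ d) * (coeff d h' - coeff d h) := by
    intro h h' hh hh' d hd
    have hlt : ∀ e : Unit →₀ ℕ, e.degree < (Finsupp.single () d).degree → e () < d := by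
      intro e he
      rwa [Finsupp.unique_single e, Finsupp.degree_single, Finsupp.degree_single] at he
    have e1 := MvPowerSeries.coeff_subst_sub_coeff_subst (d := Finsupp.single () d) f hh' hh
      (fun e he => by
        have := hd (e ()) (hlt e he)
        rwa [coeff_def rfl] at this)
    have e2 := MvPowerSeries.coeff_subst_of_X_mul (σ := Unit) (h := h' - h) (u := fun _ => u)
      (c := π) (fun i => hu.trans hg1) (d := Finsupp.single () d)
      (fun e he => by
        have := hd (e ()) (hlt e he)
        rw [coeff_def rfl] at this
        rw [map_sub, sub_eq_zero]
        exact this)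
    have e3 : MvPowerSeries.subst (fun i : Unit => MvPowerSeries.X i * u) (h' - h) =
        h'.subst g - h.subst g := by
      rw [← subst_sub hgs]
      conv_rhs => rw [hgu]
      rfl
    rw [e3] at e2
    simp only [Finsupp.degree_single, hf1] at e1 e2
    simp only [map_sub] at e1 e2 ⊢
    change coeff d _ - coeff d _ = _ * (coeff d h' - coeff d h) at e1
    change coeff d _ - coeff d _ = _ * (coeff d h' - coeff d h) at e2
    linear_combination e1 - e2
  let P : ℕ → PowerSeries R → Prop := fun d h => constantCoeff h = 0 ∧ coeff 1 h = a ∧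
    ∀ k ≤ d, coeff k (f.subst h - h.subst g) = 0
  have step : ∀ (d : ℕ) (h : {h // P (d + 1) h}), ∃ h' : {h // P (d + 2) h},
      ∀ k ≤ d + 1, coeff k h'.1 = coeff k h.1 := by
    rintro d ⟨h, hh0, hh1, hh⟩
    obtain ⟨c, hc⟩ := dvd_coeff_subst_sub_subst hρ hf hg hg0 hh0 (d + 2)
    obtain ⟨v, hv⟩ := hπ1 (d + 1) (by omega)
    -- The error in degree `d + 2` is `π c`, and `π - π ^ (d + 2) = π v`; this monomial cancels it
    -- without touching lower degrees.
    let h' := h - monomial (d + 2) (↑v⁻¹ * c)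
    have hlow : ∀ k < d + 2, coeff k h' = coeff k h := by
      intro k hk
      simp only [h', map_sub, coeff_monomial, if_neg hk.ne, sub_zero]
    have h0' : constantCoeff h' = 0 := by
      rw [← coeff_zero_eq_constantCoeff_apply, hlow 0 (by omega),
        coeff_zero_eq_constantCoeff_apply, hh0]
    refine ⟨⟨h', h0', by rw [hlow 1 (by omega), hh1], fun k hk => ?_⟩,
      fun k hk => hlow k (by omega)⟩
    have e := key h h' hh0 h0' k (fun e he => hlow e (by omega))
    rcases Nat.lt_or_ge k (d + 2) with hk' | hk'
    · rw [hh k (by omega), hlow k hk', sub_self, mul_zero, sub_zero] at e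
      exact e
    · obtain rfl : k = d + 2 := by omega
      have e4 : coeff (d + 2) h' - coeff (d + 2) h = -(↑v⁻¹ * c) := by
        simp [h']
      have e5 : π - π ^ (d + 2) = π * v := by rw [hv]; ring
      have e6 : (v : R) * ↑v⁻¹ = 1 := v.mul_inv
      rw [e4, e5, hc] at e
      linear_combination e - π * c * e6
  choose next hnext using step
  have hs1 : HasSubst (C a * X : PowerSeries R) := HasSubst.of_constantCoeff_zero' (by simp)
  -- Compare `a X` with the zero series, whose error is 0: the factor `π - π ^ k` vanishes for `k =
  -- 1`, and for `k = 0` the coefficients agree.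
  have hstart : P 1 (C a * X) := by
    refine ⟨by simp, by simp, fun k hk => ?_⟩
    have e := key 0 (C a * X) (map_zero _) (by simp) k (fun e he => by
      obtain rfl : e = 0 := by omega
      simp)
    have e0 : f.subst (0 : PowerSeries R) - (0 : PowerSeries R).subst g = 0 := by
      have h1 : f.subst (0 : PowerSeries R) = 0 := subst_zero_of_constantCoeff_zero hf0
      have h2 : (0 : PowerSeries R).subst g = 0 := by
        rw [← coe_substAlgHom hgs, map_zero]
      rw [h1, h2, sub_zero]
    rw [e0, map_zero, sub_zero] at e
    rw [e]
    interval_cases k <;> simp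
  let s : (d : ℕ) → {h // P (d + 1) h} := fun d =>
    Nat.rec (motive := fun d => {h // P (d + 1) h}) ⟨_, hstart⟩ (fun d h => next d h) d
  have hs : ∀ d, s (d + 1) = next d (s d) := fun d => rfl
  have hstab : ∀ d m k, k ≤ d + 1 → coeff k (s (d + m)).1 = coeff k (s d).1 := by
    intro d m k hk
    induction m with
    | zero => rfl
    | succ m ih => rw [← add_assoc, hs, hnext _ _ k (by omega), ih]
  -- Stage `k` is never altered again in degrees up to `k + 1`, so the diagonal series agrees with
  -- it there and inherits the vanishing of its error.
  let h : PowerSeries R := mk fun k => coeff k (s k).1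
  have hcoeff : ∀ d k, k ≤ d → coeff k h = coeff k (s d).1 := by
    intro d k hk
    obtain ⟨m, rfl⟩ := exists_add_of_le hk
    rw [hstab k m k (by omega), coeff_mk]
  have hh0 : constantCoeff h = 0 := by
    rw [← coeff_zero_eq_constantCoeff_apply, hcoeff 0 0 le_rfl, coeff_zero_eq_constantCoeff_apply,
      (s 0).2.1]
  refine ⟨h, hh0, by rw [hcoeff 1 1 le_rfl, (s 1).2.2.1], ?_⟩
  rw [← sub_eq_zero]
  ext k
  have e := key (s k).1 h (s k).2.1 hh0 k (fun e he => hcoeff k e he.le)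
  rw [(s k).2.2.2 k (by omega), hcoeff k k le_rfl, sub_self, mul_zero, sub_zero] at e
  rw [e, map_zero]

end PowerSeries

/-! ### Evaluation at topologically nilpotent tuples -/

namespace MvPowerSeries

open WithPiTopology

section Ev

variable {σ τ R R' S S' : Type*} [CommRing R] [CommRing S] [Algebra R S]

/-- The value of a power series at a tuple, as the sum of its terms. -/
def ev [TopologicalSpace S] (x : σ → S) (φ : MvPowerSeries σ R) : S :=
  ∑' d : σ →₀ ℕ, algebraMap R S (coeff d φ) * d.prod fun i e => x i ^ e

theorem ev_map [TopologicalSpace S] [CommRing R'] [Algebra R' S] (ρ : R →+* R')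
    (hρ : ∀ a, algebraMap R' S (ρ a) = algebraMap R S a) (x : σ → S) (φ : MvPowerSeries σ R) :
    ev x (map ρ φ) = ev x φ := by
  simp [ev, hρ]

theorem eval_eq_ev [TopologicalSpace S] {n : ℕ} (φ : MvPowerSeries (Fin n) R) (x : Fin n → S) :
    LubinTateManinMumford.eval φ x = ev x φ := by
  simp only [ev, LubinTateManinMumford.eval]
  refine tsum_congr fun d => ?_
  rw [Finsupp.prod_fintype _ _ fun i => pow_zero _]

theorem evalOne_eq_ev [TopologicalSpace S] (f : PowerSeries R) (x : S) :
    LubinTateManinMumford.evalOne f x = ev (fun _ : Unit => x) f := by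
  simp only [ev, LubinTateManinMumford.evalOne]
  rw [← (Finsupp.uniqueEquiv (M := ℕ) (() : Unit)).symm.tsum_eq]
  refine tsum_congr fun d => ?_
  rw [PowerSeries.coeff]
  simp [Finsupp.uniqueEquiv]

theorem hasEval_of_isTopologicallyNilpotent [TopologicalSpace S] [Finite σ] {x : σ → S}
    (hx : ∀ i, IsTopologicallyNilpotent (x i)) : HasEval x :=
  ⟨hx, by simp [Filter.cofinite_eq_bot]⟩

variable [UniformSpace S] [T2Space S] [CompleteSpace S] [IsUniformAddGroup S] [IsTopologicalRing S]
  [IsLinearTopology S S]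
  [CommRing S'] [Algebra R S'] [UniformSpace S'] [T2Space S'] [CompleteSpace S']
  [IsUniformAddGroup S'] [IsTopologicalRing S'] [IsLinearTopology S' S']

attribute [local instance] DiscreteTopology.instContinuousSMul

/-- The coefficient ring is given the discrete uniformity, so that no topology on `R` has to be
chosen or compared with that of `S`. -/
theorem exists_evalHom [Finite σ] {x : σ → S} (hx : ∀ i, IsTopologicallyNilpotent (x i)) :
    ∃ ψ : MvPowerSeries σ R →ₐ[R] S,
      (∀ φ, HasSum (fun d : σ →₀ ℕ => algebraMap R S (coeff d φ) * d.prod fun i e => x i ^ e)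
        (ψ φ)) ∧
      (∀ i, ψ (X i) = x i) ∧ ∀ φ, constantCoeff φ = 0 → IsTopologicallyNilpotent (ψ φ) := by
  let _ : UniformSpace R := ⊥
  have : DiscreteUniformity R := ⟨rfl⟩
  have hx' := hasEval_of_isTopologicallyNilpotent hx
  refine ⟨aeval hx', fun φ => ?_, fun i => ?_, fun φ hφ => ?_⟩
  · simpa only [Algebra.smul_def] using hasSum_aeval hx' φ
  · rw [← MvPolynomial.coe_X, aeval_coe, MvPolynomial.aeval_X]
  · refine IsTopologicallyNilpotent.map (φ := aeval hx') (continuous_aeval hx') ?_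
    exact LinearTopology.isTopologicallyNilpotent_of_constantCoeff (by rw [hφ]; exact .zero)

/-- Evaluation of power series at a tuple of topologically nilpotent elements. -/
def evalHom [Finite σ] (x : σ → S) (hx : ∀ i, IsTopologicallyNilpotent (x i)) :
    MvPowerSeries σ R →ₐ[R] S :=
  (exists_evalHom hx).choose

variable [Finite σ] {x : σ → S} (hx : ∀ i, IsTopologicallyNilpotent (x i))
include hx

theorem hasSum_evalHom (φ : MvPowerSeries σ R) :
    HasSum (fun d : σ →₀ ℕ => algebraMap R S (coeff d φ) * d.prod fun i e => x i ^ e)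
      (evalHom x hx φ) :=
  (exists_evalHom hx).choose_spec.1 φ

theorem evalHom_apply (φ : MvPowerSeries σ R) : evalHom x hx φ = ev x φ :=
  (hasSum_evalHom hx φ).tsum_eq.symm

theorem hasSum_ev (φ : MvPowerSeries σ R) :
    HasSum (fun d : σ →₀ ℕ => algebraMap R S (coeff d φ) * d.prod fun i e => x i ^ e)
      (ev x φ) := by
  rw [← evalHom_apply hx]
  exact hasSum_evalHom hx φ

theorem ev_X (i : σ) : ev x (X i : MvPowerSeries σ R) = x i := by
  rw [← evalHom_apply hx]
  exact (exists_evalHom hx).choose_spec.2.1 i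

theorem isTopologicallyNilpotent_ev {φ : MvPowerSeries σ R} (hφ : constantCoeff φ = 0) :
    IsTopologicallyNilpotent (ev x φ) := by
  rw [← evalHom_apply hx]
  exact (exists_evalHom hx).choose_spec.2.2 φ hφ

theorem ev_mul (φ ψ : MvPowerSeries σ R) : ev x (φ * ψ) = ev x φ * ev x ψ := by
  simp only [← evalHom_apply hx, map_mul]

theorem ev_add (φ ψ : MvPowerSeries σ R) : ev x (φ + ψ) = ev x φ + ev x ψ := by
  simp only [← evalHom_apply hx, map_add]

theorem ev_zero : ev x (0 : MvPowerSeries σ R) = 0 := by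
  simp only [← evalHom_apply hx, map_zero]

theorem ev_C (a : R) : ev x (C a : MvPowerSeries σ R) = algebraMap R S a := by
  rw [← evalHom_apply hx, c_eq_algebraMap]
  exact (evalHom x hx).commutes a

omit hx in
-- Factor `h = X (h'(0) + X v)` and evaluate. With an ultrametric norm, the linear term then
-- controls the size of the value.
theorem exists_ev_eq_add {h : PowerSeries R} (hh : PowerSeries.constantCoeff h = 0) {x : S}
    (hx : IsTopologicallyNilpotent x) :
    ∃ k : S, ev (fun _ : Unit => x) h =
      algebraMap R S (PowerSeries.coeff 1 h) * x + x ^ 2 * k := by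
  obtain ⟨u, hu, rfl⟩ := exists_eq_X_mul hh
  obtain ⟨v, hv⟩ := PowerSeries.X_dvd_iff.mpr
    (show PowerSeries.constantCoeff (u - PowerSeries.C (PowerSeries.constantCoeff u)) = 0 by simp)
  rw [sub_eq_iff_eq_add] at hv
  have hx' : ∀ _ : Unit, IsTopologicallyNilpotent x := fun _ => hx
  refine ⟨ev (fun _ : Unit => x) v, ?_⟩
  have hX : ev (fun _ : Unit => x) (PowerSeries.X : PowerSeries R) = x := ev_X hx' ()
  have h1 : ev (fun _ : Unit => x) (PowerSeries.X * u) = x * ev (fun _ : Unit => x) u :=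
    (ev_mul hx' _ _).trans (by rw [hX])
  have h2 : ev (fun _ : Unit => x) u = x * ev (fun _ : Unit => x) v +
      algebraMap R S (PowerSeries.constantCoeff u) := by
    refine (congrArg _ hv).trans ((ev_add hx' _ _).trans ?_)
    exact congrArg₂ _ ((ev_mul hx' _ _).trans (by rw [hX])) (ev_C hx' _)
  rw [h1, h2, hu]
  ring

/-- Continuous homomorphisms commute with evaluation. -/
theorem map_ev (ψ : S →+* S') (hψ : Continuous ψ)
    (hψR : ∀ a, ψ (algebraMap R S a) = algebraMap R S' a) (φ : MvPowerSeries σ R) :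
    ψ (ev x φ) = ev (fun i => ψ (x i)) φ := by
  have h1 := (hasSum_ev hx φ).map ψ hψ
  refine h1.tsum_eq.symm.trans (tsum_congr fun d => ?_)
  simp [hψR, Finsupp.prod]

theorem ev_eq_eval₂ [UniformSpace R] [DiscreteUniformity R] (φ : MvPowerSeries σ R) :
    ev x φ = eval₂ (algebraMap R S) x φ :=
  (hasSum_eval₂ (continuous_algebraMap R S) (hasEval_of_isTopologicallyNilpotent hx) φ).tsum_eq

/-- Evaluation is compatible with substitution. -/
theorem ev_subst [Finite τ] {a : τ → MvPowerSeries σ R} (ha : ∀ i, constantCoeff (a i) = 0)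
    (φ : MvPowerSeries τ R) : ev x (φ.subst a) = ev (fun i => ev x (a i)) φ := by
  let _ : UniformSpace R := ⊥
  have : DiscreteUniformity R := ⟨rfl⟩
  have hx' := hasEval_of_isTopologicallyNilpotent hx
  rw [ev_eq_eval₂ hx, ev_eq_eval₂ fun i => isTopologicallyNilpotent_ev hx (ha i),
    eval₂_subst (hasSubst_of_constantCoeff_zero ha) hx']
  simp only [ev_eq_eval₂ hx]

omit hx in
/-- The value of a power series lies in every closed subring that contains the coefficients and
the coordinates. -/
theorem ev_mem {A : Subring S} (hA : IsClosed (A : Set S)) (hR : ∀ a, algebraMap R S a ∈ A)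
    (hx : ∀ i, IsTopologicallyNilpotent (x i)) (hxA : ∀ i, x i ∈ A) (φ : MvPowerSeries σ R) :
    ev x φ ∈ A :=
  hA.mem_of_tendsto (hasSum_ev hx φ) <| .of_forall fun _ => sum_mem fun _ _ =>
    mul_mem (hR _) (prod_mem fun _ _ => pow_mem (hxA _) _)

/-- Evaluation at a tuple is continuous for the product topology. -/
theorem exists_continuous_evalHom (A : Type*) [CommRing A] [Algebra A S] [UniformSpace A]
    [IsUniformAddGroup A] [IsTopologicalRing A] [ContinuousSMul A S] :
    ∃ ψ : MvPowerSeries σ A →+* S, Continuous ψ ∧ (∀ φ, ψ φ = ev x φ) ∧ (∀ i, ψ (X i) = x i) ∧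
      ∀ a, ψ (C a) = algebraMap A S a := by
  have hx' := hasEval_of_isTopologicallyNilpotent hx
  have hs := fun φ => hasSum_aeval (R := A) hx' φ
  refine ⟨(aeval (R := A) hx').toRingHom, continuous_aeval hx', fun φ => ?_, fun i => ?_, fun a => ?_⟩
  · refine (hs φ).tsum_eq.symm.trans (tsum_congr fun d => ?_)
    rw [Algebra.smul_def]
  · change aeval (R := A) hx' (X i) = _
    rw [← MvPolynomial.coe_X, aeval_coe, MvPolynomial.aeval_X]
  · exact (aeval (R := A) hx').commutes a

omit hx in
/-- The value of a power series at the tuple of variables. -/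
theorem ev_X_eq_map [TopologicalSpace R'] [CommRing R'] [Algebra R R'] [T2Space R']
    (φ : MvPowerSeries σ R) :
    ev (X : σ → MvPowerSeries σ R') φ = map (algebraMap R R') φ := by
  refine (tsum_congr fun d => ?_).trans
    (WithPiTopology.hasSum_of_monomials_self (map (algebraMap R R') φ)).tsum_eq
  have h : (d.prod fun i e => (X i : MvPowerSeries σ R') ^ e) = monomial d 1 := by
    rw [Finsupp.prod, monomial_one_eq]
    rfl
  rw [coeff_map, h, algebraMap_apply, ← smul_eq_C_mul, ← map_smul, smul_eq_mul, mul_one]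

end Ev

end MvPowerSeries

/-! ### The shape of a formal group law -/

namespace FormalGroup

open MvPowerSeries

variable {R : Type*} [CommRing R] (G : FormalGroup R)

/-- In `G(T, 0) = T` only the pure powers of the first variable survive. -/
theorem coeff_single_zero (k : ℕ) :
    coeff (Finsupp.single 0 k) G.toPowerSeries = if k = 1 then 1 else 0 := by
  classical
  have h := congrArg (PowerSeries.coeff k) G.Xzero_eq_X
  rw [PowerSeries.coeff_X] at h
  change coeff (Finsupp.single () k) (subst ![(X () : MvPowerSeries Unit R), 0] G.toPowerSeries) = _ at h
  rw [coeff_subst HasSubst.X_zero, finsum_eq_single _ (Finsupp.single 0 k)] at h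
  · rw [← h]
    simp [coeff_X_pow]
  · intro d hd
    rw [Finsupp.prod_fintype _ _ (by simp), Fin.prod_univ_two]
    by_cases h1 : d 1 = 0
    · have : k ≠ d 0 := by
        rintro rfl
        apply hd
        ext i
        fin_cases i <;> simp [h1]
      simp [h1, coeff_X_pow, this]
    · simp [h1]

theorem coeff_single_one (k : ℕ) :
    coeff (Finsupp.single 1 k) G.toPowerSeries = if k = 1 then 1 else 0 := by
  classical
  have h := congrArg (PowerSeries.coeff k) G.zeroX_eq_X
  rw [PowerSeries.coeff_X] at h
  change coeff (Finsupp.single () k) (subst ![0, (X () : MvPowerSeries Unit R)] G.toPowerSeries) = _ at h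
  rw [coeff_subst HasSubst.zero_X, finsum_eq_single _ (Finsupp.single 1 k)] at h
  · rw [← h]
    simp [coeff_X_pow]
  · intro d hd
    rw [Finsupp.prod_fintype _ _ (by simp), Fin.prod_univ_two]
    by_cases h1 : d 0 = 0
    · have : k ≠ d 1 := by
        rintro rfl
        apply hd
        ext i
        fin_cases i <;> simp [h1]
      simp [h1, coeff_X_pow, this]
    · simp [h1]

/-- A formal group law has the form `X + Y + X Y K(X, Y)`. -/
theorem exists_eq_add_add_mul : ∃ K : MvPowerSeries (Fin 2) R,
    G.toPowerSeries = X 0 + X 1 + X 0 * X 1 * K := by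
  classical
  have h0 : ∀ d : Fin 2 →₀ ℕ, d 1 = 0 → d = Finsupp.single 0 (d 0) := by
    intro d hd; ext i; fin_cases i <;> simp [hd]
  have h1 : ∀ d : Fin 2 →₀ ℕ, d 0 = 0 → d = Finsupp.single 1 (d 1) := by
    intro d hd; ext i; fin_cases i <;> simp [hd]
  -- On each axis `G` restricts to the coordinate, so `G - X₀ - X₁` is divisible first by `X₀` and
  -- then by `X₁`.
  obtain ⟨A, hA⟩ : (X 0 : MvPowerSeries (Fin 2) R) ∣ G.toPowerSeries - X 0 - X 1 := by
    rw [X_dvd_iff]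
    intro d hd
    rw [h1 d hd, map_sub, map_sub, coeff_single_one, coeff_X, coeff_X]
    simp [Finsupp.single_eq_single_iff]
  obtain ⟨B, hB⟩ : (X 1 : MvPowerSeries (Fin 2) R) ∣ A := by
    rw [X_dvd_iff]
    intro d hd
    have h2 : coeff (d + Finsupp.single 0 1) (X 0 * A) = coeff d A := by
      rw [add_comm, X_def, coeff_add_monomial_mul, one_mul]
    rw [← h2, ← hA, h0 (d + Finsupp.single 0 1) (by simp [hd]), map_sub, map_sub,
      coeff_single_zero, coeff_X, coeff_X]
    simp only [Finsupp.single_eq_single_iff]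
    simp
  refine ⟨B, ?_⟩
  rw [hB] at hA
  linear_combination hA

variable {τ : Type*}

theorem coeff_subst_of_degree_eq_one {a b : MvPowerSeries τ R} (ha : constantCoeff a = 0)
    (hb : constantCoeff b = 0) {d : τ →₀ ℕ} (hd : d.degree = 1) :
    coeff d (G.toPowerSeries.subst ![a, b]) = coeff d a + coeff d b := by
  obtain ⟨K, hK⟩ := G.exists_eq_add_add_mul
  have hs : HasSubst ![a, b] := hasSubst_of_constantCoeff_zero fun i => by
    fin_cases i <;> simp [ha, hb]
  rw [hK, subst_add hs, subst_add hs, subst_mul hs, subst_mul hs, subst_X hs, subst_X hs]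
  have : coeff d (a * b * subst ![a, b] K) = 0 := by
    rw [mul_assoc]
    refine coeff_mul_eq_zero_of_degree_lt (fun e he => ?_) (by simp [hb])
    rw [hd, Nat.lt_one_iff, Finsupp.degree_eq_zero_iff] at he
    rw [he, coeff_zero_eq_constantCoeff_apply, ha]
  simp only [Matrix.cons_val_zero, Matrix.cons_val_one, map_add, this, _root_.add_zero]

theorem constantCoeff_subst_pair {a b : MvPowerSeries τ R} (ha : constantCoeff a = 0)
    (hb : constantCoeff b = 0) : constantCoeff (G.toPowerSeries.subst ![a, b]) = 0 := by
  refine constantCoeff_subst_eq_zero (hasSubst_of_constantCoeff_zero fun i => ?_) (fun i => ?_)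
    G.zero_constantCoeff <;> fin_cases i <;> simp [ha, hb]

end FormalGroup

/-! ### Lubin-Tate data and the endomorphisms `[a]` -/

/-- A Lubin-Tate formal group law over a discrete valuation ring `R` with finite residue field
and uniformizer `π` (only the properties of `R` that matter are recorded). -/
structure LubinTateData (R : Type*) [CommRing R] where
  π : R
  f : PowerSeries R
  G : FormalGroup R
  isLubinTate : LubinTateManinMumford.IsLubinTateFormalGroup π f G
  ne_zero : π ≠ 0
  isUnit_one_sub : ∀ n ≠ 0, IsUnit (1 - π ^ n)
  isMaximal : (Ideal.span {π}).IsMaximal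
  finite : Finite (R ⧸ Ideal.span {π})

namespace LubinTateData

open MvPowerSeries LubinTateManinMumford

variable {R : Type*} [CommRing R] (D : LubinTateData R)

/-- The number of elements of the residue field. -/
def q : ℕ := Nat.card (R ⧸ Ideal.span {D.π})

theorem map_eq_X_pow {g : PowerSeries R} (hg : IsLubinTateSeries D.π g) :
    g.map (Ideal.Quotient.mk (Ideal.span {D.π})) = PowerSeries.X ^ D.q := by
  rw [← sub_eq_zero]
  ext k
  have := hg.congr_X_pow k
  rw [← Ideal.mem_span_singleton, ← Ideal.Quotient.eq_zero_iff_mem] at this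
  rw [map_zero, ← this, ← PowerSeries.coeff_map, map_sub (PowerSeries.map _),
    map_pow (PowerSeries.map _), PowerSeries.map_X]
  rfl

/-- With `g = f` this yields the endomorphisms `[a]`; with `g = X ^ q + π X` and `a = 1` it will
transport the torsion of an explicit polynomial to `f`. -/
theorem exists_intertwiner {g : PowerSeries R} (hg : IsLubinTateSeries D.π g) (a : R) :
    ∃ h : PowerSeries R, PowerSeries.constantCoeff h = 0 ∧ PowerSeries.coeff 1 h = a ∧
      D.f.subst h = h.subst g := by
  have := D.isMaximal
  have := D.finite
  let _ := Ideal.Quotient.field (Ideal.span {D.π})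
  refine PowerSeries.exists_subst_eq_subst (ρ := Ideal.Quotient.mk (Ideal.span {D.π}))
    (π := D.π) (fun x => ?_) D.isUnit_one_sub (D.map_eq_X_pow D.isLubinTate.series)
    (D.map_eq_X_pow hg) D.isLubinTate.series.constantCoeff_eq D.isLubinTate.series.coeff_one_eq
    hg.constantCoeff_eq hg.coeff_one_eq a
  rw [Ideal.Quotient.eq_zero_iff_mem, Ideal.mem_span_singleton]

/-- The endomorphism `[a]` of the Lubin-Tate group. -/
def endo (a : R) : PowerSeries R := (D.exists_intertwiner D.isLubinTate.series a).choose

theorem constantCoeff_endo (a : R) : constantCoeff (D.endo a) = 0 :=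
  (D.exists_intertwiner D.isLubinTate.series a).choose_spec.1

theorem coeff_one_endo (a : R) : PowerSeries.coeff 1 (D.endo a) = a :=
  (D.exists_intertwiner D.isLubinTate.series a).choose_spec.2.1

theorem f_subst_endo (a : R) : D.f.subst (D.endo a) = (D.endo a).subst D.f :=
  (D.exists_intertwiner D.isLubinTate.series a).choose_spec.2.2

theorem constantCoeff_f : constantCoeff D.f = 0 := D.isLubinTate.series.constantCoeff_eq

section Commutes

variable {σ τ : Type*}

/-- The series `H` intertwines `f` with the coordinatewise action of `f`. -/
def Commutes (H : MvPowerSeries σ R) : Prop :=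
  subst (fun _ : Unit => H) D.f = H.subst fun i => subst (fun _ : Unit => X i) D.f

variable {D}

/-- Closure under composition brings every identity between composites of `G` and the `[a]` within
reach of `Commutes.ext`, where only linear parts are compared. -/
theorem Commutes.subst [Finite σ] [Finite τ] {H : MvPowerSeries τ R} (hH : D.Commutes H)
    (hH0 : constantCoeff H = 0) {a : τ → MvPowerSeries σ R} (ha0 : ∀ i, constantCoeff (a i) = 0)
    (ha : ∀ i, D.Commutes (a i)) : D.Commutes (H.subst a) := by
  have ha' : HasSubst a := hasSubst_of_constantCoeff_zero ha0
  have hfX : ∀ i, HasSubst fun _ : Unit => (X i : MvPowerSeries τ R) :=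
    fun i => hasSubst_of_constantCoeff_zero fun _ => by simp
  have hfX' : ∀ i, HasSubst fun _ : Unit => (X i : MvPowerSeries σ R) :=
    fun i => hasSubst_of_constantCoeff_zero fun _ => by simp
  have hfτ : HasSubst fun i : τ => MvPowerSeries.subst (fun _ : Unit => (X i : MvPowerSeries τ R)) D.f :=
    hasSubst_of_constantCoeff_zero fun i =>
      constantCoeff_subst_eq_zero (hfX i) (fun _ => by simp) D.constantCoeff_f
  have hfσ : HasSubst fun i : σ => MvPowerSeries.subst (fun _ : Unit => (X i : MvPowerSeries σ R)) D.f :=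
    hasSubst_of_constantCoeff_zero fun i =>
      constantCoeff_subst_eq_zero (hfX' i) (fun _ => by simp) D.constantCoeff_f
  unfold Commutes at *
  rw [subst_comp_subst_apply ha' hfσ,
    ← subst_comp_subst_apply (hasSubst_of_constantCoeff_zero fun _ => hH0) ha', hH,
    subst_comp_subst_apply hfτ ha']
  congr 1
  funext i
  rw [subst_comp_subst_apply (hfX i) ha', ← ha i]
  congr 1
  funext _
  rw [subst_X ha']

theorem Commutes.X (i : σ) [Finite σ] : D.Commutes (X i : MvPowerSeries σ R) := by
  unfold Commutes
  rw [subst_X (hasSubst_of_constantCoeff_zero fun i => constantCoeff_subst_eq_zero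
    (hasSubst_of_constantCoeff_zero fun _ => by simp) (fun _ => by simp) D.constantCoeff_f)]

theorem Commutes.of_subst_eq {h : PowerSeries R} (hh : D.f.subst h = h.subst D.f) :
    D.Commutes (h : MvPowerSeries Unit R) := by
  refine hh.trans ?_
  have : (fun i : Unit => MvPowerSeries.subst (fun _ : Unit => (MvPowerSeries.X i :
      MvPowerSeries Unit R)) D.f) = fun _ => D.f := by
    funext i
    exact PowerSeries.X_subst D.f
  rw [this]
  rfl

theorem commutes_endo (a : R) : D.Commutes (σ := Unit) (D.endo a) :=
  Commutes.of_subst_eq (D.f_subst_endo a)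

theorem commutes_f : D.Commutes (σ := Unit) D.f := Commutes.of_subst_eq rfl

theorem commutes_G : D.Commutes D.G.toPowerSeries := by
  refine D.isLubinTate.endomorphism.map_add.trans ?_
  congr 1
  funext i
  fin_cases i <;> rfl

theorem Commutes.ext [IsDomain R] [Finite σ] {a b : MvPowerSeries σ R} (ha : D.Commutes a)
    (hb : D.Commutes b) (ha0 : constantCoeff a = 0) (hb0 : constantCoeff b = 0)
    (hab : ∀ d : σ →₀ ℕ, d.degree = 1 → coeff d a = coeff d b) : a = b :=
  eq_of_subst_eq_subst D.ne_zero D.isUnit_one_sub D.isLubinTate.series.coeff_one_eq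
    D.isLubinTate.series.constantCoeff_eq D.isLubinTate.series.coeff_one_eq ha0 hb0 hab ha hb

theorem constantCoeff_subst_endo {a : R} {H : MvPowerSeries σ R} (hH : constantCoeff H = 0) :
    constantCoeff (subst (fun _ : Unit => H) (D.endo a)) = 0 :=
  constantCoeff_subst_eq_zero (hasSubst_of_constantCoeff_zero fun _ => hH) (fun _ => hH)
    (D.constantCoeff_endo a)

theorem coeff_subst_endo {a : R} {H : MvPowerSeries σ R} (hH : constantCoeff H = 0)
    {d : σ →₀ ℕ} (hd : d.degree = 1) :
    coeff d (subst (fun _ : Unit => H) (D.endo a)) = a * coeff d H := by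
  have := MvPowerSeries.coeff_subst_of_degree_eq_one (D.endo a) hH hd
  rwa [coeff_one_endo] at this

theorem coeff_eq_coeff_one (h : PowerSeries R) {d : Unit →₀ ℕ} (hd : d.degree = 1) :
    coeff d (h : MvPowerSeries Unit R) = PowerSeries.coeff 1 h := by
  rw [Finsupp.unique_single d, Finsupp.degree_single] at hd
  rw [Finsupp.unique_single d]
  exact congrArg (fun n => PowerSeries.coeff n h) hd

variable [IsDomain R]

/-- Both sides commute with `f`, and both have `a` times the linear part of `G` as linear part. The
identities below have the same proof. -/
theorem endo_subst_G (a : R) : subst (fun _ : Unit => D.G.toPowerSeries) (D.endo a) =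
    subst ![subst (fun _ : Unit => X 0) (D.endo a), subst (fun _ : Unit => X 1) (D.endo a)]
      D.G.toPowerSeries := by
  have h0 : ∀ i : Fin 2, constantCoeff (subst (fun _ : Unit => X i) (D.endo a) :
    MvPowerSeries (Fin 2) R) = 0 := fun i => constantCoeff_subst_endo (by simp)
  refine Commutes.ext ((commutes_endo a).subst (D.constantCoeff_endo a)
    (fun _ => D.G.zero_constantCoeff) fun _ => commutes_G)
    (commutes_G.subst D.G.zero_constantCoeff ?_ ?_)
    (constantCoeff_subst_endo D.G.zero_constantCoeff)
    (D.G.constantCoeff_subst_pair (h0 0) (h0 1)) ?_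
  · intro i; fin_cases i <;> simp [h0]
  · intro i
    fin_cases i
    · exact (commutes_endo a).subst (D.constantCoeff_endo a) (fun _ => by simp) fun _ => .X 0
    · exact (commutes_endo a).subst (D.constantCoeff_endo a) (fun _ => by simp) fun _ => .X 1
  · intro d hd
    rw [coeff_subst_endo D.G.zero_constantCoeff hd,
      D.G.coeff_subst_of_degree_eq_one (h0 0) (h0 1) hd, coeff_subst_endo (by simp) hd,
      coeff_subst_endo (by simp) hd, ← mul_add]
    congr 1
    have hX : (D.G.toPowerSeries.subst ![(X 0 : MvPowerSeries (Fin 2) R), X 1]) =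
        D.G.toPowerSeries := by
      have : ![(X 0 : MvPowerSeries (Fin 2) R), X 1] = X := by funext i; fin_cases i <;> rfl
      rw [this, subst_self]
      rfl
    conv_lhs => rw [← hX]
    exact D.G.coeff_subst_of_degree_eq_one (by simp) (by simp) hd

theorem endo_add (a b : R) : (D.endo (a + b) : MvPowerSeries Unit R) =
    subst ![(D.endo a : MvPowerSeries Unit R), D.endo b] D.G.toPowerSeries := by
  refine Commutes.ext (commutes_endo _) (commutes_G.subst D.G.zero_constantCoeff ?_ ?_)
    (D.constantCoeff_endo _)
    (D.G.constantCoeff_subst_pair (D.constantCoeff_endo _) (D.constantCoeff_endo _)) ?_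
  · intro i; fin_cases i <;> exact D.constantCoeff_endo _
  · intro i; fin_cases i <;> exact commutes_endo _
  · intro d hd
    rw [D.G.coeff_subst_of_degree_eq_one (D.constantCoeff_endo _) (D.constantCoeff_endo _) hd]
    iterate 3 rw [coeff_eq_coeff_one _ hd, coeff_one_endo]

theorem endo_mul (a b : R) : (D.endo (a * b) : MvPowerSeries Unit R) =
    subst (fun _ : Unit => (D.endo b : MvPowerSeries Unit R)) (D.endo a) := by
  refine Commutes.ext (commutes_endo _) ((commutes_endo a).subst (D.constantCoeff_endo a)
    (fun _ => D.constantCoeff_endo b) fun _ => commutes_endo b) (D.constantCoeff_endo _)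
    (constantCoeff_subst_endo (D.constantCoeff_endo b)) fun d hd => ?_
  rw [coeff_subst_endo (D.constantCoeff_endo b) hd]
  iterate 2 rw [coeff_eq_coeff_one _ hd, coeff_one_endo]

theorem endo_one : D.endo 1 = PowerSeries.X := by
  refine Commutes.ext (commutes_endo _) (.X ()) (D.constantCoeff_endo _)
    (constantCoeff_X _) fun d hd => ?_
  rw [coeff_eq_coeff_one _ hd, coeff_one_endo]
  exact ((coeff_eq_coeff_one PowerSeries.X hd).trans PowerSeries.coeff_one_X).symm

theorem endo_π : D.endo D.π = D.f := by
  refine Commutes.ext (commutes_endo _) commutes_f (D.constantCoeff_endo _)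
    D.constantCoeff_f fun d hd => ?_
  rw [coeff_eq_coeff_one _ hd, coeff_eq_coeff_one _ hd, coeff_one_endo,
    D.isLubinTate.series.coeff_one_eq]

theorem endo_zero : D.endo 0 = 0 := by
  refine Commutes.ext (commutes_endo _) (b := (0 : MvPowerSeries Unit R)) ?_
    (D.constantCoeff_endo _) (map_zero _) fun d hd => ?_
  · refine Commutes.of_subst_eq ?_
    have h1 : D.f.subst (0 : PowerSeries R) = 0 :=
      PowerSeries.subst_zero_of_constantCoeff_zero D.constantCoeff_f
    rw [h1, ← PowerSeries.coe_substAlgHom (.of_constantCoeff_zero' D.constantCoeff_f), map_zero]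
  · rw [coeff_eq_coeff_one _ hd, coeff_one_endo, map_zero]

end Commutes

end LubinTateData

/-! ### The module of points -/

namespace LubinTateData

open MvPowerSeries

variable {R : Type*} [CommRing R] (D : LubinTateData R)

/-- The topologically nilpotent elements of a topological ring, as points of the Lubin-Tate
group. -/
@[ext]
structure Points (_ : LubinTateData R) (S : Type*) [CommRing S] [UniformSpace S] where
  val : S
  isTopologicallyNilpotent : IsTopologicallyNilpotent val

namespace Points

variable {D} {S S' : Type*} [CommRing S] [Algebra R S] [UniformSpace S] [T2Space S]
  [CompleteSpace S] [IsUniformAddGroup S] [IsTopologicalRing S] [IsLinearTopology S S]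
  [CommRing S'] [Algebra R S'] [UniformSpace S'] [T2Space S'] [CompleteSpace S']
  [IsUniformAddGroup S'] [IsTopologicalRing S'] [IsLinearTopology S' S']

theorem nilpotent_pair (x y : D.Points S) (i : Fin 2) :
    IsTopologicallyNilpotent (![x.val, y.val] i) := by
  fin_cases i
  exacts [x.isTopologicallyNilpotent, y.isTopologicallyNilpotent]

/-- The neutral point. -/
protected def zero : D.Points S := ⟨0, .zero⟩

/-- The sum of two points for the formal group law. -/
protected def add (x y : D.Points S) : D.Points S :=
  ⟨ev ![x.val, y.val] D.G.toPowerSeries,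
    isTopologicallyNilpotent_ev (nilpotent_pair x y) D.G.zero_constantCoeff⟩

/-- The action of the endomorphism `[a]` on points. -/
protected def smul (a : R) (x : D.Points S) : D.Points S :=
  ⟨ev (fun _ : Unit => x.val) (D.endo a),
    isTopologicallyNilpotent_ev (fun _ => x.isTopologicallyNilpotent) (D.constantCoeff_endo a)⟩

instance : Zero (D.Points S) := ⟨Points.zero⟩

instance : Add (D.Points S) := ⟨Points.add⟩

instance : SMul R (D.Points S) := ⟨Points.smul⟩

theorem val_zero : (0 : D.Points S).val = 0 := rfl

theorem val_add (x y : D.Points S) : (x + y).val = ev ![x.val, y.val] D.G.toPowerSeries := rfl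

theorem val_smul (a : R) (x : D.Points S) :
    (a • x).val = ev (fun _ : Unit => x.val) (D.endo a) := rfl

theorem ev_subst_pair {σ : Type*} [Finite σ] {x : σ → S} (hx : ∀ i, IsTopologicallyNilpotent (x i))
    {a b : MvPowerSeries σ R} (ha : constantCoeff a = 0) (hb : constantCoeff b = 0)
    (φ : MvPowerSeries (Fin 2) R) : ev x (φ.subst ![a, b]) = ev ![ev x a, ev x b] φ := by
  rw [ev_subst hx (fun i => by fin_cases i <;> simp [ha, hb])]
  congr 1
  funext i
  fin_cases i <;> rfl

/-- The sum of two points is `x + y + x y k`. -/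
theorem exists_val_add (x y : D.Points S) :
    ∃ k : S, (x + y).val = x.val + y.val + x.val * y.val * k := by
  obtain ⟨K, hK⟩ := D.G.exists_eq_add_add_mul
  have h := nilpotent_pair x y
  refine ⟨ev ![x.val, y.val] K, ?_⟩
  rw [val_add, hK]
  simp [ev_add h, ev_mul h, ev_X h]

variable [IsDomain R]

theorem add_smul' (a b : R) (x : D.Points S) : (a + b) • x = a • x + b • x := by
  refine Points.ext ?_
  rw [val_smul, endo_add, ev_subst_pair (fun _ => x.isTopologicallyNilpotent)
    (D.constantCoeff_endo a) (D.constantCoeff_endo b)]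
  rfl

theorem one_smul' (x : D.Points S) : (1 : R) • x = x := by
  refine Points.ext ?_
  rw [val_smul, endo_one]
  exact ev_X (fun _ => x.isTopologicallyNilpotent) ()

theorem zero_smul' (x : D.Points S) : (0 : R) • x = 0 := by
  refine Points.ext ?_
  rw [val_smul, endo_zero]
  exact ev_zero (fun _ => x.isTopologicallyNilpotent)

/-- The inverse is `[-1]`, so no formal inverse series has to be constructed: `[-1] + [1] = [0] =
0`. -/
instance : Neg (D.Points S) := ⟨fun x => (-1 : R) • x⟩

instance : AddCommGroup (D.Points S) where
  add_assoc x y z := by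
    have h : ∀ i, IsTopologicallyNilpotent (![x.val, y.val, z.val] i) := by
      intro i
      fin_cases i
      exacts [x.isTopologicallyNilpotent, y.isTopologicallyNilpotent, z.isTopologicallyNilpotent]
    have h2 := D.G.zero_constantCoeff
    have e := congrArg (ev ![x.val, y.val, z.val]) D.G.assoc
    have c : ∀ i j : Fin 3, constantCoeff (subst ![(X i : MvPowerSeries (Fin 3) R), X j]
        D.G.toPowerSeries) = 0 := fun i j => D.G.constantCoeff_subst_pair (by simp) (by simp)
    rw [ev_subst_pair h (c 0 1) (by simp), ev_subst_pair h (by simp) (c 1 2),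
      ev_subst_pair h (by simp) (by simp), ev_subst_pair h (by simp) (by simp)] at e
    simp only [ev_X h] at e
    exact Points.ext e
  zero_add x := by
    obtain ⟨k, hk⟩ := exists_val_add 0 x
    exact Points.ext (by rw [hk, val_zero]; ring)
  add_zero x := by
    obtain ⟨k, hk⟩ := exists_val_add x 0
    exact Points.ext (by rw [hk, val_zero]; ring)
  add_comm x y := by
    have h := nilpotent_pair x y
    have e := congrArg (ev ![x.val, y.val]) D.isLubinTate.comm.comm
    rw [ev_subst_pair h (by simp) (by simp), ev_X h, ev_X h] at e
    exact Points.ext e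
  nsmul := nsmulRec
  zsmul := zsmulRec
  neg_add_cancel x := by
    change (-1 : R) • x + x = 0
    nth_rw 2 [← one_smul' x]
    rw [← add_smul', neg_add_cancel, zero_smul']

instance : Module R (D.Points S) where
  one_smul := one_smul'
  mul_smul a b x := by
    refine Points.ext ?_
    rw [val_smul, endo_mul, ev_subst (fun _ => x.isTopologicallyNilpotent)
      (fun _ => D.constantCoeff_endo b)]
    rfl
  smul_zero a := by
    obtain ⟨k, hk⟩ := exists_ev_eq_add (S := S) (D.constantCoeff_endo a) .zero
    exact Points.ext (hk.trans (by rw [val_zero]; ring))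
  smul_add a x y := by
    have h := nilpotent_pair x y
    have e := congrArg (ev ![x.val, y.val]) (D.endo_subst_G a)
    have c : ∀ i : Fin 2, constantCoeff (subst (fun _ : Unit => X i) (D.endo a) :
      MvPowerSeries (Fin 2) R) = 0 := fun i => constantCoeff_subst_endo (by simp)
    rw [ev_subst h (fun _ => D.G.zero_constantCoeff), ev_subst_pair h (c 0) (c 1),
      ev_subst h (by simp), ev_subst h (by simp)] at e
    simp only [ev_X h] at e
    exact Points.ext e
  add_smul := add_smul'
  zero_smul := zero_smul'

/-- A continuous homomorphism of algebras induces a homomorphism on points. -/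
def map (ψ : S →+* S') (hψ : Continuous ψ)
    (hψR : ∀ a, ψ (algebraMap R S a) = algebraMap R S' a) : D.Points S →ₗ[R] D.Points S' where
  toFun x := ⟨ψ x.val, x.isTopologicallyNilpotent.map hψ⟩
  map_add' x y := by
    refine Points.ext ?_
    simp only [val_add]
    rw [map_ev (nilpotent_pair x y) ψ hψ hψR]
    congr 1
    funext i
    fin_cases i <;> rfl
  map_smul' a x := by
    refine Points.ext ?_
    simp only [val_smul, RingHom.id_apply]
    rw [map_ev (fun _ => x.isTopologicallyNilpotent) ψ hψ hψR]

theorem val_π_smul (x : D.Points S) : (D.π • x).val = ev (fun _ : Unit => x.val) D.f := by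
  rw [val_smul, endo_π]

/-- `[a](x)` is `a x` up to a multiple of `x ^ 2`. -/
theorem exists_val_smul (a : R) (x : D.Points S) :
    ∃ k : S, (a • x).val = algebraMap R S a * x.val + x.val ^ 2 * k := by
  obtain ⟨k, hk⟩ := exists_ev_eq_add (D.constantCoeff_endo a) x.isTopologicallyNilpotent
  exact ⟨k, by rw [val_smul, hk, coeff_one_endo]⟩

end Points

end LubinTateData

/-! ### The unit ball of an ultrametric field -/

/-- The ring of integers of an ultrametric normed field. -/
def unitBall (K : Type*) [NormedField K] [IsUltrametricDist K] : Subring K where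
  carrier := {x | ‖x‖ ≤ 1}
  mul_mem' {a b} ha hb := by
    rw [Set.mem_ofPred_eq, norm_mul]
    exact mul_le_one₀ ha (norm_nonneg b) hb
  one_mem' := by simp
  add_mem' {a b} ha hb := (IsUltrametricDist.norm_add_le_max a b).trans (max_le ha hb)
  zero_mem' := by simp
  neg_mem' {a} ha := by rwa [Set.mem_ofPred_eq, norm_neg]

namespace unitBall

variable {K : Type*} [NormedField K] [IsUltrametricDist K]

theorem norm_le_one (x : unitBall K) : ‖x‖ ≤ 1 := x.2

theorem norm_mul (x y : unitBall K) : ‖x * y‖ = ‖x‖ * ‖y‖ := _root_.norm_mul (x : K) y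

theorem norm_pow (x : unitBall K) (n : ℕ) : ‖x ^ n‖ = ‖x‖ ^ n := _root_.norm_pow (x : K) n

instance : IsUltrametricDist (unitBall K) :=
  ⟨fun x y z => dist_triangle_max (x : K) y z⟩

/-- The ideal of elements of norm less than `r`. -/
def ballIdeal (r : {r : ℝ // 0 < r}) : Ideal (unitBall K) where
  carrier := Metric.ball 0 r
  add_mem' {a b} ha hb := by
    rw [mem_ball_zero_iff] at *
    exact (IsUltrametricDist.norm_add_le_max a b).trans_lt (max_lt ha hb)
  zero_mem' := Metric.mem_ball_self r.2
  smul_mem' c x hx := by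
    rw [mem_ball_zero_iff] at *
    rw [smul_eq_mul, norm_mul]
    exact (mul_le_of_le_one_left (norm_nonneg x) (norm_le_one c)).trans_lt hx

instance : IsLinearTopology (unitBall K) (unitBall K) :=
  IsLinearTopology.mk_of_hasBasis' (p := fun _ => True) (s := ballIdeal (K := K)) _
    (Metric.nhds_basis_ball.to_hasBasis (fun r hr => ⟨⟨r, hr⟩, trivial, subset_rfl⟩)
      fun r _ => ⟨r, r.2, subset_rfl⟩) fun _ _ _ hm => Ideal.mul_mem_left _ _ hm

theorem isClosed : IsClosed (unitBall K : Set K) := by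
  have : (unitBall K : Set K) = Metric.closedBall 0 1 := by
    ext x
    simp [unitBall]
  rw [this]
  exact Metric.isClosed_closedBall

instance [CompleteSpace K] : CompleteSpace (unitBall K) := isClosed.completeSpace_coe

theorem isTopologicallyNilpotent_iff {x : unitBall K} : IsTopologicallyNilpotent x ↔ ‖x‖ < 1 := by
  rw [IsTopologicallyNilpotent, tendsto_zero_iff_norm_tendsto_zero]
  simp_rw [norm_pow]
  refine ⟨fun h => ?_, fun h => tendsto_pow_atTop_nhds_zero_of_lt_one (norm_nonneg x) h⟩
  by_contra h1
  have : ‖x‖ = 1 := le_antisymm (norm_le_one x) (not_lt.mp h1)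
  simp [this] at h

theorem norm_add_eq_left {x y : unitBall K} (h : ‖y‖ < ‖x‖) : ‖x + y‖ = ‖x‖ := by
  rw [IsUltrametricDist.norm_add_eq_max_of_norm_ne_norm h.ne', max_eq_left h.le]

theorem norm_mul_one_add {x y : unitBall K} (h : ‖y‖ < 1) : ‖x * (1 + y)‖ = ‖x‖ := by
  have h1 : ‖(1 : unitBall K)‖ = 1 := norm_one (α := K)
  rw [norm_mul, norm_add_eq_left (h1.symm ▸ h), h1, mul_one]

theorem norm_mul_lt_one {x y : unitBall K} (h : ‖x‖ < 1) : ‖x * y‖ < 1 := by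
  rw [norm_mul]
  exact (mul_le_of_le_one_right (norm_nonneg x) (norm_le_one y)).trans_lt h

end unitBall

/-! ### Absolute values of torsion points -/

namespace LubinTateData

open MvPowerSeries

variable {R : Type*} [CommRing R] {D : LubinTateData R}

theorem two_le_q : 2 ≤ D.q := by
  have := D.isMaximal
  have := D.finite
  have : Nontrivial (R ⧸ Ideal.span {D.π}) := Ideal.Quotient.nontrivial_iff.mpr D.isMaximal.ne_top
  exact Finite.one_lt_card

/-- This isolates the two terms `x ^ q` and `π x` that compete for the size of `[π](x)`. -/
theorem exists_f_eq : ∃ u : PowerSeries R,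
    D.f = PowerSeries.X ^ D.q + PowerSeries.C D.π * PowerSeries.X * (1 + PowerSeries.X * u) := by
  have hq := two_le_q (D := D)
  choose g hg using D.isLubinTate.series.congr_X_pow
  have h1 : D.f = PowerSeries.X ^ D.q + PowerSeries.C D.π * PowerSeries.mk
      (fun k => if k = 0 then 0 else if k = 1 then 1 else g k) := by
    ext k
    rw [map_add, PowerSeries.coeff_C_mul, PowerSeries.coeff_mk]
    split_ifs with h0 h1
    · rw [h0, PowerSeries.coeff_X_pow, if_neg (by omega)]
      simp [D.isLubinTate.series.constantCoeff_eq]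
    · rw [h1, PowerSeries.coeff_X_pow, if_neg (by omega), D.isLubinTate.series.coeff_one_eq]
      simp
    · rw [← hg k, map_sub]
      exact (add_sub_cancel _ _).symm
  refine ⟨PowerSeries.mk fun k => g (k + 2), h1.trans ?_⟩
  rw [mul_assoc]
  congr 2
  ext k
  rw [PowerSeries.coeff_mk]
  rcases k with _ | _ | k
  · simp
  · simp [PowerSeries.coeff_succ_X_mul]
  · simp [PowerSeries.coeff_succ_X_mul, PowerSeries.coeff_one]

namespace Points

section

variable {S : Type*} [CommRing S] [Algebra R S] [UniformSpace S] [T2Space S]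
  [CompleteSpace S] [IsUniformAddGroup S] [IsTopologicalRing S] [IsLinearTopology S S] [IsDomain R]

theorem exists_val_π_smul (x : D.Points S) : ∃ k : S, (D.π • x).val =
    x.val ^ D.q + algebraMap R S D.π * x.val * (1 + x.val * k) := by
  obtain ⟨u, hu⟩ := exists_f_eq (D := D)
  have hx : ∀ _ : Unit, IsTopologicallyNilpotent x.val := fun _ => x.isTopologicallyNilpotent
  refine ⟨ev (fun _ : Unit => x.val) u, ?_⟩
  rw [val_π_smul, ← evalHom_apply hx, ← evalHom_apply hx]
  have hX : evalHom (R := R) _ hx (PowerSeries.X : PowerSeries R) = x.val :=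
    (evalHom_apply hx _).trans (ev_X hx ())
  have hC : evalHom (R := R) _ hx (PowerSeries.C D.π : PowerSeries R) = algebraMap R S D.π :=
    (evalHom_apply hx _).trans (ev_C hx _)
  let ψ : PowerSeries R →+* S := (evalHom (R := R) _ hx).toRingHom
  have hX' : ψ PowerSeries.X = x.val := hX
  have hC' : ψ (PowerSeries.C D.π) = algebraMap R S D.π := hC
  change ψ D.f = x.val ^ D.q + algebraMap R S D.π * x.val * (1 + x.val * ψ u)
  rw [hu]
  simp only [map_add, map_mul, map_pow, map_one, hX', hC']

end

variable {K : Type*} [NormedField K] [IsUltrametricDist K] [CompleteSpace K]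
  [Algebra R (unitBall K)] [IsDomain R]

theorem norm_val_lt_one (x : D.Points (unitBall K)) : ‖x.val‖ < 1 :=
  unitBall.isTopologicallyNilpotent_iff.mp x.isTopologicallyNilpotent

theorem val_eq_zero {x : D.Points (unitBall K)} : x.val = 0 ↔ x = 0 :=
  ⟨fun h => Points.ext h, fun h => h ▸ rfl⟩

theorem norm_val_pos {x : D.Points (unitBall K)} (hx : x ≠ 0) : 0 < ‖x.val‖ :=
  norm_pos_iff.mpr fun h => hx (val_eq_zero.mp h)

/-- The distance of two points is the size of their difference. -/
theorem norm_val_sub (x y : D.Points (unitBall K)) : ‖(x - y).val‖ = ‖x.val - y.val‖ := by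
  obtain ⟨k, hk⟩ := exists_val_add (x - y) y
  rw [sub_add_cancel] at hk
  have : x.val - y.val = (x - y).val * (1 + y.val * k) := by
    rw [hk]
    ring
  rw [this, unitBall.norm_mul_one_add (unitBall.norm_mul_lt_one y.norm_val_lt_one)]

instance : AddCommGroup (D.Points (unitBall K)) := inferInstance

instance : Module R (D.Points (unitBall K)) := inferInstance

instance : DistribSMul R (D.Points (unitBall K)) := inferInstance

instance : SMulZeroClass R (D.Points (unitBall K)) := inferInstance

/-- The absolute value of the uniformizer. -/
local notation "ρ" => ‖algebraMap R (unitBall K) D.π‖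

/-- A point is torsion if it is killed by a power of the uniformizer. -/
def IsTorsion (x : D.Points (unitBall K)) : Prop := ∃ N : ℕ, D.π ^ N • x = 0

theorem IsTorsion.smul {x : D.Points (unitBall K)} (hx : x.IsTorsion) (a : R) :
    (a • x).IsTorsion := by
  obtain ⟨N, hN⟩ := hx
  exact ⟨N, by rw [smul_comm, hN, smul_zero]⟩

theorem pow_smul_eq_zero_of_le {x : D.Points (unitBall K)} {M N : ℕ} (hMN : M ≤ N)
    (h : D.π ^ M • x = 0) : D.π ^ N • x = 0 := by
  obtain ⟨k, rfl⟩ := exists_add_of_le hMN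
  rw [pow_add, mul_comm, mul_smul, h, smul_zero]

theorem IsTorsion.add {x y : D.Points (unitBall K)} (hx : x.IsTorsion) (hy : y.IsTorsion) :
    (x + y).IsTorsion := by
  obtain ⟨N, hN⟩ := hx
  obtain ⟨M, hM⟩ := hy
  exact ⟨max N M, by rw [smul_add, pow_smul_eq_zero_of_le (le_max_left _ _) hN,
    pow_smul_eq_zero_of_le (le_max_right _ _) hM, add_zero]⟩

theorem IsTorsion.zero : (0 : D.Points (unitBall K)).IsTorsion := ⟨0, smul_zero _⟩

/-- Under this bound `x ^ q` strictly dominates `π x (1 + x k)`. The next two lemmas treat the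
opposite inequality, weak and strict. -/
theorem norm_π_smul_of_lt {x : D.Points (unitBall K)} (hx : ρ < ‖x.val‖ ^ (D.q - 1)) :
    ‖(D.π • x).val‖ = ‖x.val‖ ^ D.q := by
  obtain ⟨k, hk⟩ := exists_val_π_smul x
  have hq := two_le_q (D := D)
  have hx0 : 0 < ‖x.val‖ := by
    by_contra h
    have : ‖x.val‖ = 0 := le_antisymm (not_lt.mp h) (norm_nonneg _)
    rw [this, zero_pow (by omega)] at hx
    exact absurd hx (norm_nonneg _).not_gt
  rw [hk, unitBall.norm_add_eq_left, unitBall.norm_pow]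
  rw [unitBall.norm_mul_one_add (unitBall.norm_mul_lt_one x.norm_val_lt_one), unitBall.norm_mul,
    unitBall.norm_pow, show D.q = D.q - 1 + 1 by omega, pow_succ]
  exact mul_lt_mul_of_pos_right hx hx0

theorem norm_π_smul_le {x : D.Points (unitBall K)} (hx : ‖x.val‖ ^ (D.q - 1) ≤ ρ) :
    ‖(D.π • x).val‖ ≤ ρ * ‖x.val‖ := by
  obtain ⟨k, hk⟩ := exists_val_π_smul x
  have hq := two_le_q (D := D)
  rw [hk]
  refine (IsUltrametricDist.norm_add_le_max _ _).trans (max_le ?_ ?_)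
  · rw [unitBall.norm_pow, show D.q = D.q - 1 + 1 by omega, pow_succ]
    exact mul_le_mul_of_nonneg_right hx (norm_nonneg _)
  · rw [unitBall.norm_mul_one_add (unitBall.norm_mul_lt_one x.norm_val_lt_one), unitBall.norm_mul]

theorem norm_π_smul_of_gt {x : D.Points (unitBall K)} (hx0 : x ≠ 0)
    (hx : ‖x.val‖ ^ (D.q - 1) < ρ) : ‖(D.π • x).val‖ = ρ * ‖x.val‖ := by
  obtain ⟨k, hk⟩ := exists_val_π_smul x
  have hq := two_le_q (D := D)
  have h1 : ‖algebraMap R (unitBall K) D.π * x.val * (1 + x.val * k)‖ = ρ * ‖x.val‖ := by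
    rw [unitBall.norm_mul_one_add (unitBall.norm_mul_lt_one x.norm_val_lt_one), unitBall.norm_mul]
  rw [hk, add_comm, unitBall.norm_add_eq_left, h1]
  rw [h1, unitBall.norm_pow, show D.q = D.q - 1 + 1 by omega, pow_succ]
  exact mul_lt_mul_of_pos_right hx (norm_val_pos hx0)

/-- The reduction of the uniformizer in `unitBall K` is a nonzero nonunit. -/
class NormUniformizer (D : LubinTateData R) (K : Type*) [NormedField K] [IsUltrametricDist K]
    [Algebra R (unitBall K)] : Prop where
  pos : 0 < ‖algebraMap R (unitBall K) D.π‖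
  lt_one : ‖algebraMap R (unitBall K) D.π‖ < 1

variable [hρ : NormUniformizer D K]

/-- Inside the disc `|x| ^ (q - 1) < ρ`, `[π]` multiplies norms exactly by `ρ`: a nonzero point
stays in the disc and is never killed. -/
theorem IsTorsion.le_norm {x : D.Points (unitBall K)} (hx : x.IsTorsion) (hx0 : x ≠ 0) :
    ρ ≤ ‖x.val‖ ^ (D.q - 1) := by
  by_contra! h
  obtain ⟨N, hN⟩ := hx
  revert hN
  have : D.π ^ N • x ≠ 0 ∧ ‖(D.π ^ N • x).val‖ ≤ ‖x.val‖ := by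
    induction N with
    | zero => simpa using hx0
    | succ N ih =>
      rw [pow_succ', mul_smul]
      have h1 := norm_π_smul_of_gt ih.1 ((pow_le_pow_left₀ (norm_nonneg _) ih.2 _).trans_lt h)
      refine ⟨fun h0 => ?_, ?_⟩
      · rw [h0, val_zero, norm_zero] at h1
        exact absurd h1 (mul_pos hρ.pos (norm_val_pos ih.1)).ne
      · rw [h1]
        exact (mul_le_of_le_one_left (norm_nonneg _) hρ.lt_one.le).trans ih.2
  exact this.1

/-- The lower bound is that of every nonzero torsion point; above it `|[π](x)| = |x| ^ q` would be
nonzero. -/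
theorem norm_of_π_smul_eq_zero {x : D.Points (unitBall K)} (hx : D.π • x = 0) (hx0 : x ≠ 0) :
    ‖x.val‖ ^ (D.q - 1) = ρ := by
  refine le_antisymm (not_lt.mp fun h => ?_) (IsTorsion.le_norm ⟨1, by rwa [pow_one]⟩ hx0)
  have := norm_π_smul_of_lt h
  rw [hx, val_zero, norm_zero] at this
  exact absurd this (pow_pos (norm_val_pos hx0) _).ne

/-- Otherwise `|[π](x)| ≤ ρ |x|` with `|x| ^ (q - 1) ≤ ρ`, which puts the nonzero torsion point
`[π](x)` below the lower bound of `IsTorsion.le_norm`. -/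
theorem IsTorsion.norm_π_smul {x : D.Points (unitBall K)} (hx : x.IsTorsion)
    (hx0 : D.π • x ≠ 0) : ‖(D.π • x).val‖ = ‖x.val‖ ^ D.q := by
  refine norm_π_smul_of_lt (not_le.mp fun h => ?_)
  have hq := two_le_q (D := D)
  have h1 := norm_π_smul_le h
  have h2 := (hx.smul D.π).le_norm hx0
  have h3 : ‖(D.π • x).val‖ ^ (D.q - 1) ≤ ρ ^ (D.q - 1) * ρ := by
    refine (pow_le_pow_left₀ (norm_nonneg _) h1 _).trans ?_
    rw [mul_pow]
    exact mul_le_mul_of_nonneg_left h (by positivity)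
  have h4 : ρ ^ (D.q - 1) < 1 := pow_lt_one₀ (norm_nonneg _) hρ.lt_one (by omega)
  have h5 : ρ ^ (D.q - 1) * ρ < 1 * ρ := mul_lt_mul_of_pos_right h4 hρ.pos
  linarith

theorem IsTorsion.norm_π_pow_smul {x : D.Points (unitBall K)} (hx : x.IsTorsion) {s : ℕ}
    (hx0 : D.π ^ s • x ≠ 0) : ‖(D.π ^ s • x).val‖ = ‖x.val‖ ^ D.q ^ s := by
  induction s with
  | zero => simp
  | succ s ih =>
    rw [pow_succ', mul_smul] at hx0 ⊢
    rw [(hx.smul _).norm_π_smul hx0, ih (fun h => hx0 (by rw [h, smul_zero])), ← pow_mul, pow_succ]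

/-- The absolute value of a torsion point increases with its order. -/
theorem IsTorsion.norm_le_norm {x y : D.Points (unitBall K)} (hy : y.IsTorsion) {N : ℕ}
    (hx : D.π ^ (N + 1) • x = 0) (hy0 : D.π ^ N • y ≠ 0) : ‖x.val‖ ≤ ‖y.val‖ := by
  have hq := two_le_q (D := D)
  -- Nonzero points killed by `π` have the least norm among nonzero torsion points.
  have base : ∀ {x y : D.Points (unitBall K)}, y.IsTorsion → D.π • x = 0 → y ≠ 0 →
      ‖x.val‖ ≤ ‖y.val‖ := by
    intro x y hy hx hy0
    by_cases hx0 : x = 0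
    · rw [hx0, val_zero, norm_zero]
      exact norm_nonneg _
    · refine le_of_pow_le_pow_left₀ (n := D.q - 1) (by omega) (norm_nonneg _) ?_
      rw [norm_of_π_smul_eq_zero hx hx0]
      exact hy.le_norm hy0
  induction N generalizing x y with
  | zero => exact base hy (by simpa using hx) (by simpa using hy0)
  | succ N ih =>
    have hy1 : y ≠ 0 := fun h => hy0 (by rw [h, smul_zero])
    by_cases hx0 : D.π • x = 0
    · exact base hy hx0 hy1
    · have hy2 : D.π • y ≠ 0 := fun h => hy0 (by rw [pow_succ, mul_smul, h, smul_zero])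
      have h1 := ih (hy.smul D.π) (x := D.π • x) (by rwa [← mul_smul, ← pow_succ])
        (by rwa [← mul_smul, ← pow_succ])
      rw [hy.norm_π_smul hy2, IsTorsion.norm_π_smul ⟨_, hx⟩ hx0] at h1
      exact le_of_pow_le_pow_left₀ (by omega) (norm_nonneg _) h1

/-- A torsion point of much smaller order is much smaller. -/
theorem IsTorsion.norm_le_norm_pow {x y : D.Points (unitBall K)} (hy : y.IsTorsion) {N s : ℕ}
    (hx : D.π ^ (N + 1) • x = 0) (hy0 : D.π ^ (N + s) • y ≠ 0) :
    ‖x.val‖ ≤ ‖y.val‖ ^ D.q ^ s := by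
  rw [pow_add, mul_smul] at hy0
  rw [← hy.norm_π_pow_smul (fun h => hy0 (by rw [h, smul_zero]))]
  exact (hy.smul _).norm_le_norm hx hy0

end Points

end LubinTateData

/-! ### Cyclicity and finiteness of torsion -/

namespace LubinTateData

open MvPowerSeries Filter Topology

namespace Points

variable {R : Type*} [CommRing R] {D : LubinTateData R}
  {K : Type*} [NormedField K] [IsUltrametricDist K] [CompleteSpace K]
  [Algebra R (unitBall K)] [IsDomain R] [hρ : NormUniformizer D K]

/-- The Teichmüller-type approximation: a root of `X ^ q - X` in the residue field of `K` comes
from the residue field of `R`. -/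
theorem exists_norm_sub_lt_one (D : LubinTateData R) [hρ : NormUniformizer D K] {u : unitBall K}
    (hu : ‖u ^ D.q - u‖ < 1) : ∃ a : R, ‖u - algebraMap R (unitBall K) a‖ < 1 := by
  classical
  have := D.isMaximal
  have := D.finite
  let _ := Ideal.Quotient.field (Ideal.span {D.π})
  have := Fintype.ofFinite (R ⧸ Ideal.span {D.π})
  let J : Ideal (unitBall K) := unitBall.ballIdeal ⟨1, one_pos⟩
  have memJ : ∀ x, x ∈ J ↔ ‖x‖ < 1 := fun x => mem_ball_zero_iff
  have hJ : J.IsPrime := by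
    refine ⟨fun h => ?_, fun {x y} hxy => ?_⟩
    · have h1 : (1 : unitBall K) ∈ J := h ▸ Submodule.mem_top
      rw [memJ] at h1
      exact absurd h1 (not_lt.mpr (norm_one (α := K)).ge)
    · rw [memJ, unitBall.norm_mul] at hxy
      rw [memJ, memJ]
      by_contra! h
      have h1 := mul_le_mul h.1 h.2 zero_le_one (norm_nonneg _)
      linarith
  have hle : Ideal.span {D.π} ≤ J.comap (algebraMap R (unitBall K)) := by
    rw [Ideal.span_singleton_le_iff_mem, Ideal.mem_comap, memJ]
    exact hρ.lt_one
  let ι : R ⧸ Ideal.span {D.π} →+* unitBall K ⧸ J := Ideal.quotientMap J _ hle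
  have hq : Fintype.card (R ⧸ Ideal.span {D.π}) = D.q := Fintype.card_eq_nat_card
  have hmon : (Polynomial.X ^ D.q - Polynomial.X : Polynomial (R ⧸ Ideal.span {D.π})).Monic :=
    Polynomial.monic_X_pow_sub (by
      rw [Polynomial.degree_X]
      exact_mod_cast two_le_q (D := D))
  -- `X ^ q - X` splits completely over the residue field of `R`. Evaluating the product at the
  -- class of `u` in a domain makes one factor vanish.
  have hprod := Polynomial.prod_multiset_X_sub_C_of_monic_of_roots_card_eq hmon (by
    rw [← hq, FiniteField.roots_X_pow_card_sub_X, hq,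
      FiniteField.X_pow_card_sub_X_natDegree_eq _ two_le_q]
    exact hq)
  have h0 : (Ideal.Quotient.mk J u) ^ D.q - Ideal.Quotient.mk J u = 0 := by
    rw [← map_pow, ← map_sub, Ideal.Quotient.eq_zero_iff_mem, memJ]
    exact hu
  have h1 := congrArg (Polynomial.eval₂RingHom ι (Ideal.Quotient.mk J u)) hprod.symm
  rw [map_sub, map_pow, Polynomial.coe_eval₂RingHom, Polynomial.eval₂_X, h0,
    ← Polynomial.coe_eval₂RingHom, map_multiset_prod, Multiset.map_map, eq_comm, Multiset.prod_eq_zero_iff,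
    Multiset.mem_map] at h1
  obtain ⟨b, -, hb⟩ := h1
  obtain ⟨a, rfl⟩ := Ideal.Quotient.mk_surjective b
  refine ⟨a, ?_⟩
  rw [← memJ, ← Ideal.Quotient.eq_zero_iff_mem, ← hb]
  simp [ι]

/-- The ratio `u = z / ω` is congruent to some `a` in `R`, so `z - [a](ω)` is killed by `π` and
smaller than `ω`. It is zero, since nonzero points killed by `π` all have the same norm. -/
theorem exists_smul_eq_of_π_smul_eq_zero {z ω : D.Points (unitBall K)} (hz : D.π • z = 0)
    (hω : D.π • ω = 0) (hω0 : ω ≠ 0) : ∃ a : R, z = a • ω := by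
  have hωt : ω.IsTorsion := ⟨1, by rwa [pow_one]⟩
  have hzω : ‖z.val‖ ≤ ‖ω.val‖ :=
    hωt.norm_le_norm (N := 0) (by simpa using hz) (by simpa using hω0)
  have hωpos := norm_val_pos hω0
  have hω0' : ω.val ≠ 0 := fun h => hω0 (val_eq_zero.mp h)
  obtain ⟨u, hu⟩ : ∃ u : unitBall K, z.val = u * ω.val := by
    refine ⟨⟨(z.val : K) / ω.val, ?_⟩, Subtype.ext ?_⟩
    · change ‖_‖ ≤ 1
      rw [norm_div]
      exact div_le_one_of_le₀ hzω (norm_nonneg _)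
    · exact (div_mul_cancel₀ _ fun h => hω0' (Subtype.ext h)).symm
  obtain ⟨k, hk⟩ := exists_val_π_smul z
  obtain ⟨k', hk'⟩ := exists_val_π_smul ω
  have hπ0 : algebraMap R (unitBall K) D.π ≠ 0 := norm_pos_iff.mp hρ.pos
  -- Divide the equation `[π](z) = 0` by `π ω`, after eliminating `ω ^ q` with the equation `[π](ω)
  -- = 0`.
  have key : u ^ D.q - u = z.val * (u * k) + ω.val * (-u ^ D.q * k') := by
    rw [hz, val_zero] at hk
    rw [hω, val_zero] at hk'
    rw [hu, mul_pow] at hk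
    refine mul_left_cancel₀ (mul_ne_zero hπ0 hω0') ?_
    rw [hu]
    linear_combination hk - u ^ D.q * hk'
  obtain ⟨a, ha⟩ := exists_norm_sub_lt_one D (u := u) (by
    rw [key]
    exact (IsUltrametricDist.norm_add_le_max _ _).trans_lt
      (max_lt (unitBall.norm_mul_lt_one z.norm_val_lt_one)
        (unitBall.norm_mul_lt_one ω.norm_val_lt_one)))
  refine ⟨a, ?_⟩
  by_contra hne
  have h1 : D.π • (z - a • ω) = 0 := by
    rw [smul_sub, hz, smul_comm, hω, smul_zero, sub_zero]
  have h2 := norm_of_π_smul_eq_zero h1 (sub_ne_zero.mpr hne)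
  have h3 := norm_of_π_smul_eq_zero hω hω0
  obtain ⟨m, hm⟩ := exists_val_smul a ω
  have h4 : ‖(z - a • ω).val‖ < ‖ω.val‖ := by
    rw [norm_val_sub, hm, hu, show u * ω.val - (algebraMap R (unitBall K) a * ω.val +
      ω.val ^ 2 * m) = ((u - algebraMap R (unitBall K) a) + ω.val * -m) * ω.val by ring,
      unitBall.norm_mul]
    refine mul_lt_of_lt_one_left hωpos ?_
    exact (IsUltrametricDist.norm_add_le_max _ _).trans_lt
      (max_lt ha (unitBall.norm_mul_lt_one ω.norm_val_lt_one))
  have hq := two_le_q (D := D)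
  have := pow_lt_pow_left₀ h4 (norm_nonneg _) (n := D.q - 1) (by omega)
  exact absurd (h2.trans h3.symm) this.ne

/-- A point that is killed by all powers of `π` that kill the torsion point `ω` is a multiple
of `ω`. -/
theorem IsTorsion.exists_smul_eq {z ω : D.Points (unitBall K)} (hω : ω.IsTorsion)
    (hz : ∀ N, D.π ^ N • ω = 0 → D.π ^ N • z = 0) : ∃ a : R, z = a • ω := by
  obtain ⟨N, hN⟩ := hω
  induction N generalizing z ω with
  | zero => exact ⟨0, by rw [zero_smul]; simpa using hz 0 hN⟩
  | succ N ih =>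
    by_cases h0 : D.π ^ N • ω = 0
    · exact ih hz h0
    obtain ⟨a, ha⟩ := ih (z := D.π • z) (ω := D.π • ω)
      (fun M hM => by
        rw [← mul_smul, ← pow_succ] at hM ⊢
        exact hz _ hM) (by rwa [← mul_smul, ← pow_succ])
    -- Since `π z = a π ω`, the difference `z - a ω` is killed by `π`, hence a multiple of the
    -- nonzero point `π ^ N ω`, which `π` also kills.
    obtain ⟨b, hb⟩ := exists_smul_eq_of_π_smul_eq_zero (z := z - a • ω) (ω := D.π ^ N • ω)
      (by rw [smul_sub, ha, smul_comm, sub_self]) (by rwa [← mul_smul, ← pow_succ']) h0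
    refine ⟨a + b * D.π ^ N, ?_⟩
    rw [add_smul, mul_smul, ← hb, add_sub_cancel]

/-- The kernel of `[π]` consists of multiples of one point by residue classes, and every nonempty
fibre of `[π]` is a translate of this kernel. -/
theorem finite_π_pow_torsion (D : LubinTateData R) [hρ : NormUniformizer D K] (N : ℕ) :
    {x : D.Points (unitBall K) | D.π ^ N • x = 0}.Finite := by
  have base : {x : D.Points (unitBall K) | D.π • x = 0}.Finite := by
    by_cases h : ∃ ω : D.Points (unitBall K), D.π • ω = 0 ∧ ω ≠ 0
    · obtain ⟨ω, hω, hω0⟩ := h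
      have := D.finite
      refine (Set.finite_range fun c : R ⧸ Ideal.span {D.π} => c.out • ω).subset fun z hz => ?_
      obtain ⟨a, rfl⟩ := exists_smul_eq_of_π_smul_eq_zero hz hω hω0
      refine ⟨Ideal.Quotient.mk _ a, ?_⟩
      have : (Ideal.Quotient.mk (Ideal.span {D.π}) a).out - a ∈ Ideal.span {D.π} := by
        rw [← Ideal.Quotient.eq]
        exact Ideal.Quotient.mk_out _
      obtain ⟨c, hc⟩ := Ideal.mem_span_singleton.mp this
      change _ • ω = a • ω
      rw [← sub_eq_zero, ← sub_smul, hc, mul_comm, mul_smul, hω, smul_zero]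
    · push Not at h
      exact (Set.finite_singleton 0).subset fun x hx => h x hx
  induction N with
  | zero => simp
  | succ N ih =>
    have : {x : D.Points (unitBall K) | D.π ^ (N + 1) • x = 0} =
        (fun x => D.π • x) ⁻¹' {x | D.π ^ N • x = 0} := by
      ext x
      simp [pow_succ, mul_smul]
    rw [this]
    refine ih.preimage' fun b _ => ?_
    by_cases hb : ∃ x₀ : D.Points (unitBall K), D.π • x₀ = b
    · obtain ⟨x₀, rfl⟩ := hb
      refine (base.image fun y => y + x₀).subset fun x hx => ⟨x - x₀, ?_, sub_add_cancel _ _⟩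
      change D.π • (x - x₀) = 0
      rw [smul_sub, sub_eq_zero]
      exact hx
    · convert Set.finite_empty (α := D.Points (unitBall K))
      ext x
      simpa using fun h => hb ⟨x, h⟩

/-- If `|ω| ≤ c < 1` and `π ^ s ω ≠ 0`, then `|π ^ s ω| = |ω| ^ (q ^ s) ≤ c ^ (q ^ s)`; for large
`s` this violates the lower bound for nonzero torsion points. -/
theorem tendsto_norm_of_order {ω : ℕ → D.Points (unitBall K)} (hω : ∀ k, (ω k).IsTorsion)
    (h : ∀ N, ∀ᶠ k in atTop, D.π ^ N • ω k ≠ 0) :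
    Tendsto (fun k => ‖(ω k).val‖) atTop (𝓝 1) := by
  have hq := two_le_q (D := D)
  refine tendsto_order.mpr ⟨fun c hc => ?_, fun c hc => .of_forall fun k =>
    (norm_val_lt_one _).trans hc⟩
  obtain hc0 | hc0 := lt_or_ge c 0
  · exact .of_forall fun k => hc0.trans_le (norm_nonneg _)
  have ht : Tendsto (fun s : ℕ => c ^ (D.q ^ s * (D.q - 1))) atTop (𝓝 0) := by
    refine (tendsto_pow_atTop_nhds_zero_of_lt_one hc0 hc).comp (tendsto_atTop_mono
      (fun s => ?_) tendsto_id)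
    calc s ≤ D.q ^ s := (Nat.lt_pow_self (by omega)).le
      _ ≤ _ := Nat.le_mul_of_pos_right _ (by omega)
  obtain ⟨s, hs⟩ := ((tendsto_order.mp ht).2 _ hρ.pos).exists
  filter_upwards [h s] with k hk
  by_contra! hle
  have h1 := ((hω k).smul (D.π ^ s)).le_norm hk
  rw [(hω k).norm_π_pow_smul hk, ← pow_mul] at h1
  exact absurd (h1.trans (pow_le_pow_left₀ (norm_nonneg _) hle _)) (not_le.mpr hs)

end Points

end LubinTateData

/-! ### Spread sequences and the decomposition of torsion tuples -/

namespace LubinTateData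

open Filter Topology

namespace Points

variable {R : Type*} [CommRing R] {D : LubinTateData R}
  {K : Type*} [NormedField K] [IsUltrametricDist K] [CompleteSpace K]
  [Algebra R (unitBall K)] [IsDomain R] [hρ : NormUniformizer D K]

/-- A sequence of tuples of torsion points whose orders tend to infinity, the order of each
coordinate much faster than that of the next. -/
structure Spread {r : ℕ} (w : ℕ → Fin r → D.Points (unitBall K)) : Prop where
  isTorsion : ∀ k i, (w k i).IsTorsion
  tendsto : ∀ i, Tendsto (fun k => ‖(w k i).val‖) atTop (𝓝 1)
  lt : ∀ (d : Fin r → ℕ) (i), ∀ᶠ k in atTop,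
    ‖(w k i).val‖ < ∏ j, if j < i then ‖(w k j).val‖ ^ d j else 1

theorem Spread.cons {r : ℕ} {w : ℕ → Fin r → D.Points (unitBall K)} (hw : Spread w)
    {ω : ℕ → D.Points (unitBall K)} (hω : ∀ k, (ω k).IsTorsion)
    (htop : ∀ N, ∀ᶠ k in atTop, D.π ^ N • ω k ≠ 0)
    (hle : ∀ s i, ∀ᶠ k in atTop, ‖(w k i).val‖ ≤ ‖(ω k).val‖ ^ D.q ^ s) :
    Spread fun k => (Fin.cons (ω k) (w k) : Fin (r + 1) → D.Points (unitBall K)) := by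
  refine ⟨fun k i => ?_, fun i => ?_, fun d i => ?_⟩
  · refine Fin.cases ?_ (fun i => ?_) i
    exacts [hω k, hw.isTorsion k i]
  · refine Fin.cases ?_ (fun i => ?_) i
    · simpa using tendsto_norm_of_order hω htop
    · simpa using hw.tendsto i
  · refine Fin.cases ?_ (fun i => ?_) i
    · refine .of_forall fun k => ?_
      simpa using norm_val_lt_one (ω k)
    -- The exponents are doubled because two upper bounds for `|w_i|` are multiplied: this bounds
    -- `|w_i| ^ 2` by the square of the required product.
    · filter_upwards [hw.lt (fun j => 2 * d j.succ) i, hle (2 * d 0) i, htop 0] with k h1 h2 h3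
      have hq := two_le_q (D := D)
      have hpos : 0 < ‖(ω k).val‖ := norm_val_pos (by simpa using h3)
      simp only [Fin.prod_univ_succ, Fin.cons_zero, Fin.cons_succ, Fin.succ_lt_succ_iff,
        Fin.succ_pos, if_true]
      have h4 : ‖(w k i).val‖ ≤ (‖(ω k).val‖ ^ d 0) ^ 2 := by
        rw [← pow_mul, mul_comm]
        exact h2.trans (pow_le_pow_of_le_one (norm_nonneg _) (norm_val_lt_one _).le
          (Nat.lt_pow_self (by omega)).le)
      have h5 : (∏ j, if j < i then ‖(w k j).val‖ ^ (2 * d j.succ) else 1) =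
          (∏ j, if j < i then ‖(w k j).val‖ ^ d j.succ else 1) ^ 2 := by
        rw [← Finset.prod_pow]
        refine Finset.prod_congr rfl fun j _ => ?_
        split_ifs
        · rw [← pow_mul, mul_comm]
        · simp
      rw [h5] at h1
      have h6 : 0 ≤ ∏ j, if j < i then ‖(w k j).val‖ ^ d j.succ else 1 :=
        Finset.prod_nonneg fun j _ => by split_ifs <;> positivity
      refine lt_of_pow_lt_pow_left₀ 2 (mul_nonneg (by positivity) h6) ?_
      rw [mul_pow, sq]
      exact (mul_le_mul_of_nonneg_right h4 (norm_nonneg _)).trans_lt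
        (mul_lt_mul_of_pos_left h1 (by positivity))

/-- Among finitely many torsion points one has the largest order. -/
theorem exists_max_order {n : ℕ} {ζ : Fin (n + 1) → D.Points (unitBall K)}
    (hζ : ∀ i, (ζ i).IsTorsion) : ∃ i, ∀ j N, D.π ^ N • ζ i = 0 → D.π ^ N • ζ j = 0 := by
  classical
  obtain ⟨i, hi⟩ := Finite.exists_max fun i => Nat.find (hζ i)
  exact ⟨i, fun j N hN => pow_smul_eq_zero_of_le ((hi j).trans (Nat.find_min' (hζ i) hN))
    (Nat.find_spec (hζ j))⟩

theorem IsTorsion.exists_order {x : D.Points (unitBall K)} (hx : x.IsTorsion) (hx0 : x ≠ 0) :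
    ∃ M, D.π ^ (M + 1) • x = 0 ∧ D.π ^ M • x ≠ 0 := by
  classical
  have h := Nat.find_spec hx
  have h0 : Nat.find hx ≠ 0 := fun h0 => hx0 (by rw [h0] at h; simpa using h)
  refine ⟨Nat.find hx - 1, ?_, Nat.find_min hx (by omega)⟩
  rwa [Nat.sub_add_cancel (by omega)]

/-- A sequence of tuples of torsion points has a subsequence whose values are the images of a
spread sequence under a fixed split injective affine map. -/
theorem exists_decomposition
    (hcompact : ∀ n (a : ℕ → Fin n → R), ∃ (l : Fin n → R) (φ : ℕ → ℕ), StrictMono φ ∧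
      ∀ s, ∀ᶠ k in atTop, ∀ i, D.π ^ s ∣ a (φ k) i - l i)
    {n : ℕ} (ζ : ℕ → Fin n → D.Points (unitBall K)) (hζ : ∀ k i, (ζ k i).IsTorsion)
    (M : Submodule R (D.Points (unitBall K))) (hM : ∀ k i, ζ k i ∈ M) :
    ∃ (φ : ℕ → ℕ) (r : ℕ) (B : Fin n → Fin r → R) (C : Fin r → Fin n → R)
      (ξ : Fin n → D.Points (unitBall K)) (w : ℕ → Fin r → D.Points (unitBall K)),
      StrictMono φ ∧ (∀ m m', ∑ i, C m i * B i m' = if m = m' then 1 else 0) ∧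
      (∀ i, (ξ i).IsTorsion) ∧ (∀ i, ξ i ∈ M) ∧ Spread w ∧ ∀ k i, ζ (φ k) i = ξ i + ∑ j, B i j • w k j := by
  induction n with
  | zero =>
    exact ⟨id, 0, finZeroElim, finZeroElim, finZeroElim, fun _ => finZeroElim, strictMono_id,
      finZeroElim, finZeroElim, finZeroElim,
      ⟨fun _ => finZeroElim, finZeroElim, fun _ => finZeroElim⟩, fun _ => finZeroElim⟩
  | succ n ih =>
    -- If a fixed power of `π` kills infinitely many tuples, finiteness of torsion makes a
    -- subsequence constant, and `r = 0` suffices.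
    by_cases hA : ∃ N, ∃ᶠ k in atTop, ∀ i, D.π ^ N • ζ k i = 0
    · obtain ⟨N, hN⟩ := hA
      have hfin : {x : Fin (n + 1) → D.Points (unitBall K) | ∀ i, D.π ^ N • x i = 0}.Finite := by
        convert Set.Finite.pi' (ι := Fin (n + 1)) fun _ => finite_π_pow_torsion (K := K) D N
        exact Iff.rfl
      have : ∃ᶠ k in atTop, ∃ x ∈ {x : Fin (n + 1) → D.Points (unitBall K) |
          ∀ i, D.π ^ N • x i = 0}, ζ k = x := hN.mono fun k hk => ⟨ζ k, hk, rfl⟩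
      obtain ⟨ξ, hξ, hf⟩ := (frequently_exists_finite hfin).mp this
      obtain ⟨φ, hφ, hφ'⟩ := extraction_of_frequently_atTop hf
      exact ⟨φ, 0, fun _ => finZeroElim, finZeroElim, ξ, fun _ => finZeroElim, hφ, finZeroElim,
        fun i => ⟨N, hξ i⟩, fun i => hφ' 0 ▸ hM _ i, ⟨fun _ => finZeroElim, finZeroElim, fun _ => finZeroElim⟩,
        fun k i => by simp [hφ' k]⟩
    push Not at hA
    choose m hm using fun k => exists_max_order (hζ k)
    obtain ⟨i, hi⟩ : ∃ i, ∃ᶠ k in atTop, m k = i :=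
      frequently_exists.mp (Frequently.of_forall fun k => ⟨m k, rfl⟩)
    obtain ⟨φ₀, hφ₀, hi⟩ := extraction_of_frequently_atTop hi
    have hmax : ∀ k j N, D.π ^ N • ζ (φ₀ k) i = 0 → D.π ^ N • ζ (φ₀ k) j = 0 :=
      fun k => hi k ▸ hm (φ₀ k)
    -- Coordinate `i` has the largest order, so all other coordinates are multiples of it; `l` is a
    -- subsequential limit of the multipliers.
    choose a ha using fun k (j : Fin n) => (hζ (φ₀ k) i).exists_smul_eq (hmax k (i.succAbove j))
    obtain ⟨l, φ₁, hφ₁, hl⟩ := hcompact n a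
    obtain ⟨φ₂, r, B, C, ξ, w, hφ₂, hCB, hξ, hξM, hw, hdec⟩ := ih
      (fun k j => (a (φ₁ k) j - l j) • ζ (φ₀ (φ₁ k)) i) (fun k j => (hζ _ _).smul _)
      fun k j => M.smul_mem _ (hM _ _)
    let ω : ℕ → D.Points (unitBall K) := fun k => ζ (φ₀ (φ₁ (φ₂ k))) i
    have hω : ∀ k, (ω k).IsTorsion := fun k => hζ _ _
    have hφ : StrictMono fun k => φ₀ (φ₁ (φ₂ k)) := hφ₀.comp (hφ₁.comp hφ₂)
    have htop : ∀ N, ∀ᶠ k in atTop, D.π ^ N • ω k ≠ 0 := by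
      intro N
      filter_upwards [hφ.tendsto_atTop.eventually (hA N)] with k hk h0
      obtain ⟨j, hj⟩ := hk
      exact hj (hmax _ j N h0)
    obtain ⟨N₀, hN₀⟩ : ∃ N₀, ∀ j, D.π ^ N₀ • ξ j = 0 := by
      choose N hN using hξ
      exact ⟨Finset.univ.sup N, fun j =>
        pow_smul_eq_zero_of_le (Finset.le_sup (Finset.mem_univ j)) (hN j)⟩
    -- The left inverse `C` recovers `w` from the tuple, which turns bounds on the orders of the
    -- tuple into bounds on those of `w`.
    have hwC : ∀ k m, w k m = ∑ j, C m j • ((a (φ₁ (φ₂ k)) j - l j) • ω k - ξ j) := by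
      intro k m
      have : ∀ j, (a (φ₁ (φ₂ k)) j - l j) • ω k - ξ j = ∑ m', B j m' • w k m' := fun j => by
        rw [sub_eq_iff_eq_add', hdec k j]
      simp_rw [this, Finset.smul_sum, smul_smul]
      rw [Finset.sum_comm]
      simp_rw [← Finset.sum_smul, hCB]
      simp
    -- Once `π ^ s` divides `a - l`, the order of `(a - l) ω` is smaller than that of `ω` by a
    -- factor `π ^ s`. The fixed `ξ` does not interfere when `ω` has order beyond `π ^ (N₀ + s)`.
    have hle : ∀ s m, ∀ᶠ k in atTop, ‖(w k m).val‖ ≤ ‖(ω k).val‖ ^ D.q ^ s := by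
      intro s m
      filter_upwards [hφ₂.tendsto_atTop.eventually (hl s), htop (N₀ + s)] with k h1 h2
      obtain ⟨M, hM, hM'⟩ := (hω k).exists_order fun h => h2 (by rw [h, smul_zero])
      have hMs : N₀ + s ≤ M := by
        by_contra h
        exact h2 (pow_smul_eq_zero_of_le (by omega) hM)
      obtain ⟨P, rfl⟩ : ∃ P, M = P + s := ⟨M - s, by omega⟩
      refine (hω k).norm_le_norm_pow (N := P) ?_ hM'
      rw [hwC, Finset.smul_sum]
      refine Finset.sum_eq_zero fun j _ => ?_
      obtain ⟨b, hb⟩ := h1 j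
      rw [smul_comm, smul_sub, pow_smul_eq_zero_of_le (by omega) (hN₀ j), hb, smul_smul,
        show D.π ^ (P + 1) * (D.π ^ s * b) = b * D.π ^ (P + s + 1) by ring, mul_smul, hM,
        smul_zero, sub_zero, smul_zero]
    -- Row `i` of the new matrix is `(1, 0)` and the others are `(l_j, B_j)`. The entry `-∑ C_{mj}
    -- l_j` of the left inverse cancels the contribution of the new column.
    refine ⟨_, r + 1, i.insertNth (Fin.cons 1 0) fun j => Fin.cons (l j) (B j),
      Fin.cons (i.insertNth 1 0) fun m => i.insertNth (-∑ j, C m j * l j) (C m),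
      i.insertNth 0 ξ, _, hφ, fun m m' => ?_, fun j => ?_, fun j => ?_, hw.cons hω htop hle, fun k j => ?_⟩
    · rw [Fin.sum_univ_succAbove _ i]
      simp only [Fin.insertNth_apply_same, Fin.insertNth_apply_succAbove]
      refine Fin.cases ?_ (fun m => ?_) m <;> refine Fin.cases ?_ (fun m' => ?_) m'
      · simp
      · simp [eq_comm]
      · simp
      · simp [hCB]
    · refine Fin.succAboveCases i ?_ (fun j => ?_) j
      · simpa using IsTorsion.zero
      · simpa using hξ j
    · refine Fin.succAboveCases i ?_ (fun j => ?_) j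
      · simp
      · simpa using hξM j
    · refine Fin.succAboveCases i ?_ (fun j => ?_) j
      · simp [Fin.sum_univ_succ, ω]
      · have h := hdec k j
        simp only [Fin.sum_univ_succ, Fin.insertNth_apply_succAbove, Fin.cons_zero, Fin.cons_succ]
        rw [ha, add_left_comm, ← h, ← add_smul, add_sub_cancel]

end Points

end LubinTateData

/-! ### A vanishing criterion for power series -/

namespace unitBall

open Filter Topology MvPowerSeries

variable {K : Type*} [NormedField K] [IsUltrametricDist K]

/-- If one term of a convergent series is strictly larger than every other term, the sum has the
norm of this term. -/
theorem norm_eq_of_hasSum {ι : Type*} {f : ι → unitBall K} {a : unitBall K} (hf : HasSum f a)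
    {i : ι} (hi : ∀ j ≠ i, ‖f j‖ < ‖f i‖) : ‖a‖ = ‖f i‖ := by
  classical
  have h : ∀ᶠ s : Finset ι in atTop, ‖∑ j ∈ s, f j‖ = ‖f i‖ := by
    filter_upwards [eventually_ge_atTop {i}] with s hs
    have his : i ∈ s := hs (Finset.mem_singleton_self i)
    rw [← Finset.add_sum_erase s f his]
    obtain h0 | h0 := (s.erase i).eq_empty_or_nonempty
    · simp [h0]
    · obtain ⟨j, hj, hle⟩ := IsUltrametricDist.exists_norm_finsetSum_le_of_nonempty h0 f
      exact norm_add_eq_left (hle.trans_lt (hi j (Finset.ne_of_mem_erase hj)))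
  exact tendsto_nhds_unique hf.norm (tendsto_const_nhds.congr' (h.mono fun s hs => hs.symm))

theorem norm_finset_prod {ι : Type*} (s : Finset ι) (f : ι → unitBall K) :
    ‖∏ i ∈ s, f i‖ = ∏ i ∈ s, ‖f i‖ := by
  classical
  induction s using Finset.induction_on with
  | empty => exact norm_one (α := K)
  | insert a s ha ih => rw [Finset.prod_insert ha, Finset.prod_insert ha, norm_mul, ih]

/-- A nonzero power series whose coefficients have discrete norms attains the maximum of these
norms. -/
theorem exists_max_norm_coeff {σ : Type*} {g : MvPowerSeries σ (unitBall K)} (hg0 : g ≠ 0) {c : ℝ}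
    (hc1 : c < 1)
    (hc : ∀ d e, ‖coeff d g‖ < ‖coeff e g‖ → ‖coeff d g‖ ≤ c * ‖coeff e g‖) :
    ∃ e, 0 < ‖coeff e g‖ ∧ ∀ d, ‖coeff d g‖ ≤ ‖coeff e g‖ := by
  obtain ⟨d₀, hd₀⟩ : ∃ d, coeff d g ≠ 0 := by
    by_contra! h
    exact hg0 (MvPowerSeries.ext h)
  have hd₀ := norm_pos_iff.mpr hd₀
  by_cases hmax : ∃ e, ∀ d, ‖coeff d g‖ ≤ ‖coeff e g‖
  · obtain ⟨e, he⟩ := hmax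
    exact ⟨e, hd₀.trans_le (he d₀), he⟩
  push Not at hmax
  have hbdd : BddAbove (Set.range fun d => ‖coeff d g‖) :=
    ⟨1, by rintro _ ⟨d, rfl⟩; exact norm_le_one _⟩
  have hle : ∀ d, ‖coeff d g‖ ≤ ⨆ d, ‖coeff d g‖ := fun d => le_ciSup hbdd d
  have hpos := hd₀.trans_le (hle d₀)
  have hc0 : 0 ≤ c := by
    by_contra! h
    obtain ⟨e, he⟩ := hmax d₀
    have := hc d₀ e he
    nlinarith
  -- Without a maximum each norm is strictly exceeded by another, so discreteness bounds the
  -- supremum by `c` times itself.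
  have : (⨆ d, ‖coeff d g‖) ≤ c * ⨆ d, ‖coeff d g‖ := by
    have : Nonempty (σ →₀ ℕ) := ⟨0⟩
    refine ciSup_le fun d => ?_
    obtain ⟨e, he⟩ := hmax d
    exact (hc d e he).trans (mul_le_mul_of_nonneg_left (hle e) hc0)
  nlinarith

/-- Let `i` be the last index where the exponents differ. The extra factor `|x_i|` coming from `d`
is already smaller than all the factors `|x_j| ^ e_j` with `j < i` together. -/
theorem norm_monomial_lt {r : ℕ} {x : Fin r → unitBall K} (hx0 : ∀ i, 0 < ‖x i‖)
    {d e : Fin r →₀ ℕ}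
    (hx : ∀ i, ‖x i‖ < ∏ j, if j < i then ‖x j‖ ^ e j else 1)
    (hde : toColex (e : Fin r → ℕ) < toColex (d : Fin r → ℕ)) :
    ∏ i, ‖x i‖ ^ d i < ∏ i, ‖x i‖ ^ e i := by
  obtain ⟨i, hi, hlt⟩ := hde
  replace hi : ∀ j, i < j → e j = d j := hi
  replace hlt : e i < d i := hlt
  have hx1 : ∀ i, ‖x i‖ ≤ 1 := fun i => norm_le_one _
  have split : ∀ a : Fin r →₀ ℕ, ∏ j, ‖x j‖ ^ a j = (∏ j, if j < i then ‖x j‖ ^ a j else 1) *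
      ‖x i‖ ^ a i * ∏ j, if i < j then ‖x j‖ ^ a j else 1 := by
    intro a
    have : ‖x i‖ ^ a i = ∏ j, if j = i then ‖x j‖ ^ a j else 1 := by simp
    rw [this, ← Finset.prod_mul_distrib, ← Finset.prod_mul_distrib]
    refine Finset.prod_congr rfl fun j _ => ?_
    rcases lt_trichotomy j i with h | h | h
    · simp [h, h.ne, h.not_gt]
    · simp [h]
    · simp [h, h.ne', h.not_gt]
  have htail : (∏ j, if i < j then ‖x j‖ ^ d j else 1) = ∏ j, if i < j then ‖x j‖ ^ e j else 1 :=
    Finset.prod_congr rfl fun j _ => by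
      split_ifs with h
      · rw [hi j h]
      · rfl
  rw [split d, split e, htail]
  refine mul_lt_mul_of_pos_right ?_ (Finset.prod_pos fun j _ => by
    split_ifs
    · exact pow_pos (hx0 j) _
    · exact one_pos)
  obtain ⟨m, hm⟩ : ∃ m, d i = e i + 1 + m := exists_add_of_le hlt
  calc (∏ j, if j < i then ‖x j‖ ^ d j else 1) * ‖x i‖ ^ d i
      ≤ 1 * ‖x i‖ ^ (e i + 1) := by
        refine mul_le_mul ?_ (pow_le_pow_of_le_one (norm_nonneg _) (hx1 i) (by omega))
          (by positivity) zero_le_one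
        refine Finset.prod_le_one (fun j _ => ?_) fun j _ => ?_
        · split_ifs <;> positivity
        · split_ifs
          · exact pow_le_one₀ (norm_nonneg _) (hx1 j)
          · exact le_rfl
    _ = ‖x i‖ * ‖x i‖ ^ e i := by rw [one_mul, pow_succ']
    _ < _ := mul_lt_mul_of_pos_right (hx i) (pow_pos (hx0 i) _)

variable [CompleteSpace K]

/-- A power series with coefficients of discrete norm that tends to zero along a sequence of
points that approaches the boundary of the polydisc, each coordinate much faster than the next,
vanishes. -/
theorem eq_zero_of_tendsto_ev {r : ℕ} {g : MvPowerSeries (Fin r) (unitBall K)} {c : ℝ} (hc1 : c < 1)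
    (hc : ∀ d e, ‖coeff d g‖ < ‖coeff e g‖ → ‖coeff d g‖ ≤ c * ‖coeff e g‖)
    {x : ℕ → Fin r → unitBall K} (hx1 : ∀ k i, ‖x k i‖ < 1)
    (hx : ∀ i, Tendsto (fun k => ‖x k i‖) atTop (𝓝 1))
    (hlt : ∀ (d : Fin r → ℕ) (i), ∀ᶠ k in atTop,
      ‖x k i‖ < ∏ j, if j < i then ‖x k j‖ ^ d j else 1)
    (h0 : Tendsto (fun k => ev (x k) g) atTop (𝓝 0)) : g = 0 := by
  by_contra hg0
  obtain ⟨e₀, he₀, hmax⟩ := exists_max_norm_coeff hg0 hc1 hc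
  let A : Set (Colex (Fin r → ℕ)) :=
    {d | ‖coeff (Finsupp.equivFunOnFinite.symm (ofColex d)) g‖ = ‖coeff e₀ g‖}
  have hA : A.Nonempty := ⟨toColex (e₀ : Fin r → ℕ), by
    change ‖coeff (Finsupp.equivFunOnFinite.symm (e₀ : Fin r → ℕ)) g‖ = _
    congr 3
    exact Finsupp.equivFunOnFinite.symm_apply_apply e₀⟩
  -- Among the coefficients of maximal norm, take the one with colexicographically smallest
  -- exponent.
  obtain ⟨e, heA, hemin⟩ := WellFounded.has_min (wellFounded_lt (α := Colex (Fin r → ℕ))) A hA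
  obtain ⟨e, rfl⟩ : ∃ e' : Fin r →₀ ℕ, toColex (e' : Fin r → ℕ) = e :=
    ⟨Finsupp.equivFunOnFinite.symm (ofColex e), rfl⟩
  replace heA : ‖coeff e g‖ = ‖coeff e₀ g‖ := by
    rw [← heA]
    congr 3
    exact (Finsupp.equivFunOnFinite.symm_apply_apply e).symm
  have hmin : ∀ d : Fin r →₀ ℕ, ‖coeff d g‖ = ‖coeff e g‖ → d ≠ e →
      toColex (e : Fin r → ℕ) < toColex (d : Fin r → ℕ) := by
    intro d hd hde
    refine lt_of_le_of_ne (not_lt.mp (hemin (toColex (d : Fin r → ℕ)) ?_)) ?_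
    · change ‖coeff (Finsupp.equivFunOnFinite.symm (d : Fin r → ℕ)) g‖ = _
      rw [← heA, ← hd]
      congr 3
      exact Finsupp.equivFunOnFinite.symm_apply_apply d
    · intro h
      exact hde (DFunLike.coe_injective (toColex.injective h)).symm
  have htend : Tendsto (fun k => ∏ i, ‖x k i‖ ^ e i) atTop (𝓝 1) := by
    simpa using tendsto_finsetProd Finset.univ fun i _ => (hx i).pow (e i)
  have hpos : ∀ᶠ k in atTop, ∀ i, 0 < ‖x k i‖ :=
    eventually_all.mpr fun i => (hx i).eventually (lt_mem_nhds one_pos)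
  have hterm : ∀ k d, ‖algebraMap (unitBall K) (unitBall K) (coeff d g) *
      d.prod fun i m => x k i ^ m‖ = ‖coeff d g‖ * ∏ i, ‖x k i‖ ^ d i := by
    intro k d
    rw [norm_mul, Finsupp.prod_fintype _ _ (by simp), norm_finset_prod]
    simp_rw [norm_pow]
    rfl
  -- The term at `e` strictly dominates: other maximal coefficients lose by the choice of `e`,
  -- smaller ones by the factor `c`, since the monomial at `e` has norm tending to 1.
  have hnorm : ∀ᶠ k in atTop, ‖ev (x k) g‖ = ‖coeff e g‖ * ∏ i, ‖x k i‖ ^ e i := by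
    filter_upwards [hpos, eventually_all.mpr (hlt e), htend.eventually (lt_mem_nhds hc1)]
      with k h1 h2 h3
    rw [← hterm]
    refine norm_eq_of_hasSum (hasSum_ev (fun i => isTopologicallyNilpotent_iff.mpr (hx1 k i)) g)
      fun d hde => ?_
    rw [hterm, hterm]
    obtain h | h := ((hmax d).trans_eq heA.symm).eq_or_lt
    · rw [h]
      exact mul_lt_mul_of_pos_left (norm_monomial_lt h1 h2 (hmin d h hde)) (heA ▸ he₀)
    · calc ‖coeff d g‖ * ∏ i, ‖x k i‖ ^ d i ≤ c * ‖coeff e g‖ * 1 := by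
            refine mul_le_mul (hc d e h) (Finset.prod_le_one (fun i _ => by positivity)
              fun i _ => pow_le_one₀ (norm_nonneg _) (hx1 k i).le)
              (Finset.prod_nonneg fun i _ => by positivity) ?_
            exact (norm_nonneg _).trans (hc d e h)
        _ = ‖coeff e g‖ * c := by ring
        _ < _ := mul_lt_mul_of_pos_left h3 (heA ▸ he₀)
  have h1 := (htend.const_mul ‖coeff e g‖).congr' (hnorm.mono fun k hk => hk.symm)
  have h2 := tendsto_nhds_unique h1 (by simpa using h0.norm)
  rw [mul_one, heA] at h2
  exact he₀.ne' h2

end unitBall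

/-! ### Points and series over a closed subring -/

namespace LubinTateData

open MvPowerSeries MvPowerSeries.WithPiTopology

namespace Points

section

variable {R : Type*} [CommRing R] {D : LubinTateData R} {S : Type*} [CommRing S] [Algebra R S]
  [UniformSpace S] [T2Space S] [CompleteSpace S] [IsUniformAddGroup S] [IsTopologicalRing S]
  [IsLinearTopology S S] [IsDomain R]

/-- The points with coordinates in a closed subalgebra. -/
def ofSubring (D : LubinTateData R) (A : Subring S) (hA : IsClosed (A : Set S))
    (hR : ∀ a, algebraMap R S a ∈ A) : Submodule R (D.Points S) where
  carrier := {x | x.val ∈ A}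
  zero_mem' := A.zero_mem
  add_mem' {x y} hx hy := ev_mem hA hR (nilpotent_pair x y)
    (fun i => by fin_cases i <;> assumption) _
  smul_mem' a x hx := ev_mem hA hR (fun _ => x.isTopologicallyNilpotent) (fun _ => hx) _

end

end Points

end LubinTateData

/-- The power series with coefficients in a subring. -/
def MvPowerSeries.ofSubring (σ : Type*) {S : Type*} [CommRing S] (A : Subring S) :
    Subring (MvPowerSeries σ S) where
  carrier := {g | ∀ d, MvPowerSeries.coeff d g ∈ A}
  mul_mem' {a b} ha hb d := by
    classical
    rw [MvPowerSeries.coeff_mul]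
    exact sum_mem fun _ _ => mul_mem (ha _) (hb _)
  one_mem' d := by
    classical
    rw [MvPowerSeries.coeff_one]
    split_ifs
    exacts [A.one_mem, A.zero_mem]
  add_mem' {a b} ha hb d := by
    rw [map_add]
    exact add_mem (ha d) (hb d)
  zero_mem' d := A.zero_mem
  neg_mem' {a} ha d := by
    rw [map_neg]
    exact neg_mem (ha d)

open MvPowerSeries.WithPiTopology in
theorem MvPowerSeries.isClosed_ofSubring (σ : Type*) {S : Type*} [CommRing S] [TopologicalSpace S]
    {A : Subring S} (hA : IsClosed (A : Set S)) :
    IsClosed (MvPowerSeries.ofSubring σ A : Set (MvPowerSeries σ S)) := by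
  have : (MvPowerSeries.ofSubring σ A : Set (MvPowerSeries σ S)) =
      ⋂ d, MvPowerSeries.coeff d ⁻¹' (A : Set S) := by
    ext g
    rw [Set.mem_iInter]
    exact Iff.rfl
  rw [this]
  exact isClosed_iInter fun d => hA.preimage (continuous_coeff S d)

/-! ### Integers of finite extensions inside `ℂ_p` -/

namespace LubinTateManinMumford

open Filter Topology MvPowerSeries MvPowerSeries.WithPiTopology

variable {p : ℕ} [Fact p.Prime]

/-- The embedding of the ring of integers of a subfield of `ℚ̄_p` into that of `ℂ_p`. -/
def integersToBall (L : IntermediateField ℚ_[p] (PadicAlgCl p)) :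
    integers L →+* unitBall ℂ_[p] :=
  ((algebraMap (PadicAlgCl p) ℂ_[p]).comp (integers L).subtype).codRestrict (unitBall ℂ_[p])
    fun x => (PadicComplex.norm_extends p x).trans_le x.2.2

instance (L : IntermediateField ℚ_[p] (PadicAlgCl p)) : Algebra (integers L) (unitBall ℂ_[p]) :=
  (integersToBall L).toAlgebra

variable {E F L : IntermediateField ℚ_[p] (PadicAlgCl p)}

theorem norm_algebraMap (x : integers L) :
    ‖algebraMap (integers L) (unitBall ℂ_[p]) x‖ = ‖(x : PadicAlgCl p)‖ :=
  PadicComplex.norm_extends p x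

theorem dvd_of_norm_le {x y : integers L} (hy : y ≠ 0)
    (h : ‖(x : PadicAlgCl p)‖ ≤ ‖(y : PadicAlgCl p)‖) : y ∣ x := by
  have hy' : (y : PadicAlgCl p) ≠ 0 := fun h0 => hy (Subtype.ext h0)
  refine ⟨⟨x / y, L.div_mem x.2.1 y.2.1, ?_⟩, Subtype.ext ?_⟩
  · rw [norm_div]
    exact div_le_one_of_le₀ h (norm_nonneg _)
  · exact (mul_div_cancel₀ (x : PadicAlgCl p) hy').symm

theorem isUnit_of_norm_eq_one {x : integers L} (h : ‖(x : PadicAlgCl p)‖ = 1) : IsUnit x := by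
  have hx : x ≠ 0 := by
    rintro rfl
    simp at h
  exact isUnit_of_dvd_one (dvd_of_norm_le hx (by simp [h]))

theorem isCompact_integers [FiniteDimensional ℚ_[p] L] :
    IsCompact (integers L : Set (PadicAlgCl p)) := by
  let V : Submodule ℚ_[p] (PadicAlgCl p) := Subalgebra.toSubmodule L.toSubalgebra
  have : FiniteDimensional ℚ_[p] V := inferInstanceAs (FiniteDimensional ℚ_[p] L)
  have : ProperSpace V := FiniteDimensional.proper ℚ_[p] V
  have h : (integers L : Set (PadicAlgCl p)) = Subtype.val '' Metric.closedBall (0 : V) 1 := by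
    ext x
    constructor
    · rintro ⟨h1, h2⟩
      exact ⟨⟨x, h1⟩, by simpa using h2, rfl⟩
    · rintro ⟨⟨x, h1⟩, h2, rfl⟩
      exact ⟨h1, by simpa using h2⟩
  rw [h]
  exact (isCompact_closedBall _ _).image continuous_subtype_val

instance [FiniteDimensional ℚ_[p] L] : CompactSpace (integers L) :=
  isCompact_iff_compactSpace.mp isCompact_integers

theorem continuous_algebraMap_integers :
    Continuous (algebraMap (integers L) (unitBall ℂ_[p])) :=
  Continuous.subtype_mk
    ((UniformSpace.Completion.continuous_coe (PadicAlgCl p)).comp continuous_subtype_val) _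

theorem isClosed_range_algebraMap [FiniteDimensional ℚ_[p] L] :
    IsClosed ((algebraMap (integers L) (unitBall ℂ_[p])).range : Set (unitBall ℂ_[p])) :=
  (isCompact_range continuous_algebraMap_integers).isClosed

/-- The norms of the elements of a finite extension of `ℚ_p` are discrete. -/
theorem exists_norm_le (L : IntermediateField ℚ_[p] (PadicAlgCl p)) [FiniteDimensional ℚ_[p] L] :
    ∃ c : ℝ, c < 1 ∧ ∀ x ∈ (algebraMap (integers L) (unitBall ℂ_[p])).range,
      ∀ y ∈ (algebraMap (integers L) (unitBall ℂ_[p])).range, ‖x‖ < ‖y‖ → ‖x‖ ≤ c * ‖y‖ := by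
  have hcomp : IsCompact {x : integers L | ‖(x : PadicAlgCl p)‖ < 1} := by
    have : {x : integers L | ‖(x : PadicAlgCl p)‖ < 1} =
        Subtype.val ⁻¹' (Metric.ball (0 : PadicAlgCl p) 1) := by
      ext x
      simp
    rw [this]
    exact ((IsUltrametricDist.isClosed_ball (0 : PadicAlgCl p) 1).preimage
      continuous_subtype_val).isCompact
  -- The maximal ideal is closed in a compact ring, so the norm attains a maximum on it, which is
  -- less than 1; this is the constant `c`.
  obtain ⟨m, hm, hmax⟩ := hcomp.exists_isMaxOn ⟨0, by simp⟩
    (f := fun x : integers L => ‖(x : PadicAlgCl p)‖) (by fun_prop)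
  refine ⟨_, hm, ?_⟩
  rintro _ ⟨x, rfl⟩ _ ⟨y, rfl⟩ hxy
  rw [norm_algebraMap, norm_algebraMap] at *
  have hy : y ≠ 0 := by
    rintro rfl
    simp only [ZeroMemClass.coe_zero, norm_zero] at hxy
    exact absurd hxy (norm_nonneg _).not_gt
  obtain ⟨z, rfl⟩ := dvd_of_norm_le hy hxy.le
  have hy0 : 0 < ‖(y : PadicAlgCl p)‖ := norm_pos_iff.mpr fun h => hy (Subtype.ext h)
  have h1 : ‖((y * z : integers L) : PadicAlgCl p)‖ =
      ‖(y : PadicAlgCl p)‖ * ‖(z : PadicAlgCl p)‖ := norm_mul (y : PadicAlgCl p) z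
  rw [h1] at hxy ⊢
  rw [mul_comm]
  refine mul_le_mul_of_nonneg_right (hmax ?_) hy0.le
  exact (mul_lt_iff_lt_one_right hy0).mp hxy

section Uniformizer

variable {π : integers E} (hπ : IsUniformizer π)

include hπ

theorem IsUniformizer.norm_lt_one : ‖(π : PadicAlgCl p)‖ < 1 := (hπ π).mpr dvd_rfl

theorem IsUniformizer.dvd_p : π ∣ (p : integers E) := by
  rw [← hπ]
  have h : ((p : integers E) : PadicAlgCl p) = algebraMap ℚ_[p] (PadicAlgCl p) p := by simp
  rw [h, PadicAlgCl.norm_extends]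
  exact Padic.norm_p_lt_one

theorem IsUniformizer.ne_zero : π ≠ 0 := by
  rintro rfl
  have h := zero_dvd_iff.mp hπ.dvd_p
  have h' := congrArg (Subtype.val : integers E → PadicAlgCl p) h
  have : (p : PadicAlgCl p) = 0 := by simpa using h'
  exact (Fact.out : p.Prime).ne_zero (by exact_mod_cast this)

/-- Together with `dvd_p` this identifies `π`-power torsion with `p`-power torsion, a notion that
every additive map respects. -/
theorem IsUniformizer.p_dvd_pow : ∃ e : ℕ, (p : integers E) ∣ π ^ e := by
  have hp : 0 < ‖((p : integers E) : PadicAlgCl p)‖ := by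
    simp [(Fact.out : p.Prime).ne_zero]
  obtain ⟨e, he⟩ := exists_pow_lt_of_lt_one hp hπ.norm_lt_one
  refine ⟨e, dvd_of_norm_le (fun h => by simp [h] at hp) ?_⟩
  rw [SubmonoidClass.coe_pow, norm_pow]
  exact he.le

theorem IsUniformizer.isUnit_one_sub {n : ℕ} (hn : n ≠ 0) : IsUnit (1 - π ^ n) := by
  refine isUnit_of_norm_eq_one ?_
  have h : ‖((π ^ n : integers E) : PadicAlgCl p)‖ < ‖(1 : PadicAlgCl p)‖ := by
    rw [SubmonoidClass.coe_pow, norm_pow, norm_one]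
    exact pow_lt_one₀ (norm_nonneg _) hπ.norm_lt_one hn
  rw [← norm_neg] at h
  have h2 := IsUltrametricDist.norm_add_eq_max_of_norm_ne_norm h.ne'
  rw [max_eq_left h.le, norm_one, ← sub_eq_add_neg] at h2
  exact h2

theorem IsUniformizer.isMaximal : (Ideal.span {π}).IsMaximal := by
  rw [Ideal.isMaximal_iff]
  refine ⟨fun h => ?_, fun J x hJ hx hxJ => ?_⟩
  · have := (hπ 1).mpr (Ideal.mem_span_singleton.mp h)
    simp at this
  · rw [Ideal.mem_span_singleton, ← hπ, not_lt] at hx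
    have := isUnit_of_norm_eq_one (le_antisymm x.2.2 hx)
    rw [J.eq_top_of_isUnit_mem hxJ this]
    exact Submodule.mem_top

theorem IsUniformizer.finite_quotient [FiniteDimensional ℚ_[p] E] :
    Finite (integers E ⧸ Ideal.span {π}) := by
  have : IsOpen ((Ideal.span {π}).toAddSubgroup : Set (integers E)) := by
    have : ((Ideal.span {π}).toAddSubgroup : Set (integers E)) =
        Subtype.val ⁻¹' (Metric.ball (0 : PadicAlgCl p) 1) := by
      ext x
      simp [Ideal.mem_span_singleton, ← hπ x]
    rw [this]
    exact Metric.isOpen_ball.preimage continuous_subtype_val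
  exact AddSubgroup.quotient_finite_of_isOpen _ this

/-- The Lubin-Tate datum over the ring of integers of a finite extension of `ℚ_p`. -/
def IsUniformizer.lubinTateData [FiniteDimensional ℚ_[p] E] {f : PowerSeries (integers E)}
    {G : FormalGroup (integers E)} (hG : IsLubinTateFormalGroup π f G) :
    LubinTateData (integers E) where
  π := π
  f := f
  G := G
  isLubinTate := hG
  ne_zero := hπ.ne_zero
  isUnit_one_sub _ := hπ.isUnit_one_sub
  isMaximal := hπ.isMaximal
  finite := hπ.finite_quotient

theorem IsUniformizer.exists_subseq [FiniteDimensional ℚ_[p] E] (n : ℕ)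
    (a : ℕ → Fin n → integers E) : ∃ (l : Fin n → integers E) (φ : ℕ → ℕ), StrictMono φ ∧
      ∀ s, ∀ᶠ k in atTop, ∀ i, π ^ s ∣ a (φ k) i - l i := by
  obtain ⟨l, φ, hφ, hl⟩ := CompactSpace.tendsto_subseq a
  refine ⟨l, φ, hφ, fun s => eventually_all.mpr fun i => ?_⟩
  have h1 : Tendsto (fun k => ‖((a (φ k) i - l i : integers E) : PadicAlgCl p)‖) atTop (𝓝 0) := by
    have h2 := (tendsto_pi_nhds.mp hl i).sub_const (l i)
    rw [sub_self] at h2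
    simpa using (continuous_subtype_val.tendsto _).comp h2 |>.norm
  have hpos : 0 < ‖((π ^ s : integers E) : PadicAlgCl p)‖ :=
    norm_pos_iff.mpr fun h => pow_ne_zero s hπ.ne_zero (Subtype.ext h)
  filter_upwards [h1.eventually (gt_mem_nhds hpos)] with k hk
  exact dvd_of_norm_le (pow_ne_zero s hπ.ne_zero) hk.le

end Uniformizer

end LubinTateManinMumford

/-! ### Comparing values in `ℚ̄_p` and `ℂ_p` -/

namespace LubinTateManinMumford

open Filter Topology MvPowerSeries MvPowerSeries.WithPiTopology

variable {p : ℕ} [Fact p.Prime] {E F L : IntermediateField ℚ_[p] (PadicAlgCl p)}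

theorem finiteDimensional_of_le (h : E ≤ F) [FiniteDimensional ℚ_[p] F] :
    FiniteDimensional ℚ_[p] E :=
  FiniteDimensional.of_injective (IntermediateField.inclusion h).toLinearMap
    (IntermediateField.inclusion h).injective

/-- Finitely many elements of `ℚ̄_p` lie in a common finite extension. -/
theorem exists_finiteDimensional (F : IntermediateField ℚ_[p] (PadicAlgCl p))
    [FiniteDimensional ℚ_[p] F] {ι : Type*} [Finite ι] (y : ι → PadicAlgCl p) :
    ∃ L : IntermediateField ℚ_[p] (PadicAlgCl p), FiniteDimensional ℚ_[p] L ∧ F ≤ L ∧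
      ∀ i, y i ∈ L := by
  have : Finite (Set.range y) := Set.finite_range y
  have := IntermediateField.finiteDimensional_adjoin (K := ℚ_[p]) (S := Set.range y)
    fun x _ => Algebra.IsIntegral.isIntegral x
  exact ⟨F ⊔ IntermediateField.adjoin ℚ_[p] (Set.range y), IntermediateField.finiteDimensional_sup _ _,
    le_sup_left, fun i => (le_sup_right : _ ≤ F ⊔ _)
      (IntermediateField.subset_adjoin _ _ (Set.mem_range_self i))⟩

/-- A series with terms in a finite extension of `ℚ_p` that converges in `ℂ_p` converges in this
extension. -/
theorem exists_hasSum_of_hasSum_coe [FiniteDimensional ℚ_[p] L] {ι : Type*} {u : ι → PadicAlgCl p}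
    (hu : ∀ d, u d ∈ L) {a : ℂ_[p]} (ha : HasSum (fun d => (u d : ℂ_[p])) a) :
    ∃ b ∈ L, (b : ℂ_[p]) = a ∧ HasSum u b := by
  let V : Submodule ℚ_[p] (PadicAlgCl p) := Subalgebra.toSubmodule L.toSubalgebra
  have : FiniteDimensional ℚ_[p] V := inferInstanceAs (FiniteDimensional ℚ_[p] L)
  have hV : IsComplete (V : Set (PadicAlgCl p)) := V.complete_of_finiteDimensional
  have hcl : IsClosed ((fun x : PadicAlgCl p => (x : ℂ_[p])) '' V) :=
    ((UniformSpace.Completion.isUniformInducing_coe (PadicAlgCl p)).isComplete_iff.mpr hV).isClosed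
  have hsum : ∀ s : Finset ι, ∑ d ∈ s, (u d : ℂ_[p]) = ((∑ d ∈ s, u d : PadicAlgCl p) : ℂ_[p]) :=
    fun s => (map_sum (algebraMap (PadicAlgCl p) ℂ_[p]) u s).symm
  -- `ℚ̄_p` is not complete, but the finite extension `L` is, so its image in `ℂ_p` is closed and
  -- contains the limit of the partial sums.
  obtain ⟨b, hb, rfl⟩ := hcl.mem_of_tendsto ha <| .of_forall fun s =>
    ⟨∑ d ∈ s, u d, V.sum_mem fun d _ => hu d, (hsum s).symm⟩
  refine ⟨b, hb, rfl, ?_⟩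
  rw [HasSum, (UniformSpace.Completion.isUniformInducing_coe (PadicAlgCl p)).isInducing.tendsto_nhds_iff]
  exact ha.congr hsum

theorem coe_injective : Function.Injective fun x : PadicAlgCl p => (x : ℂ_[p]) :=
  (algebraMap (PadicAlgCl p) ℂ_[p]).injective

variable {σ : Type*} [Finite σ]

/-- The values of power series over finite extensions of `ℚ_p` at algebraic points may be
computed in `ℂ_p`. -/
theorem coe_ev [FiniteDimensional ℚ_[p] E] (φ : MvPowerSeries σ (integers E))
    {y : σ → PadicAlgCl p} {x : σ → unitBall ℂ_[p]} (hxy : ∀ i, (y i : ℂ_[p]) = x i)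
    (hx : ∀ i, IsTopologicallyNilpotent (x i)) :
    ((ev y φ : PadicAlgCl p) : ℂ_[p]) = (ev x φ : unitBall ℂ_[p]) := by
  obtain ⟨L, hL, hEL, hy⟩ := exists_finiteDimensional E y
  have h1 := (hasSum_ev hx φ).map (unitBall ℂ_[p]).subtype continuous_subtype_val
  have h1' : (⇑(unitBall ℂ_[p]).subtype ∘ fun d : σ →₀ ℕ =>
      algebraMap (integers E) (unitBall ℂ_[p]) (coeff d φ) * d.prod fun i e => x i ^ e) =
      fun d => ((algebraMap (integers E) (PadicAlgCl p) (coeff d φ) *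
        d.prod fun i e => y i ^ e : PadicAlgCl p) : ℂ_[p]) := by
    funext d
    change (unitBall ℂ_[p]).subtype _ = algebraMap (PadicAlgCl p) ℂ_[p] (_ * _)
    rw [map_mul, map_mul, Finsupp.prod, Finsupp.prod, map_prod, map_prod]
    refine congrArg₂ _ rfl (Finset.prod_congr rfl fun i _ => ?_)
    rw [map_pow, map_pow]
    exact congrArg (· ^ d i) (hxy i).symm
  obtain ⟨b, -, hb, hs⟩ := exists_hasSum_of_hasSum_coe (L := L)
    (u := fun d : σ →₀ ℕ => algebraMap (integers E) (PadicAlgCl p) (coeff d φ) *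
      d.prod fun i e => y i ^ e) (fun d => mul_mem (hEL (coeff d φ).2.1)
        (prod_mem fun i _ => pow_mem (hy i) _)) (h1' ▸ h1)
  rw [ev, hs.tsum_eq]
  exact hb

/-- The analogue of `coe_ev` for the values at tuples of power series. -/
theorem coe_coeff_ev [FiniteDimensional ℚ_[p] L] (hEL : E ≤ L) (φ : MvPowerSeries σ (integers E))
    {y : σ → PowerSeries (PadicAlgCl p)} {x : σ → PowerSeries (unitBall ℂ_[p])}
    (hyL : ∀ i k, PowerSeries.coeff k (y i) ∈ L)
    (hxy : ∀ i, PowerSeries.map (algebraMap (PadicAlgCl p) ℂ_[p]) (y i) =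
      PowerSeries.map (unitBall ℂ_[p]).subtype (x i))
    (hx : ∀ i, IsTopologicallyNilpotent (x i)) :
    (∀ k, PowerSeries.coeff k (ev y φ) ∈ L) ∧
      PowerSeries.map (algebraMap (PadicAlgCl p) ℂ_[p]) (ev y φ) =
        PowerSeries.map (unitBall ℂ_[p]).subtype (ev x φ) := by
  have h1 := hasSum_ev hx φ
  let u : (σ →₀ ℕ) → PowerSeries (PadicAlgCl p) := fun d =>
    algebraMap (integers E) (PowerSeries (PadicAlgCl p)) (coeff d φ) * d.prod fun i e => y i ^ e
  have hu : ∀ d, u d ∈ MvPowerSeries.ofSubring Unit L.toSubring := by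
    intro d
    refine mul_mem (fun e => ?_) (prod_mem fun i _ => pow_mem (fun e => ?_) _)
    · classical
      rw [PowerSeries.algebraMap_apply]
      change MvPowerSeries.coeff e (MvPowerSeries.C _) ∈ L
      rw [MvPowerSeries.coeff_C]
      split_ifs
      exacts [hEL (coeff d φ).2.1, L.zero_mem]
    · have := hyL i (e ())
      rwa [PowerSeries.coeff, ← Finsupp.unique_single] at this
  have hmap : ∀ d, PowerSeries.map (algebraMap (PadicAlgCl p) ℂ_[p]) (u d) =
      PowerSeries.map (unitBall ℂ_[p]).subtype (algebraMap (integers E)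
        (PowerSeries (unitBall ℂ_[p])) (coeff d φ) * d.prod fun i e => x i ^ e) := by
    intro d
    rw [map_mul, map_mul, Finsupp.prod, Finsupp.prod, map_prod, map_prod]
    refine congrArg₂ _ ?_ (Finset.prod_congr rfl fun i _ => ?_)
    · rw [PowerSeries.algebraMap_apply, PowerSeries.algebraMap_apply, PowerSeries.map_C,
        PowerSeries.map_C]
      rfl
    · rw [map_pow, map_pow, hxy]
  have h2 : ∀ k, ∃ b ∈ L, (b : ℂ_[p]) = (PowerSeries.coeff k (ev x φ) : unitBall ℂ_[p]) ∧
      HasSum (fun d => PowerSeries.coeff k (u d)) b := by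
    intro k
    refine exists_hasSum_of_hasSum_coe (fun d => hu d _) ?_
    have h3 := ((h1.map (PowerSeries.coeff k : PowerSeries (unitBall ℂ_[p]) →ₗ[_] _)
      (PowerSeries.WithPiTopology.continuous_coeff _ k)).map (unitBall ℂ_[p]).subtype
        continuous_subtype_val)
    refine (funext fun d => ?_ : (fun d => ((PowerSeries.coeff k (u d) : PadicAlgCl p) : ℂ_[p])) = _) ▸ h3
    have h4 := congrArg (PowerSeries.coeff k) (hmap d)
    rw [PowerSeries.coeff_map, PowerSeries.coeff_map] at h4
    exact h4
  choose b hbL hb hbs using h2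
  have h5 : ev y φ = PowerSeries.mk b := by
    refine HasSum.tsum_eq ?_
    rw [PowerSeries.WithPiTopology.hasSum_iff_hasSum_coeff]
    intro k
    rw [PowerSeries.coeff_mk]
    exact hbs k
  rw [h5]
  refine ⟨fun k => ?_, ?_⟩
  · rw [PowerSeries.coeff_mk]
    exact hbL k
  · ext k
    rw [PowerSeries.coeff_map, PowerSeries.coeff_map, PowerSeries.coeff_mk]
    exact hb k

end LubinTateManinMumford

/-! ### Algebraic torsion points and their infinitude -/

namespace LubinTateManinMumford

open Filter Topology MvPowerSeries MvPowerSeries.WithPiTopology LubinTateData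

variable {p : ℕ} [Fact p.Prime] {E F L : IntermediateField ℚ_[p] (PadicAlgCl p)}

theorem IsUniformizer.normUniformizer {D : LubinTateData (integers E)} (hD : IsUniformizer D.π) :
    Points.NormUniformizer D ℂ_[p] where
  pos := by
    rw [norm_algebraMap, norm_pos_iff]
    exact fun h => D.ne_zero (Subtype.ext h)
  lt_one := by
    rw [norm_algebraMap]
    exact hD.norm_lt_one

variable [FiniteDimensional ℚ_[p] E]

/-- The points with algebraic coordinate. -/
def algebraicPoints (D : LubinTateData (integers E)) :
    Submodule (integers E) (D.Points (unitBall ℂ_[p])) where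
  carrier := {P | ∃ y : PadicAlgCl p, (y : ℂ_[p]) = P.val}
  zero_mem' := ⟨0, rfl⟩
  add_mem' := by
    rintro P Q ⟨x, hx⟩ ⟨y, hy⟩
    refine ⟨ev ![x, y] D.G.toPowerSeries, ?_⟩
    rw [Points.val_add]
    exact coe_ev _ (fun i => by fin_cases i <;> assumption) (Points.nilpotent_pair P Q)
  smul_mem' := by
    rintro a P ⟨x, hx⟩
    exact ⟨ev (fun _ : Unit => x) (D.endo a),
      coe_ev _ (fun _ => hx) fun _ => P.isTopologicallyNilpotent⟩

/-- The point with a given coordinate in the open unit disc of `ℚ̄_p`. -/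
def toPoint (D : LubinTateData (integers E)) (x : PadicAlgCl p) (hx : ‖x‖ < 1) :
    D.Points (unitBall ℂ_[p]) :=
  ⟨⟨(x : ℂ_[p]), (PadicComplex.norm_extends p x).trans_le hx.le⟩,
    unitBall.isTopologicallyNilpotent_iff.mpr ((PadicComplex.norm_extends p x).trans_lt hx)⟩

theorem coe_iterate_evalOne (D : LubinTateData (integers E)) {x : PadicAlgCl p}
    {P : D.Points (unitBall ℂ_[p])} (hP : (x : ℂ_[p]) = P.val) (k : ℕ) :
    (((evalOne D.f)^[k] x : PadicAlgCl p) : ℂ_[p]) = (D.π ^ k • P).val := by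
  induction k generalizing x P with
  | zero => simpa using hP
  | succ k ih =>
    rw [Function.iterate_succ_apply, pow_succ, mul_smul]
    refine ih ?_
    rw [Points.val_π_smul, evalOne_eq_ev]
    exact coe_ev _ (fun _ => hP) fun _ => P.isTopologicallyNilpotent

theorem iterate_evalOne_eq_zero_iff (D : LubinTateData (integers E)) {x : PadicAlgCl p}
    {P : D.Points (unitBall ℂ_[p])} (hP : (x : ℂ_[p]) = P.val) (k : ℕ) :
    (evalOne D.f)^[k] x = 0 ↔ D.π ^ k • P = 0 := by
  rw [← Points.val_eq_zero, ← coe_injective.eq_iff, coe_iterate_evalOne D hP k]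
  exact ZeroMemClass.coe_eq_zero

theorem mem_torsionPoints_iff (D : LubinTateData (integers E)) {x : PadicAlgCl p} :
    x ∈ torsionPoints D.f ↔
      ∃ P : D.Points (unitBall ℂ_[p]), P.IsTorsion ∧ (x : ℂ_[p]) = P.val := by
  constructor
  · rintro ⟨hx, k, hk⟩
    exact ⟨toPoint D x hx, ⟨k, (iterate_evalOne_eq_zero_iff D rfl k).mp hk⟩, rfl⟩
  · rintro ⟨P, ⟨k, hk⟩, hP⟩
    refine ⟨?_, k, (iterate_evalOne_eq_zero_iff D hP k).mpr hk⟩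
    rw [← PadicComplex.norm_extends p x, hP]
    exact P.norm_val_lt_one

/-- The polynomial `X ^ q + π X` is a Lubin-Tate series. -/
theorem isLubinTateSeries_X_pow_add {R : Type*} [CommRing R] (D : LubinTateData R) :
    IsLubinTateSeries D.π (PowerSeries.X ^ D.q + PowerSeries.C D.π * PowerSeries.X) := by
  have hq := two_le_q (D := D)
  refine ⟨?_, ?_, fun k => ?_⟩
  · simp [show D.q ≠ 0 by omega]
  · simp [PowerSeries.coeff_X_pow, show 1 ≠ D.q by omega]
  · change D.π ∣ PowerSeries.coeff k (_ - PowerSeries.X ^ D.q)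
    rw [add_sub_cancel_left, PowerSeries.coeff_C_mul]
    exact dvd_mul_right _ _

/-- There is a compatible sequence of algebraic torsion points of increasing orders. -/
theorem exists_torsion_tower (D : LubinTateData (integers E)) (hD : IsUniformizer D.π) :
    ∃ P : ℕ → D.Points (unitBall ℂ_[p]), (∀ N, P N ∈ algebraicPoints D) ∧ P 0 ≠ 0 ∧
      D.π • P 0 = 0 ∧ ∀ N, D.π • P (N + 1) = P N := by
  have hq := two_le_q (D := D)
  have hlt := hD.norm_lt_one
  have hπ0 : (D.π : PadicAlgCl p) ≠ 0 := fun h => D.ne_zero (Subtype.ext h)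
  -- `θ` carries the polynomial `X ^ q + π X` to `f`. Roots of the polynomial exist in the
  -- algebraically closed field `ℚ̄_p`, which replaces a root-finding argument for the series `f`.
  obtain ⟨θ, hθ0, hθ1, hθ⟩ := D.exists_intertwiner (isLubinTateSeries_X_pow_add D) 1
  -- For `|x| ≥ 1` the term `x ^ q` dominates, so preimages of points of the open disc stay in it.
  have small : ∀ x : PadicAlgCl p, ‖x ^ D.q + D.π * x‖ < 1 → ‖x‖ < 1 := by
    intro x hx
    by_contra! h
    have h1 : ‖(D.π : PadicAlgCl p) * x‖ < ‖x ^ D.q‖ := by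
      rw [norm_mul, norm_pow]
      calc ‖(D.π : PadicAlgCl p)‖ * ‖x‖ < 1 * ‖x‖ :=
            mul_lt_mul_of_pos_right hlt (one_pos.trans_le h)
        _ = ‖x‖ ^ 1 := by simp
        _ ≤ _ := pow_le_pow_right₀ h (by omega)
    rw [IsUltrametricDist.norm_add_eq_max_of_norm_ne_norm h1.ne', max_eq_left h1.le, norm_pow] at hx
    exact absurd hx (not_lt.mpr (one_le_pow₀ h))
  have solve : ∀ y : PadicAlgCl p, ∃ x, x ^ D.q + D.π * x = y := by
    intro y
    let g : Polynomial (PadicAlgCl p) :=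
      Polynomial.X ^ D.q + (Polynomial.C (D.π : PadicAlgCl p) * Polynomial.X - Polynomial.C y)
    have hdeg : (Polynomial.C (D.π : PadicAlgCl p) * Polynomial.X - Polynomial.C y).degree <
        (D.q : WithBot ℕ) := by
      refine (Polynomial.degree_sub_le _ _).trans_lt (max_lt ?_ ?_)
      · refine (Polynomial.degree_C_mul_X_le _).trans_lt ?_
        exact_mod_cast hq
      · refine Polynomial.degree_C_le.trans_lt ?_
        exact_mod_cast (by omega : 0 < D.q)
    have hg : g.degree ≠ 0 := by
      rw [Polynomial.degree_add_eq_left_of_degree_lt (by rwa [Polynomial.degree_X_pow]),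
        Polynomial.degree_X_pow]
      exact_mod_cast (by omega : D.q ≠ 0)
    obtain ⟨x, hx⟩ := IsAlgClosed.exists_root g hg
    refine ⟨x, ?_⟩
    simp only [g, Polynomial.IsRoot.def, Polynomial.eval_add, Polynomial.eval_pow,
      Polynomial.eval_X, Polynomial.eval_sub, Polynomial.eval_mul, Polynomial.eval_C] at hx
    linear_combination hx
  obtain ⟨x₀, hx₀, hx₀0⟩ : ∃ x : PadicAlgCl p, x ^ D.q + D.π * x = 0 ∧ x ≠ 0 := by
    obtain ⟨x, hx⟩ := IsAlgClosed.exists_pow_nat_eq (-(D.π : PadicAlgCl p))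
      (n := D.q - 1) (by omega)
    refine ⟨x, ?_, fun h => ?_⟩
    · rw [show D.q = D.q - 1 + 1 by omega, pow_succ, hx]
      ring
    · rw [h, zero_pow (by omega)] at hx
      exact hπ0 (neg_eq_zero.mp hx.symm)
  choose s hs using solve
  let x : ℕ → PadicAlgCl p := fun N => s^[N] x₀
  have hxs : ∀ N, x (N + 1) ^ D.q + D.π * x (N + 1) = x N := fun N => by
    simp only [x, Function.iterate_succ_apply']
    exact hs _
  have hx1 : ∀ N, ‖x N‖ < 1 := by
    intro N
    induction N with
    | zero => exact small x₀ (by rw [hx₀]; simp)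
    | succ N ih => exact small _ (by rwa [hxs])
  let Q : ℕ → D.Points (unitBall ℂ_[p]) := fun N => toPoint D (x N) (hx1 N)
  have hQ : ∀ N (_ : Unit), IsTopologicallyNilpotent (Q N).val :=
    fun N _ => (Q N).isTopologicallyNilpotent
  let P : ℕ → D.Points (unitBall ℂ_[p]) := fun N =>
    ⟨ev (fun _ : Unit => (Q N).val) θ, isTopologicallyNilpotent_ev (hQ N) hθ0⟩
  have hPval : ∀ N, (P N).val = ev (fun _ : Unit => (Q N).val) θ := fun _ => rfl
  have hstep : ∀ N, (D.π • P N).val = ev (fun _ : Unit => (Q N).val ^ D.q +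
      algebraMap (integers E) (unitBall ℂ_[p]) D.π * (Q N).val) θ := by
    intro N
    have h1 : ev (fun _ : Unit => (Q N).val) (D.f.subst θ) =
        ev (fun _ : Unit => (P N).val) D.f := ev_subst (hQ N) (fun _ => hθ0) D.f
    have h2 : ev (fun _ : Unit => (Q N).val) (θ.subst (PowerSeries.X ^ D.q +
        PowerSeries.C D.π * PowerSeries.X : PowerSeries (integers E))) =
        ev (fun _ : Unit => ev (fun _ : Unit => (Q N).val) (PowerSeries.X ^ D.q +
          PowerSeries.C D.π * PowerSeries.X : PowerSeries (integers E))) θ :=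
      ev_subst (hQ N) (fun _ => (isLubinTateSeries_X_pow_add D).constantCoeff_eq) θ
    rw [Points.val_π_smul, ← h1, hθ, h2]
    congr 1
    funext _
    let ψ : PowerSeries (integers E) →+* unitBall ℂ_[p] :=
      (evalHom (R := integers E) _ (hQ N)).toRingHom
    have hψ : ∀ g : PowerSeries (integers E), ψ g = ev (fun _ : Unit => (Q N).val) g :=
      evalHom_apply (hQ N)
    have hX : ψ PowerSeries.X = (Q N).val := (hψ _).trans (ev_X (hQ N) ())
    have hC : ψ (PowerSeries.C D.π) = algebraMap (integers E) (unitBall ℂ_[p]) D.π :=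
      (hψ _).trans (ev_C (hQ N) D.π)
    rw [← hψ, map_add, map_mul, map_pow, hX, hC]
  refine ⟨P, fun N => ⟨ev (fun _ : Unit => x N) θ, ?_⟩, fun h => ?_, ?_, fun N => ?_⟩
  · exact coe_ev _ (fun _ => rfl) (hQ N)
  · obtain ⟨k, hk⟩ := exists_ev_eq_add hθ0 (Q 0).isTopologicallyNilpotent
    rw [hθ1, map_one] at hk
    -- The linear coefficient of `θ` is 1, so `θ` preserves norms on the open disc and `P 0` is
    -- nonzero because `x₀` is.
    have h3 : ‖(P 0).val‖ = ‖(Q 0).val‖ := by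
      rw [hPval, hk, show 1 * (Q 0).val + (Q 0).val ^ 2 * k = (Q 0).val * (1 + (Q 0).val * k)
        by ring]
      exact unitBall.norm_mul_one_add (unitBall.norm_mul_lt_one (Q 0).norm_val_lt_one)
    rw [h, Points.val_zero, norm_zero, eq_comm] at h3
    have h4 : ‖(x₀ : ℂ_[p])‖ = 0 := h3
    rw [PadicComplex.norm_extends, norm_eq_zero] at h4
    exact hx₀0 h4
  · refine Points.ext ((hstep 0).trans ?_)
    have h5 : (Q 0).val ^ D.q + algebraMap (integers E) (unitBall ℂ_[p]) D.π * (Q 0).val = 0 := by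
      refine Subtype.ext ?_
      have := congrArg (algebraMap (PadicAlgCl p) ℂ_[p]) hx₀
      rwa [map_add, map_mul, map_pow, map_zero] at this
    rw [h5]
    obtain ⟨k, hk⟩ := exists_ev_eq_add (S := unitBall ℂ_[p]) hθ0 .zero
    exact hk.trans (by rw [Points.val_zero]; ring)
  · refine Points.ext ((hstep (N + 1)).trans ?_)
    rw [hPval]
    congr 1
    funext _
    refine Subtype.ext ?_
    have := congrArg (algebraMap (PadicAlgCl p) ℂ_[p]) (hxs N)
    rwa [map_add, map_mul, map_pow] at this

/-- The members of the tower are distinct: `π ^ (N + 1)` kills `P N` but none of the later members.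
-/
theorem infinite_torsionPoints (D : LubinTateData (integers E)) (hD : IsUniformizer D.π) :
    (torsionPoints D.f).Infinite := by
  obtain ⟨P, hP, h0, h1, hs⟩ := exists_torsion_tower D hD
  have hpow : ∀ k N, D.π ^ k • P (N + k) = P N := by
    intro k
    induction k with
    | zero => simp
    | succ k ih =>
      intro N
      rw [pow_succ, mul_smul, ← add_assoc, hs, ih]
  have hzero : ∀ N, D.π ^ (N + 1) • P N = 0 := fun N => by
    have := hpow N 0
    rw [zero_add] at this
    rw [pow_succ', mul_smul, this, h1]
  choose x hx using hP
  refine Set.infinite_of_injective_forall_mem (f := x) (fun M N hMN => ?_) fun N =>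
    (mem_torsionPoints_iff D).mpr ⟨P N, ⟨_, hzero N⟩, hx N⟩
  have hP : P M = P N := Points.ext (Subtype.ext (by rw [← hx, ← hx, hMN]))
  have key : ∀ M k, P M ≠ P (k + (M + 1)) := by
    intro M k h
    have h2 := hpow (M + 1) k
    rw [← h, hzero] at h2
    have h3 := hpow k 0
    rw [zero_add, ← h2, smul_zero] at h3
    exact h0 h3.symm
  rcases lt_trichotomy M N with h | h | h
  · obtain ⟨k, rfl⟩ : ∃ k, N = k + (M + 1) := ⟨N - M - 1, by omega⟩
    exact absurd hP (key M k)
  · exact h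
  · obtain ⟨k, rfl⟩ : ∃ k, M = k + (N + 1) := ⟨M - N - 1, by omega⟩
    exact absurd hP.symm (key N k)

end LubinTateManinMumford

/-! ### A torsion translate excludes boundedness away from zero -/

namespace LubinTateManinMumford

open Filter Topology MvPowerSeries MvPowerSeries.WithPiTopology LubinTateData

variable {p : ℕ} [Fact p.Prime] {E F : IntermediateField ℚ_[p] (PadicAlgCl p)}

theorem map_injective {R S : Type*} [CommRing R] [CommRing S] {ρ : R →+* S}
    (hρ : Function.Injective ρ) : Function.Injective (PowerSeries.map ρ) := by
  intro a b h
  ext k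
  have := congrArg (PowerSeries.coeff k) h
  rw [PowerSeries.coeff_map, PowerSeries.coeff_map] at this
  exact hρ this

/-- The parametrization of a translate, over the ring of integers of `ℂ_p`. -/
def ballTranslate (G : FormalGroup (integers E)) {n : ℕ} (h : Fin n → PowerSeries (integers F))
    (ξ : Fin n → unitBall ℂ_[p]) : Fin n → PowerSeries (unitBall ℂ_[p]) :=
  fun i => ev ![PowerSeries.map (algebraMap (integers F) (unitBall ℂ_[p])) (h i),
    PowerSeries.C (ξ i)] G.toPowerSeries

theorem isTopologicallyNilpotent_pair {h : PowerSeries (integers F)}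
    (hh : PowerSeries.constantCoeff h = 0) {ξ : unitBall ℂ_[p]} (hξ : IsTopologicallyNilpotent ξ)
    (i : Fin 2) : IsTopologicallyNilpotent
      ((![PowerSeries.map (algebraMap (integers F) (unitBall ℂ_[p])) h, PowerSeries.C ξ] :
        Fin 2 → PowerSeries (unitBall ℂ_[p])) i) := by
  refine LinearTopology.isTopologicallyNilpotent_of_constantCoeff ?_
  fin_cases i
  · have : PowerSeries.constantCoeff (PowerSeries.map (algebraMap (integers F) (unitBall ℂ_[p])) h)
        = 0 := by
      rw [← PowerSeries.coeff_zero_eq_constantCoeff_apply, PowerSeries.coeff_map,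
        PowerSeries.coeff_zero_eq_constantCoeff_apply, hh, map_zero]
    exact (congrArg IsTopologicallyNilpotent this).mpr .zero
  · exact (congrArg IsTopologicallyNilpotent (PowerSeries.constantCoeff_C ξ)).mpr hξ

theorem isTopologicallyNilpotent_ballTranslate (G : FormalGroup (integers E)) {n : ℕ}
    {h : Fin n → PowerSeries (integers F)} (hh : ∀ i, PowerSeries.constantCoeff (h i) = 0)
    {ξ : Fin n → unitBall ℂ_[p]} (hξ : ∀ i, IsTopologicallyNilpotent (ξ i)) (i : Fin n) :
    IsTopologicallyNilpotent (ballTranslate G h ξ i) :=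
  isTopologicallyNilpotent_ev (isTopologicallyNilpotent_pair (hh i) (hξ i)) G.zero_constantCoeff

/-- The vanishing of a power series on a translate may be checked over the ring of integers
of `ℂ_p`. -/
theorem eval_translate_eq_zero_iff [FiniteDimensional ℚ_[p] F] (hEF : E ≤ F)
    (G : FormalGroup (integers E)) {n : ℕ} {h : Fin n → PowerSeries (integers F)}
    (hh : ∀ i, PowerSeries.constantCoeff (h i) = 0) {ξ : Fin n → PadicAlgCl p}
    {Ξ : Fin n → unitBall ℂ_[p]} (hξ : ∀ i, (ξ i : ℂ_[p]) = Ξ i)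
    (hΞ : ∀ i, IsTopologicallyNilpotent (Ξ i)) (φ : MvPowerSeries (Fin n) (integers F)) :
    eval φ (translate G h ξ) = 0 ↔ ev (ballTranslate G h Ξ) φ = 0 := by
  obtain ⟨L, hL, hFL, hξL⟩ := exists_finiteDimensional F ξ
  have h1 := fun i => coe_coeff_ev (L := L) (hEF.trans hFL) G.toPowerSeries
    (y := ![PowerSeries.map (integers F).subtype (h i), PowerSeries.C (ξ i)])
    (x := ![PowerSeries.map (algebraMap (integers F) (unitBall ℂ_[p])) (h i),
      PowerSeries.C (Ξ i)]) (fun j k => by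
        fin_cases j
        · change PowerSeries.coeff k (PowerSeries.map (integers F).subtype (h i)) ∈ L
          rw [PowerSeries.coeff_map]
          exact hFL (PowerSeries.coeff k (h i)).2.1
        · change PowerSeries.coeff k (PowerSeries.C (ξ i)) ∈ L
          rw [PowerSeries.coeff_C]
          split_ifs
          exacts [hξL i, L.zero_mem]) (fun j => by
        fin_cases j
        · change PowerSeries.map _ (PowerSeries.map _ _) = PowerSeries.map _ (PowerSeries.map _ _)
          ext k
          simp only [PowerSeries.coeff_map]
          rfl
        · change PowerSeries.map _ (PowerSeries.C _) = PowerSeries.map _ (PowerSeries.C _)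
          rw [PowerSeries.map_C, PowerSeries.map_C]
          exact congrArg _ (hξ i)) (isTopologicallyNilpotent_pair (hh i) (hΞ i))
  have h2 : translate G h ξ = fun i => ev ![PowerSeries.map (integers F).subtype (h i),
      PowerSeries.C (ξ i)] G.toPowerSeries := funext fun i => eval_eq_ev _ _
  have h3 := (coe_coeff_ev (L := L) hFL φ (y := translate G h ξ) (x := ballTranslate G h Ξ)
    (h2 ▸ fun i => (h1 i).1) (h2 ▸ fun i => (h1 i).2)
    (isTopologicallyNilpotent_ballTranslate G hh hΞ)).2
  rw [eval_eq_ev]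
  have i1 := map_injective (algebraMap (PadicAlgCl p) ℂ_[p]).injective
  have i2 := map_injective (ρ := (unitBall ℂ_[p]).subtype) Subtype.val_injective
  rw [← map_eq_zero_iff _ i1, h3, map_eq_zero_iff _ i2]

variable [FiniteDimensional ℚ_[p] E]

section EndoHom

variable (hEF : E ≤ F) {D : LubinTateData (integers E)} {h : PowerSeries (integers F)}
  (hh : IsEndomorphism (D.G.map (integersInclusion hEF)) h)

/-- The action of an endomorphism of the Lubin-Tate group over a larger ring on points. -/
def endoHom : D.Points (unitBall ℂ_[p]) →+ D.Points (unitBall ℂ_[p]) :=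
  AddMonoidHom.mk' (fun P => ⟨ev (fun _ : Unit => P.val) h, isTopologicallyNilpotent_ev
    (fun _ => P.isTopologicallyNilpotent) hh.constantCoeff_eq⟩) <| by
    intro P Q
    have hPQ := Points.nilpotent_pair P Q
    have hX : ∀ i : Fin 2, MvPowerSeries.constantCoeff (MvPowerSeries.subst (fun _ : Unit =>
        (X i : MvPowerSeries (Fin 2) (integers F))) h) = 0 := fun i =>
      constantCoeff_subst_eq_zero (hasSubst_of_constantCoeff_zero fun _ => by simp)
        (fun _ => by simp) hh.constantCoeff_eq
    have e := congrArg (ev ![P.val, Q.val]) hh.map_add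
    have e1 : ev ![P.val, Q.val] (h.subst (D.G.map (integersInclusion hEF)).toPowerSeries) =
        ev (fun _ : Unit => ev ![P.val, Q.val] (D.G.map (integersInclusion hEF)).toPowerSeries)
          h := ev_subst hPQ (fun _ => (D.G.map (integersInclusion hEF)).zero_constantCoeff) h
    have e2 := Points.ev_subst_pair hPQ (hX 0) (hX 1)
      (D.G.map (integersInclusion hEF)).toPowerSeries
    have e3 : ∀ x : Fin 2 → unitBall ℂ_[p], ev x (D.G.map (integersInclusion hEF)).toPowerSeries =
      ev x D.G.toPowerSeries := fun x => ev_map _ (fun _ => rfl) x _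
    have e4 : ∀ i : Fin 2, ev ![P.val, Q.val] (MvPowerSeries.subst (fun _ : Unit =>
        (X i : MvPowerSeries (Fin 2) (integers F))) h) =
        ev (fun _ : Unit => ![P.val, Q.val] i) h := fun i => by
      rw [ev_subst hPQ (by simp)]
      simp only [ev_X hPQ]
    rw [e4, e4, e3] at e2
    rw [e1, e3] at e
    exact Points.ext (e.trans e2)

theorem val_endoHom (P : D.Points (unitBall ℂ_[p])) :
    (endoHom hEF hh P).val = ev (fun _ : Unit => P.val) h := rfl

/-- The unit linear term dominates. Applied to differences, this makes such an endomorphism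
injective on points. -/
theorem norm_endoHom (hu : IsUnit (PowerSeries.coeff 1 h)) (P : D.Points (unitBall ℂ_[p])) :
    ‖(endoHom hEF hh P).val‖ = ‖P.val‖ := by
  obtain ⟨k, hk⟩ := exists_ev_eq_add hh.constantCoeff_eq P.isTopologicallyNilpotent
  obtain ⟨v, hv⟩ := hu
  let a := algebraMap (integers F) (unitBall ℂ_[p])
  have h1 : a ↑v * a ↑v⁻¹ = 1 := by
    rw [← map_mul, Units.mul_inv, map_one]
  have h2 : ‖a ↑v‖ = 1 := by
    refine le_antisymm (unitBall.norm_le_one _) ?_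
    have h3 : ‖(1 : unitBall ℂ_[p])‖ = 1 := norm_one (α := ℂ_[p])
    rw [← h1, unitBall.norm_mul] at h3
    rw [← h3]
    exact mul_le_of_le_one_right (norm_nonneg _) (unitBall.norm_le_one _)
  rw [val_endoHom, hk, ← hv, show a ↑v * P.val + P.val ^ 2 * k =
    a ↑v * P.val * (1 + P.val * (k * a ↑v⁻¹)) by linear_combination (-(P.val ^ 2 * k)) * h1,
    unitBall.norm_mul_one_add (unitBall.norm_mul_lt_one P.norm_val_lt_one), unitBall.norm_mul, h2,
    one_mul]

/-- The endomorphism is defined over `O_F` and is only known to be additive, so the argument passes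
through multiplication by powers of `p`. -/
theorem isTorsion_endoHom (hD : IsUniformizer D.π) {P : D.Points (unitBall ℂ_[p])}
    (hP : P.IsTorsion) : (endoHom hEF hh P).IsTorsion := by
  obtain ⟨N, hN⟩ := hP
  obtain ⟨e, he⟩ := hD.p_dvd_pow
  have h1 : (p ^ N) • P = 0 := by
    obtain ⟨c, hc⟩ := pow_dvd_pow_of_dvd hD.dvd_p N
    have : ((p ^ N : ℕ) : integers E) • P = 0 := by
      rw [Nat.cast_pow, hc, mul_comm, mul_smul, hN, smul_zero]
    exact (Nat.cast_smul_eq_nsmul (integers E) (p ^ N) P).symm.trans this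
  have h2 : ((p ^ N : ℕ) : integers E) • endoHom hEF hh P = 0 := by
    refine (Nat.cast_smul_eq_nsmul (integers E) (p ^ N) (endoHom hEF hh P)).trans ?_
    rw [← map_nsmul, h1, map_zero]
  obtain ⟨c, hc⟩ := pow_dvd_pow_of_dvd he N
  refine ⟨e * N, ?_⟩
  rw [pow_mul, hc, mul_comm, mul_smul, ← Nat.cast_pow, h2, smul_zero]

/-- The values on a translate are values at points of the group. -/
theorem ev_endoHom_add_eq_zero {n : ℕ} {h : Fin n → PowerSeries (integers F)}
    (hh : ∀ i, IsEndomorphism (D.G.map (integersInclusion hEF)) (h i))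
    (Ξ : Fin n → D.Points (unitBall ℂ_[p])) {φ : MvPowerSeries (Fin n) (integers F)}
    (hφ : ev (ballTranslate D.G h fun i => (Ξ i).val) φ = 0) (P : D.Points (unitBall ℂ_[p])) :
    ev (fun i => (endoHom hEF (hh i) P + Ξ i).val) φ = 0 := by
  have hP : ∀ _ : Unit, IsTopologicallyNilpotent P.val := fun _ => P.isTopologicallyNilpotent
  have hh0 := fun i => (hh i).constantCoeff_eq
  obtain ⟨ψ, hψ, hψev, -, hψC⟩ := exists_continuous_evalHom hP (unitBall ℂ_[p])
  have hψE : ∀ a, ψ (algebraMap (integers E) (PowerSeries (unitBall ℂ_[p])) a) =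
    algebraMap (integers E) (unitBall ℂ_[p]) a := fun a => by
    rw [PowerSeries.algebraMap_apply]
    exact hψC _
  have hψF : ∀ a, ψ (algebraMap (integers F) (PowerSeries (unitBall ℂ_[p])) a) =
    algebraMap (integers F) (unitBall ℂ_[p]) a := fun a => by
    rw [PowerSeries.algebraMap_apply]
    exact hψC _
  have h1 := map_ev (isTopologicallyNilpotent_ballTranslate D.G hh0
    fun i => (Ξ i).isTopologicallyNilpotent) (ψ : PowerSeries (unitBall ℂ_[p]) →+* _) hψ hψF φ
  rw [hφ, map_zero] at h1
  rw [h1]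
  congr 1
  funext i
  rw [Points.val_add, ballTranslate, map_ev (isTopologicallyNilpotent_pair (hh0 i)
    (Ξ i).isTopologicallyNilpotent) (ψ : PowerSeries (unitBall ℂ_[p]) →+* _) hψ hψE]
  congr 1
  funext j
  fin_cases j
  · refine Eq.symm ((hψev _).trans ?_)
    exact ev_map (algebraMap (integers F) (unitBall ℂ_[p])) (fun _ => rfl) _ _
  · exact (hψC _).symm

end EndoHom

/-- All of `I` vanishes at the images of the torsion points, so every image lies in the exceptional
set; there are infinitely many of them. -/
theorem not_boundedAwayFromZero_of_contains [FiniteDimensional ℚ_[p] F] (hEF : E ≤ F) (D : LubinTateData (integers E))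
    (hD : IsUniformizer D.π) {n : ℕ} {I : Ideal (MvPowerSeries (Fin n) (integers F))}
    (hI : ContainsTorsionTranslate hEF D.f D.G I) : ¬ BoundedAwayFromZero D.f I := by
  rintro ⟨C, hC, S, hS, -, hCS⟩
  obtain ⟨ξ, hξ, h, ⟨hh, i₀, hu⟩, hφ⟩ := hI
  choose Ξ hΞt hΞ using fun i => (mem_torsionPoints_iff D).mp (hξ i)
  choose P hPt hP using fun x : torsionPoints D.f => (mem_torsionPoints_iff D).mp x.2
  let Q : torsionPoints D.f → Fin n → D.Points (unitBall ℂ_[p]) := fun x i =>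
    endoHom hEF (hh i) (P x) + Ξ i
  have hQ : ∀ x i, (Q x i).IsTorsion := fun x i =>
    (isTorsion_endoHom hEF (hh i) hD (hPt x)).add (hΞt i)
  have hQa : ∀ x i, ∃ y : PadicAlgCl p, (y : ℂ_[p]) = (Q x i).val := by
    intro x i
    have h1 : ((ev (fun _ : Unit => (x : PadicAlgCl p)) (h i) : PadicAlgCl p) : ℂ_[p]) =
        (endoHom hEF (hh i) (P x)).val :=
      coe_ev _ (fun _ => hP x) fun _ => (P x).isTopologicallyNilpotent
    exact (algebraicPoints D).add_mem (x := endoHom hEF (hh i) (P x)) ⟨_, h1⟩ ⟨_, hΞ i⟩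
  choose y hy using hQa
  have hyS : ∀ x, y x ∈ S := by
    intro x
    by_contra hxS
    obtain ⟨φ, hφI, hlt⟩ := hCS (y x)
      ⟨fun i => (mem_torsionPoints_iff D).mpr ⟨Q x i, hQ x i, hy x i⟩, hxS⟩
    have h0 : eval φ (y x) = 0 := by
      rw [eval_eq_ev]
      refine coe_injective ?_
      change ((ev (y x) φ : PadicAlgCl p) : ℂ_[p]) = ((0 : PadicAlgCl p) : ℂ_[p])
      rw [coe_ev φ (hy x) fun i => (Q x i).isTopologicallyNilpotent,
        ev_endoHom_add_eq_zero hEF hh Ξ ((eval_translate_eq_zero_iff hEF D.G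
          (fun i => (hh i).constantCoeff_eq) hΞ (fun i => (Ξ i).isTopologicallyNilpotent) φ).mp
            (hφ φ hφI)) (P x)]
      rfl
    rw [h0, norm_zero] at hlt
    exact absurd hlt hC.not_gt
  -- The component `i₀` with unit linear coefficient already separates points.
  have hinj : Function.Injective y := by
    intro a b hab
    have h1 : Q a i₀ = Q b i₀ := Points.ext (Subtype.ext (by rw [← hy, ← hy, hab]))
    have h2 : endoHom hEF (hh i₀) (P a - P b) = 0 := by
      rw [map_sub, sub_eq_zero]
      exact add_right_cancel h1
    have h3 := norm_endoHom hEF (hh i₀) hu (P a - P b)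
    rw [h2, Points.val_zero, norm_zero, eq_comm, norm_eq_zero, Points.val_eq_zero, sub_eq_zero] at h3
    exact Subtype.ext (coe_injective (by
      change ((a : PadicAlgCl p) : ℂ_[p]) = ((b : PadicAlgCl p) : ℂ_[p])
      rw [hP, hP, h3]))
  have : Infinite (torsionPoints D.f) := (infinite_torsionPoints D hD).to_subtype
  exact Set.infinite_of_injective_forall_mem hinj hyS hS

end LubinTateManinMumford

/-! ### From failure of boundedness to a torsion translate -/

namespace LubinTateData.Points

open MvPowerSeries MvPowerSeries.WithPiTopology

variable {R : Type*} [CommRing R] [IsDomain R] {D : LubinTateData R} {n r : ℕ}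
  {S S' : Type*} [CommRing S] [Algebra R S] [UniformSpace S] [T2Space S]
  [CompleteSpace S] [IsUniformAddGroup S] [IsTopologicalRing S] [IsLinearTopology S S]
  [CommRing S'] [Algebra R S'] [UniformSpace S'] [T2Space S']
  [CompleteSpace S'] [IsUniformAddGroup S'] [IsTopologicalRing S'] [IsLinearTopology S' S']

theorem smul_zero' (a : R) : a • (0 : D.Points S) = 0 := smul_zero a

/-- The image of a tuple of points under an affine map with integral linear part. -/
def affine (B : Fin n → Fin r → R) (ξ : Fin n → D.Points S) (w : Fin r → D.Points S) (i : Fin n) :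
    D.Points S :=
  ξ i + ∑ j, B i j • w j

theorem map_affine (B : Fin n → Fin r → R) (ψ : D.Points S →ₗ[R] D.Points S') (ξ : Fin n → D.Points S)
    (w : Fin r → D.Points S) (i : Fin n) :
    ψ (affine B ξ w i) = affine B (fun i => ψ (ξ i)) (fun j => ψ (w j)) i := by
  simp [affine, map_sum]

/-- The constant points over a power series ring. -/
def const (D : LubinTateData R) (σ : Type*) [Finite σ] :
    D.Points S →ₗ[R] D.Points (MvPowerSeries σ S) :=
  Points.map C continuous_C fun _ => MvPowerSeries.algebraMap_apply.symm

/-- The variables as points over a power series ring. -/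
def var (D : LubinTateData R) (S : Type*) [CommRing S] [Algebra R S] [UniformSpace S] [T2Space S]
    [CompleteSpace S] [IsUniformAddGroup S] [IsTopologicalRing S] [IsLinearTopology S S]
    {σ : Type*} [Finite σ] (j : σ) : D.Points (MvPowerSeries σ S) :=
  ⟨X j, LinearTopology.isTopologicallyNilpotent_of_constantCoeff (by
    rw [constantCoeff_X]
    exact .zero)⟩

end LubinTateData.Points

namespace LubinTateManinMumford

open Filter Topology MvPowerSeries MvPowerSeries.WithPiTopology LubinTateData

variable {p : ℕ} [Fact p.Prime] {E F L : IntermediateField ℚ_[p] (PadicAlgCl p)}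

/-- A sum of elements of norm less than 1 cannot be 1. This extracts a unit entry from a column of a
matrix with a left inverse. -/
theorem exists_isUnit_of_sum_eq_one {n : ℕ} {c b : Fin n → integers E}
    (h : ∑ i, c i * b i = 1) : ∃ i, IsUnit (b i) := by
  by_contra! hb
  have hlt : ∀ i, ‖((c i * b i : integers E) : PadicAlgCl p)‖ < 1 := by
    intro i
    have h1 : ‖(b i : PadicAlgCl p)‖ < 1 :=
      lt_of_le_of_ne (b i).2.2 fun h1 => hb i (isUnit_of_norm_eq_one h1)
    have h2 : ‖((c i * b i : integers E) : PadicAlgCl p)‖ =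
      ‖(c i : PadicAlgCl p)‖ * ‖(b i : PadicAlgCl p)‖ := norm_mul (c i : PadicAlgCl p) (b i)
    rw [h2]
    exact (mul_le_of_le_one_left (norm_nonneg _) (c i).2.2).trans_lt h1
  have h1 : ∑ i, ((c i * b i : integers E) : PadicAlgCl p) = 1 := by
    have := congrArg (integers E).subtype h
    rwa [map_sum, map_one] at this
  have hne : (Finset.univ : Finset (Fin n)).Nonempty := by
    by_contra hne
    rw [Finset.not_nonempty_iff_eq_empty.mp hne, Finset.sum_empty] at h1
    exact zero_ne_one h1
  obtain ⟨i, -, hi⟩ := IsUltrametricDist.exists_norm_finsetSum_le_of_nonempty hne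
    fun i => ((c i * b i : integers E) : PadicAlgCl p)
  rw [h1, norm_one] at hi
  exact absurd (hlt i) (not_lt.mpr hi)

theorem isEndomorphism_map_endo (hEF : E ≤ F) (D : LubinTateData (integers E)) (a : integers E) :
    IsEndomorphism (D.G.map (integersInclusion hEF))
      (PowerSeries.map (integersInclusion hEF) (D.endo a)) := by
  have hX : ∀ i : Fin 2, MvPowerSeries.constantCoeff (MvPowerSeries.subst (fun _ : Unit =>
      (X i : MvPowerSeries (Fin 2) (integers E))) (D.endo a)) = 0 := fun i =>
    constantCoeff_subst_endo (by simp)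
  have hXs : ∀ i : Fin 2, HasSubst fun _ : Unit => (X i : MvPowerSeries (Fin 2) (integers E)) :=
    fun i => hasSubst_of_constantCoeff_zero fun _ => by simp
  have hmX : ∀ i : Fin 2, MvPowerSeries.map (integersInclusion hEF) (MvPowerSeries.subst
      (fun _ : Unit => (X i : MvPowerSeries (Fin 2) (integers E))) (D.endo a)) =
      (PowerSeries.map (integersInclusion hEF) (D.endo a)).subst
        (X i : MvPowerSeries (Fin 2) (integers F)) := fun i => by
    rw [MvPowerSeries.map_subst (hXs i)]
    simp only [map_X]
    rfl
  refine ⟨?_, ?_⟩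
  · rw [← PowerSeries.coeff_zero_eq_constantCoeff_apply, PowerSeries.coeff_map,
      PowerSeries.coeff_zero_eq_constantCoeff_apply]
    exact (congrArg _ (D.constantCoeff_endo a)).trans (map_zero _)
  · have h := congrArg (MvPowerSeries.map (integersInclusion hEF)) (D.endo_subst_G a)
    rw [MvPowerSeries.map_subst (hasSubst_of_constantCoeff_zero fun _ => D.G.zero_constantCoeff),
      MvPowerSeries.map_subst (hasSubst_of_constantCoeff_zero fun i => by
        fin_cases i
        exacts [hX 0, hX 1])] at h
    refine h.trans ?_
    congr 1
    funext i
    fin_cases i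
    exacts [hmX 0, hmX 1]

theorem algebraMap_mem_ofSubring (hEL : E ≤ L) (σ : Type*) (a : integers E) :
    algebraMap (integers E) (MvPowerSeries σ (unitBall ℂ_[p])) a ∈
      MvPowerSeries.ofSubring σ (algebraMap (integers L) (unitBall ℂ_[p])).range := by
  classical
  intro d
  rw [MvPowerSeries.algebraMap_apply, MvPowerSeries.coeff_C]
  split_ifs
  exacts [⟨integersInclusion hEL a, rfl⟩, Subring.zero_mem _]

theorem X_mem_ofSubring {σ S : Type*} [CommRing S] (A : Subring S) (j : σ) :
    X j ∈ MvPowerSeries.ofSubring σ A := by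
  classical
  intro d
  rw [coeff_X]
  split_ifs
  exacts [A.one_mem, A.zero_mem]

theorem C_mem_ofSubring {σ S : Type*} [CommRing S] {A : Subring S} {a : S} (ha : a ∈ A) :
    C a ∈ MvPowerSeries.ofSubring σ A := by
  classical
  intro d
  rw [coeff_C]
  split_ifs
  exacts [ha, A.zero_mem]

variable [FiniteDimensional ℚ_[p] E] [FiniteDimensional ℚ_[p] F]

theorem exists_torsion_sequence (D : LubinTateData (integers E)) (hD : IsUniformizer D.π) {n : ℕ}
    {I : Ideal (MvPowerSeries (Fin n) (integers F))} (hI : ¬ BoundedAwayFromZero D.f I) :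
    ∃ Z : ℕ → Fin n → D.Points (unitBall ℂ_[p]), (∀ k i, (Z k i).IsTorsion) ∧
      (∀ k i, Z k i ∈ algebraicPoints D) ∧ (∀ k, ∃ i, D.π ^ k • Z k i ≠ 0) ∧
      ∀ k, ∀ φ ∈ I, ‖ev (fun i => (Z k i).val) φ‖ ≤ 1 / ((k : ℝ) + 1) := by
  have := hD.normUniformizer
  have key : ∀ k : ℕ, ∃ Z : Fin n → D.Points (unitBall ℂ_[p]), (∀ i, (Z i).IsTorsion) ∧
      (∀ i, Z i ∈ algebraicPoints D) ∧ (∃ i, D.π ^ k • Z i ≠ 0) ∧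
      ∀ φ ∈ I, ‖ev (fun i => (Z i).val) φ‖ ≤ 1 / ((k : ℝ) + 1) := by
    intro k
    by_contra! hk
    -- Test boundedness with constant `1 / (k + 1)` and the finite exceptional set of tuples killed
    -- by `π ^ k`; its failure supplies the tuple `Z`.
    refine hI ⟨1 / ((k : ℝ) + 1), by positivity,
      {ζ | ζ ∈ torsionTuples D.f n ∧ ∀ i, (evalOne D.f)^[k] (ζ i) = 0}, ?_, fun ζ h => h.1, ?_⟩
    · have hfin : {x : PadicAlgCl p | x ∈ torsionPoints D.f ∧ (evalOne D.f)^[k] x = 0}.Finite := by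
        refine Set.Finite.of_finite_image (f := fun x : PadicAlgCl p => (x : ℂ_[p]))
          (((Points.finite_π_pow_torsion (K := ℂ_[p]) D k).image fun P => (P.val : ℂ_[p])).subset ?_)
          coe_injective.injOn
        rintro _ ⟨x, ⟨hx, hxk⟩, rfl⟩
        obtain ⟨P, -, hP⟩ := (mem_torsionPoints_iff D).mp hx
        exact ⟨P, (iterate_evalOne_eq_zero_iff D hP k).mp hxk, hP.symm⟩
      refine (Set.Finite.pi' fun _ : Fin n => hfin).subset fun ζ hζ i => ⟨hζ.1 i, hζ.2 i⟩
    · rintro ζ ⟨hζ, hζS⟩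
      choose Z hZt hZ using fun i => (mem_torsionPoints_iff D).mp (hζ i)
      have hne : ∃ i, D.π ^ k • Z i ≠ 0 := by
        by_contra! h
        exact hζS ⟨hζ, fun i => (iterate_evalOne_eq_zero_iff D (hZ i) k).mpr (h i)⟩
      obtain ⟨φ, hφI, hφ⟩ := hk Z hZt (fun i => ⟨_, hZ i⟩) hne
      refine ⟨φ, hφI, ?_⟩
      rw [eval_eq_ev, ← PadicComplex.norm_extends p, coe_ev φ hZ
        fun i => (Z i).isTopologicallyNilpotent]
      exact hφ
  choose Z h1 h2 h3 h4 using key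
  exact ⟨Z, h1, h2, h3, h4⟩

open Points in
theorem contains_of_not_boundedAwayFromZero (hEF : E ≤ F) (D : LubinTateData (integers E))
    (hD : IsUniformizer D.π) {n : ℕ} {I : Ideal (MvPowerSeries (Fin n) (integers F))}
    (hI : ¬ BoundedAwayFromZero D.f I) : ContainsTorsionTranslate hEF D.f D.G I := by
  have := hD.normUniformizer
  obtain ⟨Z, hZt, hZa, hZk, hZI⟩ := exists_torsion_sequence D hD hI
  obtain ⟨θ, r, B, A, Ξ, w, hθ, hAB, hΞt, hΞa, hw, hdec⟩ :=
    exists_decomposition hD.exists_subseq Z hZt (algebraicPoints D) hZa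
  choose ξ hξ using hΞa
  -- With `r = 0` the subsequence would be constantly `ξ`, which a fixed power of `π` kills, whereas
  -- `π ^ k` does not kill `Z k`; here `k ≤ θ k` is used.
  obtain _ | r := r
  · choose N hN using hΞt
    obtain ⟨i, hi⟩ := hZk (θ (Finset.univ.sup N))
    refine absurd ?_ hi
    rw [hdec, Fin.sum_univ_zero, add_zero]
    exact pow_smul_eq_zero_of_le ((Finset.le_sup (Finset.mem_univ i)).trans (hθ.id_le _)) (hN i)
  obtain ⟨i₀, hi₀⟩ := exists_isUnit_of_sum_eq_one (c := A 0) (b := fun i => B i 0)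
    (by simpa using hAB 0 0)
  obtain ⟨L, hL, hFL, hξL⟩ := exists_finiteDimensional F ξ
  -- The generic point `ξ + B T`, with the variables `T_j` in place of `w`.
  let u : Fin n → D.Points (MvPowerSeries (Fin (r + 1)) (unitBall ℂ_[p])) :=
    affine B (fun i => const D _ (Ξ i)) (fun j => var D _ j)
  have hu : ∀ i, IsTopologicallyNilpotent (u i).val := fun i => (u i).isTopologicallyNilpotent
  let V := (algebraMap (integers L) (unitBall ℂ_[p])).range
  have hV : IsClosed (V : Set (unitBall ℂ_[p])) := isClosed_range_algebraMap
  have huV : ∀ i, (u i).val ∈ MvPowerSeries.ofSubring (Fin (r + 1)) V := by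
    intro i
    have h1 : u i ∈ Points.ofSubring D (MvPowerSeries.ofSubring (Fin (r + 1)) V)
        (isClosed_ofSubring _ hV) (algebraMap_mem_ofSubring (hEF.trans hFL) _) := by
      refine add_mem ?_ (sum_mem fun j _ => Submodule.smul_mem _ _ (X_mem_ofSubring V j))
      refine C_mem_ofSubring ⟨⟨ξ i, hξL i, ?_⟩, Subtype.ext (hξ i)⟩
      rw [← PadicComplex.norm_extends p, hξ]
      exact unitBall.norm_le_one (Ξ i).val
    exact h1
  obtain ⟨c, hc1, hc⟩ := exists_norm_le L
  have hzero : ∀ φ ∈ I, ev (fun i => (u i).val) φ = 0 := by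
    intro φ hφ
    have hg : ev (fun i => (u i).val) φ ∈ MvPowerSeries.ofSubring (Fin (r + 1)) V :=
      ev_mem (isClosed_ofSubring _ hV) (algebraMap_mem_ofSubring hFL _) hu huV φ
    refine unitBall.eq_zero_of_tendsto_ev hc1 (fun d e => hc _ (hg d) _ (hg e))
      (x := fun k j => (w k j).val) (fun k j => (w k j).norm_val_lt_one) hw.tendsto hw.lt ?_
    -- Specializing `T` to `w_k` turns `φ(ξ + B T)` into `φ(Z_{θ k})`, which tends to zero.
    have hev : ∀ k, ev (fun j => (w k j).val) (ev (fun i => (u i).val) φ) =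
        ev (fun i => (Z (θ k) i).val) φ := by
      intro k
      obtain ⟨ψ, hψ, hψev, hψX, hψC⟩ := exists_continuous_evalHom
        (fun j => (w k j).isTopologicallyNilpotent) (unitBall ℂ_[p])
      have hψE : ∀ a, ψ (algebraMap (integers E) _ a) =
          algebraMap (integers E) (unitBall ℂ_[p]) a := fun a => by
        rw [MvPowerSeries.algebraMap_apply]
        exact hψC _
      have hψF : ∀ a, ψ (algebraMap (integers F) _ a) =
          algebraMap (integers F) (unitBall ℂ_[p]) a := fun a => by
        rw [MvPowerSeries.algebraMap_apply]
        exact hψC _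
      rw [← hψev, map_ev hu ψ hψ hψF]
      congr 1
      funext i
      have h1 := map_affine B (Points.map (D := D) ψ hψ hψE) (fun i => const D _ (Ξ i))
        (fun j => var D _ j) i
      have h2 : (fun i => Points.map (D := D) ψ hψ hψE (const D _ (Ξ i))) = Ξ :=
        funext fun i => Points.ext (hψC _)
      have h3 : (fun j => Points.map (D := D) ψ hψ hψE (var D _ j)) = w k :=
        funext fun j => Points.ext (hψX j)
      rw [h2, h3] at h1
      rw [hdec k i]
      exact congrArg Points.val h1
    simp_rw [hev]
    refine squeeze_zero_norm (fun k => (hZI (θ k) φ hφ)) ?_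
    exact tendsto_one_div_add_atTop_nhds_zero_nat.comp hθ.tendsto_atTop
  let h : Fin n → PowerSeries (integers F) := fun i =>
    PowerSeries.map (integersInclusion hEF) (D.endo (B i 0))
  have hh : ∀ i, IsEndomorphism (D.G.map (integersInclusion hEF)) (h i) := fun i =>
    isEndomorphism_map_endo hEF D _
  refine ⟨ξ, fun i => (mem_torsionPoints_iff D).mpr ⟨Ξ i, hΞt i, hξ i⟩, h, ⟨hh, i₀, ?_⟩,
    fun φ hφ => ?_⟩
  · rw [PowerSeries.coeff_map, coeff_one_endo]
    exact hi₀.map _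
  rw [eval_translate_eq_zero_iff hEF D.G (fun i => (hh i).constantCoeff_eq) hξ
    fun i => (Ξ i).isTopologicallyNilpotent]
  -- Specialize to `T_0 = T` and `T_j = 0` for `j > 0`, which leaves `ξ_i + [B_{i0}](T)` in
  -- coordinate `i`.
  let v : Fin (r + 1) → D.Points (MvPowerSeries Unit (unitBall ℂ_[p])) :=
    Fin.cons (var D _ ()) fun _ => 0
  obtain ⟨χ, hχ, -, hχX, hχC⟩ := exists_continuous_evalHom
    (fun j => (v j).isTopologicallyNilpotent) (unitBall ℂ_[p])
  have hχC' : ∀ a, χ (C a) = C a := hχC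
  have hχE : ∀ a, χ (algebraMap (integers E) _ a) =
      algebraMap (integers E) (MvPowerSeries Unit (unitBall ℂ_[p])) a := fun a => by
    rw [MvPowerSeries.algebraMap_apply, MvPowerSeries.algebraMap_apply]
    exact hχC _
  have hχF : ∀ a, χ (algebraMap (integers F) _ a) =
      algebraMap (integers F) (MvPowerSeries Unit (unitBall ℂ_[p])) a := fun a => by
    rw [MvPowerSeries.algebraMap_apply, MvPowerSeries.algebraMap_apply]
    exact hχC _
  have h0 := map_ev hu χ hχ hχF φ
  rw [hzero φ hφ, map_zero] at h0
  rw [h0]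
  refine congrArg (fun x => ev x φ) (funext fun i => ?_)
  have h1 := map_affine B (Points.map (D := D) χ hχ hχE) (fun i => const D _ (Ξ i))
    (fun j => var D _ j) i
  have h2 : (fun i => Points.map (D := D) χ hχ hχE (const D _ (Ξ i))) = fun i => const D _ (Ξ i) :=
    funext fun i => Points.ext (hχC' _)
  have h3 : (fun j => Points.map (D := D) χ hχ hχE (var D _ j)) = v :=
    funext fun j => Points.ext (hχX j)
  rw [h2, h3] at h1
  have h4 : affine B (fun i => const D Unit (Ξ i)) v i = B i 0 • var D _ () + const D Unit (Ξ i) := by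
    have h5 : ∀ j : Fin r, B i j.succ • v j.succ = 0 := fun j => by
      have h6 : v j.succ = 0 := Fin.cons_succ (α := fun _ => D.Points _) _ _ j
      rw [h6]
      exact smul_zero' _
    rw [affine, Fin.sum_univ_succ, Finset.sum_eq_zero fun j _ => h5 j, add_zero, add_comm]
    rfl
  refine Eq.trans ?_ (congrArg Points.val (h4.symm.trans h1.symm))
  rw [val_add, ballTranslate]
  refine congrArg (fun x => ev x D.G.toPowerSeries) ?_
  refine congrArg₂ (fun a b => ![a, b]) ?_ rfl
  refine Eq.trans ?_ (ev_X_eq_map (σ := Unit) (D.endo (B i 0))).symm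
  ext k
  simp only [h, PowerSeries.coeff_map]
  rfl

end LubinTateManinMumford
end

theorem theorem3p6 (p : ℕ) [Fact p.Prime]
    (E F : IntermediateField ℚ_[p] (PadicAlgCl p)) [FiniteDimensional ℚ_[p] F] (hEF : E ≤ F)
    (π : LubinTateManinMumford.integers E) (hπ : LubinTateManinMumford.IsUniformizer π)
    (f : PowerSeries (LubinTateManinMumford.integers E))
    (G : FormalGroup (LubinTateManinMumford.integers E))
    (hG : LubinTateManinMumford.IsLubinTateFormalGroup π f G)
    (n : ℕ) (I : Ideal (MvPowerSeries (Fin n) (LubinTateManinMumford.integers F))) :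
    Xor (LubinTateManinMumford.ContainsTorsionTranslate hEF f G I)
      (LubinTateManinMumford.BoundedAwayFromZero f I) := by
  have := LubinTateManinMumford.finiteDimensional_of_le hEF
  have h1 := LubinTateManinMumford.not_boundedAwayFromZero_of_contains (I := I) hEF (hπ.lubinTateData hG) hπ
  have h2 := LubinTateManinMumford.contains_of_not_boundedAwayFromZero (I := I) hEF (hπ.lubinTateData hG) hπ
  by_cases hb : LubinTateManinMumford.BoundedAwayFromZero f I
  · exact Or.inr ⟨hb, fun hc => h1 hc hb⟩
  · exact Or.inl ⟨h2 hb, hb⟩
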